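/- Let $\mathbb K\in\{\mathbb R,\mathbb C\}$, let $X,U_1,U_2,Y$ be Hilbert spaces over $\mathbb K$, with $Y\subseteq X$ continuously embedded, and consider the bilinear feedback system $$\dot z(t)=Az(t)+B_1u_1(t)+B_2N(z(t),y(t)),\qquad z(0)=z_0,\qquad y(t)=Cz(t).\tag{$\Sigma$}$$ Here $A$ generates a $C_0$-semigroup $(T(t))_{t\ge0}$ on $X$; for some $\beta\in\rho(A)$, $X_1$ is $D(A)$ with the norm $\|(\beta-A)x\|$ and $X_{-1}$ is the completion of $X$ for the norm $\|(\beta-A)^{-1}x\|$, to which $T(t)$ extends as $T_{-1}(t)$; $B_i\in\mathcal L(U_i,X_{-1})$ for $i=1,2$; $C\in\mathcal L(X_1,Y)$ has an extension $C\in\mathcal L(X)$; and $N:X\times Y\to U_2$ is continuous and bilinear with $\|N(z,y)\|_{U_2}\le K\|z\|_X\|y\|_X^{1-p_0}\|y\|_Y^{p_0}$ for some $K>0$, $p_0\in(0,1)$ and all $z\in X$, $y\in Y$. Write $L^2_{\rm loc}(0,\infty;U)$ for the functions that lie in $L^2(0,t;U)$ for every $t>0$. A (global) solution of $(\Sigma)$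 for $z_0\in X$ and $u_1\in L^2_{\rm loc}(0,\infty;U_1)$ is a function $z\in C([0,\infty);X)$ for which there is an output $y\in L^2_{\rm loc}(0,\infty;Y)$ with $y(t)=Cz(t)$ for a.e. $t>0$ and, for all $t\ge0$, $$z(t)=T(t)z_0+\Phi^1_tu_1+\Phi^2_tN(z,y),\qquad \Phi^i_tu=\int_0^tT_{-1}(t-s)B_iu(s)\,ds\in X .$$ Suppose that one of the following two assumptions holds. (1) $A$ is self-adjoint and there is $w_A<0$ with $\langle Az,z\rangle\le w_A\|z\|^2$ for all $z\in D(A)$; $B_i\in\mathcal L(U_i,X_{-1/2})$ for $i=1,2$ and $C\in\mathcal L(X_{1/2},Y)$, where $X_{1/2}$ is the completion of $D(A)$ for the norm $\langle -Az,z\rangle^{1/2}$ and $X_{-1/2}$ is its dual with respect to the pivot space $X$. (2) $A=A_0+L$ with $A_0$ skew-adjoint and $L\in\mathcal L(X)$, and there is $w_A<0$ with $\operatorname{Re}\langle Lz,z\rangle\le w_A\|z\|^2$ for all $z\in X$; $B_i\in\mathcal L(U_i,X)$ for $i=1,2$ and $C\in\mathcal L(X,Y)$. Suppose moreover that there are $m_1,m_2\in\mathbb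 R$ with $1-m_1>0$ and $(1-m_1)w_A+m_2<0$ such that $$|\langle N(z,Cz),B_2^*z\rangle_{U_2}|\le -m_1\operatorname{Re}\langle Az,z\rangle_X+m_2\|z\|_X^2\qquad\text{for all }z\in D(A),$$ where $B_2^*\in\mathcal L(X_{1/2},U_2)$ in case (1) and $B_2^*\in\mathcal L(X,U_2)$ in case (2). Then there are $\nu,c>0$ such that for every $z_0\in X$ and every $u_1\in L^2_{\rm loc}(0,\infty;U_1)$ the system $(\Sigma)$ admits a global solution $z$ which satisfies, for all $t\ge0$, $$\|z(t)\|_X\le\|z_0\|_Xe^{-\nu t}+c\,e^{-\nu t}\,\|e^{\nu\,\cdot}u_1\|_{L^2(0,t;U_1)}.$$ In particular, $(\Sigma)$ is (globally) $L^p$-ISS for every $p\in[2,\infty]$: there are $\beta\in\mathcal{KL}$ and $\gamma\in\mathcal K_\infty$ such that for all $z_0\in X$ and $u_1\in L^p(0,\infty;U_1)$ there is a unique solution $z$ of $(\Sigma)$, and $\|z(t)\|_X\le\beta(\|z_0\|_X,t)+\gamma(\|u_1\|_{L^p(0,t;U_1)})$ for all $t\ge0$. Here $\mathcal K_\infty$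 is the set of continuous, strictly increasing, unbounded $\gamma:[0,\infty)\to[0,\infty)$ with $\gamma(0)=0$, and $\mathcal{KL}$ is the set of continuous $\beta:[0,\infty)^2\to[0,\infty)$ such that $\beta(\cdot,t)$ is strictly increasing with $\beta(0,t)=0$ for all $t\ge0$ and $\beta(s,\cdot)$ is strictly decreasing to $0$ for all $s>0$. -/

import Mathlib

open MeasureTheory Filter Topology Set
open scoped NNReal ENNReal LinearPMap

noncomputable section

namespace BFS

section Semigroup

variable (𝕜 X : Type*) [RCLike 𝕜] [NormedAddCommGroup X] [NormedSpace 𝕜 X]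

/-- A `C₀`-semigroup `(T(t))_{t ≥ 0}` of bounded operators on `X`; the values of `T` at negative
times carry no information and are never used. -/
structure C0Semigroup where
  T : ℝ → X →L[𝕜] X
  map_zero : T 0 = ContinuousLinearMap.id 𝕜 X
  map_add : ∀ s t : ℝ, 0 ≤ s → 0 ≤ t → T (s + t) = (T s).comp (T t)
  continuousOn : ∀ x : X, ContinuousOn (fun t => T t x) (Ici 0)

end Semigroup

section Operators

variable {𝕜 X : Type*} [RCLike 𝕜] [NormedAddCommGroup X] [NormedSpace 𝕜 X]

/-- `A` is the generator of the semigroup: `x ∈ D(A)` and `A x = y` if and only if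
`(T(t) x - x) / t → y` as `t ↓ 0`. -/
def C0Semigroup.IsGenerator (T : C0Semigroup 𝕜 X) (A : X →ₗ.[𝕜] X) : Prop :=
  ∀ x y : X, (x, y) ∈ A.graph ↔
    Tendsto (fun t : ℝ => (t : 𝕜)⁻¹ • (T.T t x - x)) (𝓝[>] 0) (𝓝 y)

/-- `β` lies in the resolvent set of `A`, and `R = (β - A)⁻¹`. -/
structure IsResolvent (A : X →ₗ.[𝕜] X) (β : 𝕜) (R : X →L[𝕜] X) : Prop where
  mem_domain : ∀ x : X, R x ∈ A.domain
  right_inv : ∀ x : X, β • R x - A ⟨R x, mem_domain x⟩ = x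
  left_inv : ∀ x : A.domain, R (β • (x : X) - A x) = x

/-- A semigroup commutes with the resolvents of its generator. -/
theorem IsResolvent.commute {A : X →ₗ.[𝕜] X} {β : 𝕜} {R : X →L[𝕜] X} (hR : IsResolvent A β R)
    {T : C0Semigroup 𝕜 X} (hT : T.IsGenerator A) {t : ℝ} (ht : 0 ≤ t) (x : X) :
    R (T.T t x) = T.T t (R x) := by
  have h1 : (R x, A ⟨R x, hR.mem_domain x⟩) ∈ A.graph := A.mem_graph ⟨R x, hR.mem_domain x⟩
  have h2 := ((T.T t).continuous.tendsto _).comp ((hT _ _).1 h1)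
  have h3 : (T.T t (R x), T.T t (A ⟨R x, hR.mem_domain x⟩)) ∈ A.graph := by
    refine (hT _ _).2 (h2.congr' ?_)
    filter_upwards [self_mem_nhdsWithin] with s hs
    have e : T.T s (T.T t (R x)) = T.T t (T.T s (R x)) := by
      have := T.map_add s t (le_of_lt hs) ht
      rw [add_comm, T.map_add t s ht (le_of_lt hs)] at this
      exact (DFunLike.congr_fun this (R x)).symm
    simp [e]
  obtain ⟨y, hy1, hy2⟩ := (LinearPMap.mem_graph_iff A).1 h3
  have h4 := hR.left_inv y
  simp only at hy1 hy2
  rw [hy1, hy2, ← map_smul, ← map_sub, hR.right_inv] at h4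
  exact h4

/-- The space `X₁`: the domain of `A` with the norm `‖x‖₁ = ‖(β - A) x‖`. -/
def Interpolation (A : X →ₗ.[𝕜] X) (_β : 𝕜) : Type _ := A.domain

namespace Interpolation

variable (A : X →ₗ.[𝕜] X) (β : 𝕜)

instance : AddCommGroup (Interpolation A β) := inferInstanceAs (AddCommGroup A.domain)

instance : Module 𝕜 (Interpolation A β) := inferInstanceAs (Module 𝕜 A.domain)

/-- The element of `X₁` given by an element of the domain. -/
def of : A.domain →ₗ[𝕜] Interpolation A β := LinearMap.id

/-- The map `β - A : X₁ → X`. -/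
def betaSub : Interpolation A β →ₗ[𝕜] X := β • A.domain.subtype - A.toFun

instance : SeminormedAddCommGroup (Interpolation A β) :=
  SeminormedAddCommGroup.induced _ X (betaSub A β)

instance : NormedSpace 𝕜 (Interpolation A β) := NormedSpace.induced 𝕜 _ X (betaSub A β)

theorem norm_of (x : A.domain) : ‖of A β x‖ = ‖β • (x : X) - A x‖ := rfl

end Interpolation

/-- The space `X` with the norm `x ↦ ‖R x‖`, where `R = (β - A)⁻¹`. -/
def ResolventNormed (_R : X →L[𝕜] X) : Type _ := X

namespace ResolventNormed

variable (R : X →L[𝕜] X)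

instance : AddCommGroup (ResolventNormed R) := inferInstanceAs (AddCommGroup X)

instance : Module 𝕜 (ResolventNormed R) := inferInstanceAs (Module 𝕜 X)

/-- The identity, as a map from `X` to `X` with the norm `x ↦ ‖R x‖`. -/
def of : X ≃ₗ[𝕜] ResolventNormed R := LinearEquiv.refl 𝕜 X

instance : SeminormedAddCommGroup (ResolventNormed R) :=
  SeminormedAddCommGroup.induced _ X (R.toLinearMap.comp (of R).symm.toLinearMap)

instance : NormedSpace 𝕜 (ResolventNormed R) :=
  NormedSpace.induced 𝕜 _ X (R.toLinearMap.comp (of R).symm.toLinearMap)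

theorem norm_of (x : X) : ‖of R x‖ = ‖R x‖ := rfl

/-- An operator on `X` that commutes with `R` is bounded for the norm `x ↦ ‖R x‖`. -/
def lift (S : X →L[𝕜] X) (h : ∀ x, R (S x) = S (R x)) :
    ResolventNormed R →L[𝕜] ResolventNormed R :=
  LinearMap.mkContinuous ((of R).toLinearMap.comp (S.toLinearMap.comp (of R).symm.toLinearMap)) ‖S‖
    (fun x => by
      change ‖R (S ((of R).symm x))‖ ≤ ‖S‖ * ‖R ((of R).symm x)‖
      rw [h]
      exact S.le_opNorm _)

end ResolventNormed

/-- The extrapolation space `X₋₁`: the completion of `X` for the norm `x ↦ ‖(β - A)⁻¹ x‖`. -/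
def Extrapolation (R : X →L[𝕜] X) : Type _ := UniformSpace.Completion (ResolventNormed R)

namespace Extrapolation

variable (R : X →L[𝕜] X)

instance : NormedAddCommGroup (Extrapolation R) :=
  inferInstanceAs (NormedAddCommGroup (UniformSpace.Completion (ResolventNormed R)))

instance : NormedSpace 𝕜 (Extrapolation R) :=
  inferInstanceAs (NormedSpace 𝕜 (UniformSpace.Completion (ResolventNormed R)))

instance : CompleteSpace (Extrapolation R) :=
  inferInstanceAs (CompleteSpace (UniformSpace.Completion (ResolventNormed R)))

/-- The real structure of `X₋₁`, needed to integrate functions with values in `X₋₁`. -/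
instance : NormedSpace ℝ (Extrapolation R) := NormedSpace.restrictScalars ℝ 𝕜 (Extrapolation R)

/-- The canonical embedding of `X` in `X₋₁`. -/
def of : X →ₗ[𝕜] Extrapolation R :=
  (UniformSpace.Completion.toComplL (𝕜 := 𝕜) (E := ResolventNormed R)).toLinearMap.comp
    (ResolventNormed.of R).toLinearMap

theorem norm_of (x : X) : ‖of R x‖ = ‖R x‖ :=
  UniformSpace.Completion.norm_coe (ResolventNormed.of R x)

theorem denseRange_of : DenseRange (of R) :=
  UniformSpace.Completion.denseRange_coe (α := ResolventNormed R)

/-- The continuous extension to `X₋₁` of an operator on `X` that commutes with `(β - A)⁻¹`. -/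
def lift (S : X →L[𝕜] X) (h : ∀ x, R (S x) = S (R x)) : Extrapolation R →L[𝕜] Extrapolation R :=
  ContinuousLinearMap.completion (ResolventNormed.lift R S h)

theorem lift_of (S : X →L[𝕜] X) (h : ∀ x, R (S x) = S (R x)) (x : X) :
    lift R S h (of R x) = of R (S x) :=
  ContinuousLinearMap.completion_apply_coe (ResolventNormed.lift R S h) (ResolventNormed.of R x)

end Extrapolation

end Operators

section Half

variable {𝕜 X : Type*} [RCLike 𝕜] [NormedAddCommGroup X] [InnerProductSpace 𝕜 X] [CompleteSpace X]

/-- `A` is self-adjoint and strictly negative with constant `w < 0`. -/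
structure IsStrictlyNegative (A : X →ₗ.[𝕜] X) (w : ℝ) : Prop where
  isSelfAdjoint : IsSelfAdjoint A
  neg : w < 0
  re_inner_le : ∀ z : A.domain, RCLike.re (inner 𝕜 (z : X) (A z)) ≤ w * ‖(z : X)‖ ^ 2

theorem IsStrictlyNegative.inner_comm {A : X →ₗ.[𝕜] X} {w : ℝ} (h : IsStrictlyNegative A w)
    (x y : A.domain) : inner 𝕜 (A x) (y : X) = inner 𝕜 (x : X) (A y) := by
  have h1 := LinearPMap.adjoint_isFormalAdjoint h.isSelfAdjoint.dense_domain
  rw [LinearPMap.isSelfAdjoint_def.1 h.isSelfAdjoint] at h1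
  exact h1 x y

/-- The domain of `A`, to be equipped with the inner product `⟨-A z, w⟩`. -/
def FormDomain {A : X →ₗ.[𝕜] X} {w : ℝ} (_h : IsStrictlyNegative A w) : Type _ := A.domain

namespace FormDomain

variable {A : X →ₗ.[𝕜] X} {w : ℝ} (h : IsStrictlyNegative A w)

instance : AddCommGroup (FormDomain h) := inferInstanceAs (AddCommGroup A.domain)

instance : Module 𝕜 (FormDomain h) := inferInstanceAs (Module 𝕜 A.domain)

/-- The identity of `D(A)`. -/
def of : A.domain ≃ₗ[𝕜] FormDomain h := LinearEquiv.refl 𝕜 _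

/-- The inner product `⟨-A z, w⟩` on `D(A)`. -/
@[reducible] def core : InnerProductSpace.Core 𝕜 (FormDomain h) where
  inner x y := inner 𝕜 (((of h).symm x : A.domain) : X) (-A ((of h).symm y))
  conj_inner_symm x y := by
    rw [inner_conj_symm, inner_neg_left, inner_neg_right, h.inner_comm]
  re_inner_nonneg x := by
    have h1 := h.re_inner_le ((of h).symm x)
    have h2 := mul_nonneg (neg_nonneg.2 h.neg.le) (sq_nonneg ‖(((of h).symm x : A.domain) : X)‖)
    rw [inner_neg_right, map_neg]
    linarith
  add_left x y z := by simp [inner_add_left, add_comm]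
  smul_left x y r := by simp [inner_smul_left]
  definite x hx := by
    have h1 := h.re_inner_le ((of h).symm x)
    rw [inner_neg_right, neg_eq_zero] at hx
    rw [hx, map_zero] at h1
    have h2 : ‖(((of h).symm x : A.domain) : X)‖ ^ 2 = 0 := by
      have := sq_nonneg ‖(((of h).symm x : A.domain) : X)‖
      nlinarith [h.neg]
    have h3 : (of h).symm x = 0 := by
      apply Subtype.ext
      simpa using h2
    simpa using h3

instance : NormedAddCommGroup (FormDomain h) :=
  @InnerProductSpace.Core.toNormedAddCommGroup 𝕜 (FormDomain h) _ _ _ (core h)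

instance : InnerProductSpace 𝕜 (FormDomain h) :=
  InnerProductSpace.ofCore (core h).toCore

theorem inner_of (x y : A.domain) : inner 𝕜 (of h x) (of h y) = inner 𝕜 (x : X) (-A y) := rfl

theorem norm_sq_of (x : A.domain) : ‖of h x‖ ^ 2 = RCLike.re (inner 𝕜 (x : X) (-A x)) := by
  rw [← inner_of h, ← norm_sq_eq_re_inner (𝕜 := 𝕜)]

theorem norm_le (x : A.domain) : ‖(x : X)‖ ≤ (Real.sqrt (-w))⁻¹ * ‖of h x‖ := by
  have h1 := h.re_inner_le x
  have h2 := norm_sq_of h x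
  rw [inner_neg_right, map_neg] at h2
  have h3 : 0 < Real.sqrt (-w) := Real.sqrt_pos.2 (neg_pos.2 h.neg)
  have h4 : Real.sqrt (-w) ^ 2 = -w := Real.sq_sqrt (neg_nonneg.2 h.neg.le)
  rw [← div_eq_inv_mul, le_div_iff₀ h3]
  refine le_of_sq_le_sq ?_ (norm_nonneg _)
  rw [mul_pow, h4]
  linarith

/-- The inclusion of `D(A)` in `X`, as a bounded operator for the norm `⟨-A z, z⟩ ^ (1 / 2)`. -/
def incl : FormDomain h →L[𝕜] X :=
  LinearMap.mkContinuous (A.domain.subtype.comp (of h).symm.toLinearMap) (Real.sqrt (-w))⁻¹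
    (fun x => norm_le h ((of h).symm x))

end FormDomain

/-- The space `X_{1/2}`: the completion of `D(A)` for the norm `⟨-A z, z⟩ ^ (1 / 2)`. -/
abbrev Half {A : X →ₗ.[𝕜] X} {w : ℝ} (h : IsStrictlyNegative A w) : Type _ :=
  UniformSpace.Completion (FormDomain h)

/-- The embedding of `D(A)` in `X_{1/2}`. -/
def Half.of {A : X →ₗ.[𝕜] X} {w : ℝ} (h : IsStrictlyNegative A w) : A.domain →ₗ[𝕜] Half h :=
  (UniformSpace.Completion.toComplL (𝕜 := 𝕜) (E := FormDomain h)).toLinearMap.comp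
    (FormDomain.of h).toLinearMap

/-- The embedding of `X_{1/2}` in `X`. -/
def Half.incl {A : X →ₗ.[𝕜] X} {w : ℝ} (h : IsStrictlyNegative A w) : Half h →L[𝕜] X :=
  ContinuousLinearMap.fromCompletion (FormDomain.incl h)

theorem Half.incl_of {A : X →ₗ.[𝕜] X} {w : ℝ} (h : IsStrictlyNegative A w) (x : A.domain) :
    Half.incl h (Half.of h x) = x :=
  ContinuousLinearMap.fromCompletion_apply_coe (FormDomain.incl h) (FormDomain.of h x)

/-- The space `X_{-1/2}`: the dual of `X_{1/2}` with respect to the pivot space `X`, that is, the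
bounded conjugate-linear functionals on `X_{1/2}` (all bounded linear functionals in the real
case). The duality pairing `⟨f, y⟩` is `f y`. -/
abbrev NegHalf {A : X →ₗ.[𝕜] X} {w : ℝ} (h : IsStrictlyNegative A w) : Type _ :=
  Half h →L⋆[𝕜] 𝕜

/-- The embedding of the pivot space: `x ∈ X` is the functional whose pairing with
`y ∈ X_{1/2}` is the inner product of `x` and `y` (linear in `x`, conjugate-linear in `y`). -/
def NegHalf.of {A : X →ₗ.[𝕜] X} {w : ℝ} (h : IsStrictlyNegative A w) : X →L[𝕜] NegHalf h :=
  ((innerSL 𝕜 (E := X)).comp (Half.incl h)).flip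

theorem NegHalf.of_apply {A : X →ₗ.[𝕜] X} {w : ℝ} (h : IsStrictlyNegative A w) (x : X)
    (y : Half h) : NegHalf.of h x y = inner 𝕜 (Half.incl h y) x := rfl

/-- `f ∈ X_{-1/2}` and `g ∈ X₋₁` are the same element under the canonical embedding of `X_{-1/2}`
in `X₋₁`. This embedding is the continuous extension of the identity of `X`, which is dense in
`X_{-1/2}`, so its graph is the closure of the set of all `(x, x)` with `x ∈ X`. -/
def NegHalf.Represents {A : X →ₗ.[𝕜] X} {w : ℝ} (h : IsStrictlyNegative A w) (R : X →L[𝕜] X)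
    (f : NegHalf h) (g : Extrapolation R) : Prop :=
  (f, g) ∈ closure (range fun x : X => (NegHalf.of h x, Extrapolation.of R x))

/-- The adjoint `B^* : X_{1/2} → U` of `B : U → X_{-1/2}`. -/
def NegHalf.adjoint {A : X →ₗ.[𝕜] X} {w : ℝ} {h : IsStrictlyNegative A w}
    {U : Type*} [NormedAddCommGroup U] [InnerProductSpace 𝕜 U] [CompleteSpace U]
    (B : U →L[𝕜] NegHalf h) : Half h →L[𝕜] U :=
  ((InnerProductSpace.toDual 𝕜 U).symm.toContinuousLinearEquiv :
    StrongDual 𝕜 U →L⋆[𝕜] U).comp B.flip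

theorem NegHalf.inner_adjoint {A : X →ₗ.[𝕜] X} {w : ℝ} {h : IsStrictlyNegative A w}
    {U : Type*} [NormedAddCommGroup U] [InnerProductSpace 𝕜 U] [CompleteSpace U]
    (B : U →L[𝕜] NegHalf h) (z : Half h) (u : U) :
    inner 𝕜 (NegHalf.adjoint B z) u = B u z :=
  InnerProductSpace.toDual_symm_apply

end Half

section System

variable (𝕜 X U₁ U₂ Y : Type*) [RCLike 𝕜]
  [NormedAddCommGroup X] [InnerProductSpace 𝕜 X] [CompleteSpace X]
  [NormedAddCommGroup U₁] [InnerProductSpace 𝕜 U₁] [CompleteSpace U₁]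
  [NormedAddCommGroup U₂] [InnerProductSpace 𝕜 U₂] [CompleteSpace U₂]
  [NormedAddCommGroup Y] [InnerProductSpace 𝕜 Y] [CompleteSpace Y]

/-- The data of a bilinear feedback system
`z' = A z + B₁ u₁ + B₂ N(z, y)`, `z(0) = z₀`, `y = C z`. -/
structure System where
  /-- the generator of a `C₀`-semigroup -/
  A : X →ₗ.[𝕜] X
  semigroup : C0Semigroup 𝕜 X
  isGenerator : semigroup.IsGenerator A
  /-- a point of the resolvent set of `A` and the resolvent there, which fix the norms of `X₁` and
  `X₋₁` -/
  β : 𝕜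
  R : X →L[𝕜] X
  isResolvent : IsResolvent A β R
  /-- the control operators -/
  B₁ : U₁ →L[𝕜] Extrapolation R
  B₂ : U₂ →L[𝕜] Extrapolation R
  /-- the continuous embedding of `Y` in `X` -/
  ι : Y →L[𝕜] X
  ι_injective : Function.Injective ι
  /-- the observation operator, as a bounded operator from `X₁` to `Y` -/
  C₁ : Interpolation A β →L[𝕜] Y
  /-- its extension to a bounded operator on `X` -/
  C : X →L[𝕜] X
  ι_C₁ : ∀ x : A.domain, ι (C₁ (Interpolation.of A β x)) = C x
  /-- the bilinear feedback law -/
  N : X →L[𝕜] Y →L[𝕜] U₂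
  N_bound : ∃ K > (0 : ℝ), ∃ p ∈ Ioo (0 : ℝ) 1, ∀ (z : X) (y : Y),
    ‖N z y‖ ≤ K * ‖z‖ * ‖ι y‖ ^ (1 - p) * ‖y‖ ^ p

variable {𝕜 X U₁ U₂ Y}

namespace System

variable (S : System 𝕜 X U₁ U₂ Y)

/-- The operator `T₋₁(t)` on `X₋₁`, the continuous extension of `T(t)`, for `t ≥ 0`
(and `0` for `t < 0`, which is never used). -/
def Tneg (t : ℝ) : Extrapolation S.R →L[𝕜] Extrapolation S.R :=
  if ht : 0 ≤ t then
    Extrapolation.lift S.R (S.semigroup.T t) (S.isResolvent.commute S.isGenerator ht)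
  else 0

/-- The integral `∫₀ᵗ T₋₁(t - s) B u(s) ds` in `X₋₁`. -/
def inputIntegral {U : Type*} [NormedAddCommGroup U] [NormedSpace 𝕜 U]
    (B : U →L[𝕜] Extrapolation S.R) (t : ℝ) (u : ℝ → U) : Extrapolation S.R :=
  ∫ s in (0 : ℝ)..t, S.Tneg (t - s) (B (u s))

end System

/-- `u ∈ L²(0, t)` for every `t > 0`. -/
def MemL2Loc {E : Type*} [NormedAddCommGroup E] (u : ℝ → E) : Prop :=
  ∀ t : ℝ, 0 < t → MemLp u 2 (volume.restrict (Ioc 0 t))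

namespace System

variable (S : System 𝕜 X U₁ U₂ Y)

/-- `x` and `y` are the state trajectory and the output of the linear system
`x' = A x + B₁ u₁ + B₂ u₂`, `x(0) = x₀`, `y = C x`: `x ∈ C([0, ∞); X)`,
`y ∈ L²_loc(0, ∞; Y)`, `x(t) = T(t) x₀ + Φ¹_t u₁ + Φ²_t u₂` with `Φⁱ_t uᵢ ∈ X`, and
`y(t) = C x(t)` for almost every `t > 0`. -/
structure IsLinearSolution (x₀ : X) (u₁ : ℝ → U₁) (u₂ : ℝ → U₂) (x : ℝ → X) (y : ℝ → Y) :
    Prop where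
  continuousOn : ContinuousOn x (Ici 0)
  memL2Loc : MemL2Loc y
  state : ∀ t : ℝ, 0 ≤ t → ∃ φ₁ φ₂ : X,
    Extrapolation.of S.R φ₁ = S.inputIntegral S.B₁ t u₁ ∧
    Extrapolation.of S.R φ₂ = S.inputIntegral S.B₂ t u₂ ∧
    x t = S.semigroup.T t x₀ + φ₁ + φ₂
  output : ∀ᵐ t ∂volume.restrict (Ioi (0 : ℝ)), S.ι (y t) = S.C (x t)

/-- `z` and `y` are a (global) solution and output of the bilinear feedback system with input data
`z₀` and `u₁`: they are the state trajectory and the output of the linear system with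
`u₂ = N(z, y)`. -/
def IsSolutionOutput (z₀ : X) (u₁ : ℝ → U₁) (z : ℝ → X) (y : ℝ → Y) : Prop :=
  S.IsLinearSolution z₀ u₁ (fun t => S.N (z t) (y t)) z y

/-- `z` is a (global) solution of the bilinear feedback system with input data `z₀` and `u₁`. -/
def IsSolution (z₀ : X) (u₁ : ℝ → U₁) (z : ℝ → X) : Prop :=
  ∃ y : ℝ → Y, S.IsSolutionOutput z₀ u₁ z y

/-- The decay inequality `|⟨N(z, C z), B₂^* z⟩| ≤ -m₁ Re ⟨A z, z⟩ + m₂ ‖z‖²` for all `z ∈ D(A)`,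
with constants such that `1 - m₁ > 0` and `(1 - m₁) w + m₂ < 0`. The operator `B₂^*` enters through
its values on `D(A)`. -/
def Decay (w : ℝ) (B₂adj : S.A.domain → U₂) : Prop :=
  ∃ m₁ m₂ : ℝ, 0 < 1 - m₁ ∧ (1 - m₁) * w + m₂ < 0 ∧ ∀ z : S.A.domain,
    ‖inner 𝕜 (B₂adj z) (S.N z (S.C₁ (Interpolation.of S.A S.β z)))‖ ≤
      -m₁ * RCLike.re (inner 𝕜 (z : X) (S.A z)) + m₂ * ‖(z : X)‖ ^ 2

/-- `A` is self-adjoint and strictly negative, `Bᵢ ∈ L(Uᵢ, X_{-1/2})` and `C ∈ L(X_{1/2}, Y)`. -/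
structure SelfAdjointCase where
  w : ℝ
  strictlyNegative : IsStrictlyNegative S.A w
  B₁ : U₁ →L[𝕜] NegHalf strictlyNegative
  B₂ : U₂ →L[𝕜] NegHalf strictlyNegative
  represents₁ : ∀ u, NegHalf.Represents strictlyNegative S.R (B₁ u) (S.B₁ u)
  represents₂ : ∀ u, NegHalf.Represents strictlyNegative S.R (B₂ u) (S.B₂ u)
  C : Half strictlyNegative →L[𝕜] Y
  C_of : ∀ x : S.A.domain,
    C (Half.of strictlyNegative x) = S.C₁ (Interpolation.of S.A S.β x)

/-- The decay inequality in the self-adjoint case, with `B₂^* : X_{1/2} → U₂`. -/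
def SelfAdjointCase.HasDecay {S : System 𝕜 X U₁ U₂ Y} (a : S.SelfAdjointCase) : Prop :=
  S.Decay a.w (fun z => NegHalf.adjoint a.B₂ (Half.of a.strictlyNegative z))

/-- `A = A₀ + L` with `A₀` skew-adjoint and `L ∈ L(X)` strictly dissipative, `Bᵢ ∈ L(Uᵢ, X)` and
`C ∈ L(X, Y)`. -/
structure SkewAdjointCase where
  w : ℝ
  A₀ : X →ₗ.[𝕜] X
  dense_domain : Dense (A₀.domain : Set X)
  skewAdjoint : A₀† = -A₀
  L : X →L[𝕜] X
  eq_add : S.A = A₀ + L.toLinearMap.toPMap ⊤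
  neg : w < 0
  re_inner_le : ∀ z : X, RCLike.re (inner 𝕜 z (L z)) ≤ w * ‖z‖ ^ 2
  B₁ : U₁ →L[𝕜] X
  B₂ : U₂ →L[𝕜] X
  of_B₁ : ∀ u, Extrapolation.of S.R (B₁ u) = S.B₁ u
  of_B₂ : ∀ u, Extrapolation.of S.R (B₂ u) = S.B₂ u
  C : X →L[𝕜] Y
  C_coe : ∀ x : S.A.domain, C x = S.C₁ (Interpolation.of S.A S.β x)

/-- The decay inequality in the skew-adjoint case, with the Hilbert space adjoint
`B₂^* : X → U₂`. -/
def SkewAdjointCase.HasDecay {S : System 𝕜 X U₁ U₂ Y} (a : S.SkewAdjointCase) : Prop :=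
  S.Decay a.w (fun z => ContinuousLinearMap.adjoint a.B₂ (z : X))

end System

/-- The class `𝒦ℒ` of comparison functions. -/
structure IsKL (β : ℝ≥0 → ℝ≥0 → ℝ≥0) : Prop where
  continuous : Continuous (Function.uncurry β)
  strictMono : ∀ t, StrictMono (fun s => β s t)
  map_zero : ∀ t, β 0 t = 0
  strictAnti : ∀ s, 0 < s → StrictAnti (β s)
  tendsto_zero : ∀ s, 0 < s → Tendsto (β s) atTop (𝓝 0)

/-- The class `𝒦_∞` of comparison functions. -/
structure IsKInfty (γ : ℝ≥0 → ℝ≥0) : Prop where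
  continuous : Continuous γ
  map_zero : γ 0 = 0
  strictMono : StrictMono γ
  tendsto_atTop : Tendsto γ atTop atTop

/-- The bilinear feedback system is (globally) `L^p`-ISS: for all `z₀ ∈ X` and
`u₁ ∈ L^p(0, ∞; U₁)` there is a unique solution `z`, and
`‖z(t)‖ ≤ β(‖z₀‖, t) + γ(‖u₁‖_{L^p(0, t)})` for all `t ≥ 0`. -/
def System.IsLpISS (S : System 𝕜 X U₁ U₂ Y) (p : ℝ≥0∞) : Prop :=
  ∃ (β : ℝ≥0 → ℝ≥0 → ℝ≥0) (γ : ℝ≥0 → ℝ≥0), IsKL β ∧ IsKInfty γ ∧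
    ∀ (z₀ : X) (u₁ : ℝ → U₁), MemLp u₁ p (volume.restrict (Ioi 0)) →
      ∃ z : ℝ → X, S.IsSolution z₀ u₁ z ∧
        (∀ z' : ℝ → X, S.IsSolution z₀ u₁ z' → EqOn z' z (Ici 0)) ∧
        ∀ t : ℝ≥0, ‖z t‖₊ ≤
          β ‖z₀‖₊ t + γ (eLpNorm u₁ p (volume.restrict (Ioc 0 (t : ℝ)))).toNNReal

end System

end BFS

end

/-!
The proof rests on the energy `‖z(t)‖²`. Formally, a solution satisfies
`d/dt ‖z‖² = 2 Re ⟨A z, z⟩ + 2 Re ⟨B₁ u₁, z⟩ + 2 Re ⟨B₂ N(z, C z), z⟩`, and the decay inequality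
bounds the last term by `-2 m₁ Re ⟨A z, z⟩ + 2 m₂ ‖z‖²`. A small part of the dissipation
`2 (1 - m₁) Re ⟨A z, z⟩` absorbs `B₁ u₁`, and since `(1 - m₁) w_A + m₂ < 0` the sum is at most
`-2 ν ‖z‖² + c² ‖u₁‖²`. Multiplication by `exp (2 ν t)` and integration give the estimate.

Both cases are treated at once, by a form domain `V ⊆ X` on which `z ↦ Re ⟨A z, z⟩` extends to a
coercive quadratic expression `q`, with control operators in the dual of `V` and `C` bounded on `V`
(`FormData`). In the self-adjoint case `V = X_{1/2}` and `q(v) = -‖v‖²`; in the skew-adjoint case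
`V = X` and `q(v) = Re ⟨L v, v⟩`, because `A₀` does not contribute.

For data in the range of the resolvent, mild solutions are classical and the energy identity holds
by differentiation (`FormData.energy_mild`). Coercivity bounds the trajectory, in `C([0, T]; X)` and
in `L²(0, T; V)`, by the data in `X` and in `L²` of the dual of `V`. So solutions of the linear
equation with general data are limits of classical ones, inherit the energy identity
(`FormData.LinSol.energy`), and take values in `X`; this yields the input maps `Φⁱ`
(`FormData.exists_linSol_input`).

The feedback is treated as an input. By Young's inequality, `N(z, C z')` is bounded by
`‖z‖_X (δ ‖z'‖_V + c ‖z'‖_X)` with arbitrarily small `δ`, so that on bounded sets of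
trajectories and over short time intervals the feedback, as a map on `L²(s, t; U₂)`, is Lipschitz
continuous with a small constant (`FormData.exists_feedback_lipschitz`). This gives uniqueness, and
a contraction that continues a solution by a time step depending only on the input and on a bound
for the norm of the solution (`FormData.exists_step`). The energy estimate is such a bound
(`FormData.HasDecay.exists_bound`), so finitely many steps reach any time. Finally, the weighted
`L²`-norm in the estimate is bounded by the `Lᵖ`-norm of the input with Hölder's inequality, since
the weight `exp (-2 ν (t - s))` is integrable uniformly in `t` (`exp_mul_eLpNorm_le`).
-/

set_option linter.unusedSectionVars false

noncomputable section

open MeasureTheory Filter Topology Set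
open scoped NNReal ENNReal LinearPMap

/-! ### Convergence in `L²` and density of continuous functions -/

namespace BFS

section L2

variable {α E F : Type*} [MeasurableSpace α] {μ : Measure α} [NormedAddCommGroup E]
  [NormedAddCommGroup F]

theorem sq_toReal_eLpNorm_two {u : α → E} (hu : MemLp u 2 μ) :
    (eLpNorm u 2 μ).toReal ^ 2 = ∫ a, ‖u a‖ ^ 2 ∂μ := by
  have h0 : 0 ≤ ∫ a, ‖u a‖ ^ 2 ∂μ := integral_nonneg fun a => by positivity
  rw [hu.eLpNorm_eq_integral_rpow_norm (by norm_num) (by norm_num)]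
  simp only [ENNReal.toReal_ofNat, Real.rpow_ofNat]
  rw [ENNReal.toReal_ofReal (Real.rpow_nonneg h0 _), ← Real.rpow_natCast, ← Real.rpow_mul h0]
  norm_num

theorem integrable_norm_sq {u : α → E} (hu : MemLp u 2 μ) :
    Integrable (fun a => ‖u a‖ ^ 2) μ := by
  have := MemLp.integrable_norm_pow (p := 2) (f := u) (μ := μ) (by simpa using hu) (by norm_num)
  exact this

/-- A function with a quadratic local Lipschitz bound is continuous. -/
theorem continuous_of_quadratic {Q : E → ℝ} {M : ℝ}
    (hQ : ∀ a b, |Q a - Q b| ≤ M * (‖a‖ + ‖b‖) * ‖a - b‖) : Continuous Q := by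
  rw [continuous_iff_continuousAt]
  intro b
  rw [ContinuousAt, tendsto_iff_dist_tendsto_zero]
  have h : Tendsto (fun a => M * (‖a‖ + ‖b‖) * ‖a - b‖) (𝓝 b) (𝓝 (M * (‖b‖ + ‖b‖) * ‖b - b‖)) := by
    apply Continuous.tendsto
    fun_prop
  rw [sub_self, norm_zero, mul_zero] at h
  exact squeeze_zero (fun _ => dist_nonneg) (fun a => by rw [Real.dist_eq]; exact hQ a b) h

theorem integrable_of_quadratic {Q : E → ℝ} {M : ℝ} (hQ0 : Q 0 = 0)
    (hQ : ∀ a b, |Q a - Q b| ≤ M * (‖a‖ + ‖b‖) * ‖a - b‖) {p : α → E} (hp : MemLp p 2 μ) :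
    Integrable (fun a => Q (p a)) μ := by
  refine Integrable.mono' ((integrable_norm_sq hp).const_mul M)
    ((continuous_of_quadratic hQ).comp_aestronglyMeasurable hp.1) (Eventually.of_forall fun a => ?_)
  have := hQ (p a) 0
  simp only [hQ0, sub_zero, norm_zero, add_zero] at this
  rw [Real.norm_eq_abs]
  linarith [sq (‖p a‖)]

/-- Weighted integrals of quadratic expressions are continuous for convergence in `L²`. -/
theorem tendsto_integral_of_quadratic {Q : E → ℝ} {M : ℝ} (hQ0 : Q 0 = 0)
    (hQ : ∀ a b, |Q a - Q b| ≤ M * (‖a‖ + ‖b‖) * ‖a - b‖) {ρ : α → ℝ} {c : ℝ}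
    (hρ : AEStronglyMeasurable ρ μ) (hc : ∀ᵐ a ∂μ, |ρ a| ≤ c) {p : α → E} {q : ℕ → α → E}
    (hp : MemLp p 2 μ) (hq : ∀ n, MemLp (q n) 2 μ)
    (h : Tendsto (fun n => eLpNorm (q n - p) 2 μ) atTop (𝓝 0)) :
    Tendsto (fun n => ∫ a, ρ a * Q (q n a) ∂μ) atTop (𝓝 (∫ a, ρ a * Q (p a) ∂μ)) := by
  have hint : ∀ {f : α → E}, MemLp f 2 μ → Integrable (fun a => ρ a * Q (f a)) μ := by
    intro f hf
    exact (integrable_of_quadratic hQ0 hQ hf).bdd_mul hρ hc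
  refine tendsto_integral_of_L1' _ (hint hp).1 (Eventually.of_forall fun n => hint (hq n)) ?_
  have hb : ∀ n, eLpNorm ((fun a => ρ a * Q (q n a)) - fun a => ρ a * Q (p a)) 1 μ ≤
      (Real.toNNReal (c * M) : ℝ≥0∞) * (eLpNorm (q n - p) 2 μ + 2 * eLpNorm p 2 μ) *
        eLpNorm (q n - p) 2 μ := by
    intro n
    have hs : MemLp (q n - p) 2 μ := (hq n).sub hp
    have h1 : eLpNorm ((fun a => ρ a * Q (q n a)) - fun a => ρ a * Q (p a)) 1 μ ≤
        (Real.toNNReal (c * M) : ℝ≥0∞) * eLpNorm (fun a => ‖q n a‖ + ‖p a‖) 2 μ *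
          eLpNorm (q n - p) 2 μ := by
      refine le_trans ?_ (eLpNorm_le_eLpNorm_mul_eLpNorm'_of_norm (p := 2) (q := 2) (r := 1)
        ((hq n).1.norm.add hp.1.norm) hs.1
        (fun (x : ℝ) (y : E) => (Real.toNNReal (c * M) : ℝ) * x * ‖y‖) (Real.toNNReal (c * M))
        (Eventually.of_forall fun a => ?_))
      · refine eLpNorm_mono_ae (hc.mono fun a ha => ?_)
        have h2 := hQ (q n a) (p a)
        have h3 : |ρ a| * |Q (q n a) - Q (p a)| ≤
            c * (M * (‖q n a‖ + ‖p a‖) * ‖q n a - p a‖) :=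
          mul_le_mul ha h2 (abs_nonneg _) ((abs_nonneg _).trans ha)
        simp only [Pi.sub_apply]
        rw [← mul_sub, norm_mul, Real.norm_eq_abs, Real.norm_eq_abs, Real.norm_eq_abs]
        refine h3.trans (le_trans ?_ (le_abs_self _))
        have h4 : c * M ≤ (Real.toNNReal (c * M) : ℝ) := Real.le_coe_toNNReal _
        calc c * (M * (‖q n a‖ + ‖p a‖) * ‖q n a - p a‖)
            = c * M * ((‖q n a‖ + ‖p a‖) * ‖q n a - p a‖) := by ring
          _ ≤ (Real.toNNReal (c * M) : ℝ) * ((‖q n a‖ + ‖p a‖) * ‖q n a - p a‖) :=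
              mul_le_mul_of_nonneg_right h4 (by positivity)
          _ = _ := by simp only [Pi.add_apply]; ring
      · simp [abs_of_nonneg]
    refine h1.trans ?_
    gcongr
    calc eLpNorm (fun a => ‖q n a‖ + ‖p a‖) 2 μ
        ≤ eLpNorm (fun a => ‖(q n - p) a‖ + (‖p a‖ + ‖p a‖)) 2 μ := by
          refine eLpNorm_mono_real fun a => ?_
          rw [Real.norm_eq_abs, abs_of_nonneg (by positivity)]
          have : ‖q n a‖ ≤ ‖(q n - p) a‖ + ‖p a‖ := by
            simpa using norm_add_le ((q n - p) a) (p a)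
          linarith
      _ ≤ eLpNorm (fun a => ‖(q n - p) a‖) 2 μ + eLpNorm (fun a => ‖p a‖ + ‖p a‖) 2 μ :=
          eLpNorm_add_le hs.1.norm (hp.1.norm.add hp.1.norm) (by norm_num)
      _ ≤ eLpNorm (q n - p) 2 μ + 2 * eLpNorm p 2 μ := by
          rw [eLpNorm_norm, two_mul]
          gcongr
          refine (eLpNorm_add_le hp.1.norm hp.1.norm (by norm_num)).trans ?_
          rw [eLpNorm_norm]
  have hlim : Tendsto (fun n => (Real.toNNReal (c * M) : ℝ≥0∞) *
      (eLpNorm (q n - p) 2 μ + 2 * eLpNorm p 2 μ) * eLpNorm (q n - p) 2 μ) atTop (𝓝 0) := by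
    have h2 : 2 * eLpNorm p 2 μ ≠ ∞ := ENNReal.mul_ne_top (by norm_num) hp.eLpNorm_ne_top
    have h3 : Tendsto (fun n => (Real.toNNReal (c * M) : ℝ≥0∞) *
      (eLpNorm (q n - p) 2 μ + 2 * eLpNorm p 2 μ)) atTop
        (𝓝 ((Real.toNNReal (c * M) : ℝ≥0∞) * (0 + 2 * eLpNorm p 2 μ))) :=
      ENNReal.Tendsto.const_mul (h.add tendsto_const_nhds) (Or.inr ENNReal.coe_ne_top)
    have h4 := ENNReal.Tendsto.mul h3 (Or.inr ENNReal.zero_ne_top) h (Or.inr (by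
      rw [zero_add]; exact ENNReal.mul_ne_top ENNReal.coe_ne_top h2))
    simpa using h4
  exact tendsto_of_tendsto_of_tendsto_of_le_of_le tendsto_const_nhds hlim (fun _ => zero_le) hb

theorem tendsto_eLpNorm_two_add {f g : α → E} {fn gn : ℕ → α → E}
    (hf : MemLp f 2 μ) (hg : MemLp g 2 μ) (hfn : ∀ n, MemLp (fn n) 2 μ)
    (hgn : ∀ n, MemLp (gn n) 2 μ)
    (h1 : Tendsto (fun n => eLpNorm (fn n - f) 2 μ) atTop (𝓝 0))
    (h2 : Tendsto (fun n => eLpNorm (gn n - g) 2 μ) atTop (𝓝 0)) :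
    Tendsto (fun n => eLpNorm ((fn n + gn n) - (f + g)) 2 μ) atTop (𝓝 0) := by
  have h3 := h1.add h2
  rw [add_zero] at h3
  refine tendsto_of_tendsto_of_tendsto_of_le_of_le tendsto_const_nhds h3 (fun _ => zero_le) ?_
  intro n
  have : (fn n + gn n) - (f + g) = (fn n - f) + (gn n - g) := by abel
  simp only [this]
  exact eLpNorm_add_le ((hfn n).sub hf).1 ((hgn n).sub hg).1 (by norm_num)

theorem tendsto_eLpNorm_two_clm {𝕜 : Type*} [NontriviallyNormedField 𝕜] [NormedSpace 𝕜 E]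
    [NormedSpace 𝕜 F] (L : E →L[𝕜] F) {f : α → E} {fn : ℕ → α → E}
    (h : Tendsto (fun n => eLpNorm (fn n - f) 2 μ) atTop (𝓝 0)) :
    Tendsto (fun n => eLpNorm ((fun a => L (fn n a)) - fun a => L (f a)) 2 μ) atTop (𝓝 0) := by
  have h1 : Tendsto (fun n => (‖L‖₊ : ℝ≥0∞) * eLpNorm (fn n - f) 2 μ) atTop (𝓝 0) := by
    simpa using ENNReal.Tendsto.const_mul h (Or.inr ENNReal.coe_ne_top)
  refine tendsto_of_tendsto_of_tendsto_of_le_of_le tendsto_const_nhds h1 (fun _ => zero_le) ?_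
  intro n
  refine eLpNorm_le_nnreal_smul_eLpNorm_of_ae_le_mul (Eventually.of_forall fun a => ?_) 2
  simp only [Pi.sub_apply, ← map_sub]
  exact L.le_opNNNorm _

end L2

section Joint

variable {𝕜 E : Type*} [RCLike 𝕜] [NormedAddCommGroup E] [NormedSpace 𝕜 E]

/-- A family of contractions that is strongly continuous on a dense set is jointly continuous. -/
theorem continuous_uncurry_of_contraction {ι : Type*} {D : ι → E} (hD : DenseRange D)
    {S : ℝ → E →L[𝕜] E} (hS : ∀ r x, ‖S r x‖ ≤ ‖x‖) (hc : ∀ i, Continuous fun r => S r (D i)) :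
    Continuous fun q : ℝ × E => S q.1 q.2 := by
  rw [continuous_iff_continuousAt]
  rintro ⟨r, x⟩
  rw [ContinuousAt, Metric.tendsto_nhds]
  intro ε hε
  obtain ⟨i, hi⟩ := hD.exists_dist_lt x (show 0 < ε / 4 by positivity)
  have h1 : ∀ᶠ q : ℝ × E in 𝓝 (r, x), dist (S q.1 (D i)) (S r (D i)) < ε / 4 :=
    ((hc i).comp continuous_fst).continuousAt.eventually (Metric.ball_mem_nhds _ (by positivity))
  have h2 : ∀ᶠ q : ℝ × E in 𝓝 (r, x), dist q.2 x < ε / 4 :=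
    continuous_snd.continuousAt.eventually (Metric.ball_mem_nhds _ (by positivity))
  filter_upwards [h1, h2] with q hq1 hq2
  rw [dist_eq_norm] at *
  have e : S q.1 q.2 - S r x =
      S q.1 (q.2 - x) + S q.1 (x - D i) + (S q.1 (D i) - S r (D i)) + S r (D i - x) := by
    simp only [map_sub]; abel
  rw [e]
  refine (norm_add₄_le).trans_lt ?_
  have h3 := hS q.1 (q.2 - x)
  have h4 := hS q.1 (x - D i)
  have h5 := hS r (D i - x)
  rw [norm_sub_rev] at h5
  linarith

end Joint

section Density

variable {U W Z X : Type*} [NormedAddCommGroup U] [NormedAddCommGroup W] [NormedAddCommGroup Z]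
  [NormedAddCommGroup X] {𝕜 : Type*} [RCLike 𝕜] [NormedSpace 𝕜 U] [NormedSpace 𝕜 W]
  [NormedSpace 𝕜 Z] [NormedSpace 𝕜 X]

/-- If every value of `B` is a limit of values of `D : X → W`, then for `u ∈ L²` the function
`B u` is an `L²`-limit of functions `D g` with `g` continuous. -/
theorem exists_continuous_approx (μ : Measure ℝ) [IsFiniteMeasure μ]
    (B : U →L[𝕜] W) (D : X →L[𝕜] W) (hB : ∀ u, B u ∈ closure (range D))
    {u : ℝ → U} (hu : MemLp u 2 μ) {ε : ℝ≥0∞} (hε : ε ≠ 0) :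
    ∃ g : ℝ → X, Continuous g ∧ eLpNorm ((fun s => D (g s)) - fun s => B (u s)) 2 μ ≤ ε := by
  set P : (ℝ → U) → Prop := fun h => AEStronglyMeasurable h μ ∧ ∀ ε : ℝ≥0∞, ε ≠ 0 →
    ∃ g : ℝ → X, Continuous g ∧ eLpNorm ((fun s => D (g s)) - fun s => B (h s)) 2 μ ≤ ε with hP
  have aesm : ∀ {h : ℝ → U} {g : ℝ → X}, AEStronglyMeasurable h μ → Continuous g →
      AEStronglyMeasurable ((fun s => D (g s)) - fun s => B (h s)) μ := fun hh hg =>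
    ((D.continuous.comp hg).aestronglyMeasurable).sub (B.continuous.comp_aestronglyMeasurable hh)
  have h0 : ∀ (c : U) ⦃s : Set ℝ⦄, MeasurableSet s → μ s < ⊤ → P (s.indicator fun _ => c) := by
    intro c s hs _
    refine ⟨(stronglyMeasurable_const.indicator hs).aestronglyMeasurable, fun ε hε => ?_⟩
    have hε2 : ε / 2 ≠ 0 := by simpa using hε
    -- replace `B c` by a value `D x`
    obtain ⟨δ, hδ, hδε⟩ : ∃ δ : ℝ≥0, 0 < δ ∧ (δ : ℝ≥0∞) * μ univ ^ (2⁻¹ : ℝ) ≤ ε / 2 := by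
      have hfin : μ univ ^ (2⁻¹ : ℝ) ≠ ∞ :=
        ENNReal.rpow_ne_top_of_nonneg (by norm_num) (measure_ne_top _ _)
      obtain ⟨δ, hδ, h⟩ := ENNReal.exists_nnreal_pos_mul_lt hfin hε2
      exact ⟨δ, hδ, h.le⟩
    obtain ⟨_, ⟨x, rfl⟩, hx⟩ := Metric.mem_closure_iff.1 (hB c) δ hδ
    -- replace the indicator function by a continuous function
    obtain ⟨φ, -, hφ1, hφ2, -⟩ := (memLp_indicator_const (μ := μ) 2 hs (1 : 𝕜)
      (Or.inr (measure_ne_top _ _))).exists_hasCompactSupport_eLpNorm_sub_le (by norm_num)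
      (ε := ε / 2 / (‖D x‖₊ + 1 : ℝ≥0)) (by
        simp only [ne_eq, ENNReal.div_eq_zero_iff, not_or]
        exact ⟨by simpa using hε, ENNReal.coe_ne_top⟩)
    refine ⟨fun t => φ t • x, by fun_prop, ?_⟩
    have e : ((fun t => D (φ t • x)) - fun t => B (s.indicator (fun _ => c) t)) =
        (fun t => (φ - s.indicator fun _ => (1 : 𝕜)) t • D x) +
          fun t => s.indicator (fun _ => D x - B c) t := by
      funext t
      by_cases ht : t ∈ s <;> simp [ht, sub_smul]
    rw [e]
    refine (eLpNorm_add_le ?_ ?_ (by norm_num)).trans ?_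
    · exact ((hφ2.aestronglyMeasurable).sub
        (stronglyMeasurable_const.indicator hs).aestronglyMeasurable).smul_const _
    · exact (stronglyMeasurable_const.indicator hs).aestronglyMeasurable
    rw [← ENNReal.add_halves ε]
    refine add_le_add ?_ ?_
    · have h1 : eLpNorm (fun t => (φ - s.indicator fun _ => (1 : 𝕜)) t • D x) 2 μ ≤
          ((‖D x‖₊ + 1 : ℝ≥0) : ℝ≥0∞) * eLpNorm (φ - s.indicator fun _ => (1 : 𝕜)) 2 μ := by
        refine eLpNorm_le_nnreal_smul_eLpNorm_of_ae_le_mul (Eventually.of_forall fun a => ?_) 2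
        rw [nnnorm_smul, mul_comm]
        gcongr
        exact le_self_add
      refine h1.trans ?_
      rw [eLpNorm_sub_comm] at hφ1
      refine (mul_le_mul_right hφ1 _).trans ?_
      rw [ENNReal.mul_div_cancel (by simp) ENNReal.coe_ne_top]
    · refine le_trans ?_ hδε
      have h1 : eLpNorm (fun t => s.indicator (fun _ => D x - B c) t) 2 μ ≤
          eLpNorm (fun _ => (δ : ℝ)) 2 μ := by
        refine eLpNorm_mono fun t => ?_
        rw [norm_indicator_eq_indicator_norm]
        refine (Set.indicator_le_self' (by intros; positivity) t).trans ?_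
        rw [← dist_eq_norm, dist_comm]
        simpa using hx.le
      refine h1.trans ?_
      refine (eLpNorm_le_of_ae_bound (C := δ) (Eventually.of_forall fun t => by simp)).trans ?_
      simp [mul_comm]
  have hPu : ∀ {δ : ℝ≥0∞}, δ ≠ 0 → ∃ h, eLpNorm (u - h) 2 μ ≤ δ ∧ P h := by
    intro δ hδ
    refine MemLp.induction_dense (by norm_num) P ?_ ?_ (fun f hf => hf.1) hu hδ
    · intro c s hs hμ δ _
      exact ⟨_, by simp, h0 c hs hμ⟩
    · rintro f g ⟨hf, hf'⟩ ⟨hg, hg'⟩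
      refine ⟨hf.add hg, fun ε hε => ?_⟩
      obtain ⟨a, ha, ha'⟩ := hf' (ε / 2) (by simpa using hε)
      obtain ⟨b, hb, hb'⟩ := hg' (ε / 2) (by simpa using hε)
      refine ⟨a + b, ha.add hb, ?_⟩
      have e : ((fun s => D ((a + b) s)) - fun s => B ((f + g) s)) =
          ((fun s => D (a s)) - fun s => B (f s)) + ((fun s => D (b s)) - fun s => B (g s)) := by
        funext s; simp; abel
      rw [e, ← ENNReal.add_halves ε]
      exact (eLpNorm_add_le (aesm hf ha) (aesm hg hb) (by norm_num)).trans (add_le_add ha' hb')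
  obtain ⟨h, hh, hP'⟩ := hPu (δ := ε / 2 / (‖B‖₊ + 1 : ℝ≥0)) (by
    simp only [ne_eq, ENNReal.div_eq_zero_iff, not_or]
    exact ⟨by simpa using hε, ENNReal.coe_ne_top⟩)
  obtain ⟨g, hg, hg'⟩ := hP'.2 (ε / 2) (by simpa using hε)
  refine ⟨g, hg, ?_⟩
  have e : ((fun s => D (g s)) - fun s => B (u s)) =
      ((fun s => D (g s)) - fun s => B (h s)) - (fun s => B ((u - h) s)) := by
    funext s; simp
  rw [e, ← ENNReal.add_halves ε]
  refine (eLpNorm_sub_le (aesm hP'.1 hg)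
    (B.continuous.comp_aestronglyMeasurable (hu.1.sub hP'.1)) (by norm_num)).trans
    (add_le_add hg' ?_)
  have h1 : eLpNorm (fun s => B ((u - h) s)) 2 μ ≤
      ((‖B‖₊ + 1 : ℝ≥0) : ℝ≥0∞) * eLpNorm (u - h) 2 μ := by
    refine eLpNorm_le_nnreal_smul_eLpNorm_of_ae_le_mul (Eventually.of_forall fun a => ?_) 2
    refine (B.le_opNNNorm _).trans ?_
    gcongr
    exact le_self_add
  refine h1.trans ((mul_le_mul_right hh _).trans ?_)
  rw [ENNReal.mul_div_cancel (by simp) ENNReal.coe_ne_top]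

end Density

end BFS

/-! ### Coercive forms and classical solutions -/

namespace BFS

section Calculus

variable {𝕜 X : Type*} [RCLike 𝕜] [NormedAddCommGroup X]

/-- The derivative of an integral with a parameter at the moment where the interval is trivial. -/
theorem hasDerivAt_integral_diag [NormedSpace ℝ X] [CompleteSpace X] {K : ℝ → ℝ → X}
    (hK : Continuous (Function.uncurry K)) (t : ℝ) :
    HasDerivAt (fun r => ∫ s in t..r, K r s) (K t t) t := by
  rw [hasDerivAt_iff_isLittleO, Asymptotics.isLittleO_iff]
  intro ε hε
  have h1 : ∀ᶠ q : ℝ × ℝ in 𝓝 (t, t), dist (Function.uncurry K q) (K t t) < ε :=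
    hK.continuousAt.eventually (Metric.ball_mem_nhds _ hε)
  obtain ⟨δ, hδ, h2⟩ := Metric.eventually_nhds_iff.1 h1
  filter_upwards [Metric.ball_mem_nhds t hδ] with r hr
  have hKr : Continuous (K r) := hK.comp (by fun_prop : Continuous fun s => (r, s))
  have e : (∫ s in t..r, K r s) - (∫ s in t..t, K t s) - (r - t) • K t t =
      ∫ s in t..r, (K r s - K t t) := by
    rw [intervalIntegral.integral_sub (hKr.intervalIntegrable _ _) (by simp)]
    simp
  rw [e, Real.norm_eq_abs]
  refine intervalIntegral.norm_integral_le_of_norm_le_const fun s hs => ?_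
  rw [← dist_eq_norm]
  refine (h2 (y := (r, s)) ?_).le
  rw [Prod.dist_eq, max_lt_iff]
  refine ⟨hr, ?_⟩
  have : |s - t| ≤ |r - t| := by
    rcases le_total t r with h | h
    · rw [uIoc_of_le h] at hs
      rw [abs_of_nonneg (by linarith [hs.1]), abs_of_nonneg (by linarith)]
      linarith [hs.2]
    · rw [uIoc_of_ge h] at hs
      rw [abs_of_nonpos (by linarith [hs.2]), abs_of_nonpos (by linarith)]
      linarith [hs.1]
  exact this.trans_lt hr

theorem hasDerivWithinAt_re_norm_sq [InnerProductSpace 𝕜 X] [NormedSpace ℝ X] {f : ℝ → X} {f' : X}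
    {s : Set ℝ} {t : ℝ} (h : HasDerivWithinAt f f' s t) :
    HasDerivWithinAt (fun r => ‖f r‖ ^ 2) (2 * RCLike.re (inner 𝕜 (f t) f')) s t := by
  have h1 := (RCLike.reCLM (K := 𝕜)).hasFDerivAt.comp_hasDerivWithinAt t (h.inner 𝕜 h)
  have e : (RCLike.reCLM (K := 𝕜) : 𝕜 → ℝ) ∘ (fun r => inner 𝕜 (f r) (f r)) =
      fun r => ‖f r‖ ^ 2 := by
    funext r
    exact (norm_sq_eq_re_inner (𝕜 := 𝕜) _).symm
  rw [e] at h1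
  refine h1.congr_deriv ?_
  change RCLike.re (inner 𝕜 (f t) f' + inner 𝕜 f' (f t)) = _
  rw [map_add, inner_re_symm f' (f t)]
  ring

end Calculus

variable {𝕜 X U₁ U₂ Y : Type*} [RCLike 𝕜]
  [NormedAddCommGroup X] [InnerProductSpace 𝕜 X] [CompleteSpace X]
  [NormedAddCommGroup U₁] [InnerProductSpace 𝕜 U₁] [CompleteSpace U₁]
  [NormedAddCommGroup U₂] [InnerProductSpace 𝕜 U₂] [CompleteSpace U₂]
  [NormedAddCommGroup Y] [InnerProductSpace 𝕜 Y] [CompleteSpace Y]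

/-- The common form of the self-adjoint and of the skew-adjoint case: a space `V ⊆ X` (`X_{1/2}`
or `X`) containing `D(A)` densely, to which `z ↦ Re ⟨A z, z⟩` extends as a quadratic expression
`q` that is coercive in the norm of `V`, while the control operators have values in the dual of `V`
with respect to the pivot space `X`, and `C` is bounded on `V`. The embedding of `D(A)` in `V`
enters through `res`, which is `(β - A)⁻¹` as an operator from `X` to `V`. The space `W` stands for
this dual of `V`, with the duality pairing `pair` and the embedding `pivot` of `X`. That a control
operator with values in `W` is the given one with values in `X₋₁` is expressed as for
`NegHalf.Represents`. -/
structure FormData (S : System 𝕜 X U₁ U₂ Y) (V W : Type*) [NormedAddCommGroup V]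
    [NormedSpace 𝕜 V] [NormedAddCommGroup W] [NormedSpace 𝕜 W] where
  incl : V →L[𝕜] X
  incl_injective : Function.Injective incl
  res : X →L[𝕜] V
  incl_res : ∀ x, incl (res x) = S.R x
  denseRange_res : DenseRange res
  denseRange_R : DenseRange S.R
  q : V → ℝ
  q_res : ∀ x, q (res x) =
    RCLike.re (inner 𝕜 (S.R x) (S.A ⟨S.R x, S.isResolvent.mem_domain x⟩))
  M : ℝ
  abs_q_sub_le : ∀ a b, |q a - q b| ≤ M * (‖a‖ + ‖b‖) * ‖a - b‖
  α : ℝ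
  α_pos : 0 < α
  q_le_neg : ∀ v, q v ≤ -α * ‖v‖ ^ 2
  w : ℝ
  q_le : ∀ v, q v ≤ w * ‖incl v‖ ^ 2
  w_neg : w < 0
  pair : W → V → 𝕜
  pair_sub_left : ∀ f g v, pair (f - g) v = pair f v - pair g v
  pair_sub_right : ∀ f v v', pair f (v - v') = pair f v - pair f v'
  norm_pair_le : ∀ f v, ‖pair f v‖ ≤ ‖f‖ * ‖v‖
  pivot : X →L[𝕜] W
  pair_pivot : ∀ x v, pair (pivot x) v = inner 𝕜 (incl v) x
  B₁ : U₁ →L[𝕜] W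
  B₂ : U₂ →L[𝕜] W
  represents₁ : ∀ u, (B₁ u, S.B₁ u) ∈
    closure (range fun x : X => (pivot x, Extrapolation.of S.R x))
  represents₂ : ∀ u, (B₂ u, S.B₂ u) ∈
    closure (range fun x : X => (pivot x, Extrapolation.of S.R x))
  C : V →L[𝕜] Y
  ι_C_res : ∀ x, S.ι (C (res x)) = S.C (S.R x)

namespace FormData

variable {S : System 𝕜 X U₁ U₂ Y} {V W : Type*} [NormedAddCommGroup V] [NormedSpace 𝕜 V]
  [NormedAddCommGroup W] [NormedSpace 𝕜 W]
  (D : FormData S V W)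

theorem q_zero : D.q 0 = 0 := by
  have := D.q_res 0
  simpa using this

theorem ι_C (v : V) : S.ι (D.C v) = S.C (D.incl v) := by
  have h : (fun v => S.ι (D.C v)) = fun v => S.C (D.incl v) := by
    refine D.denseRange_res.equalizer (by fun_prop) (by fun_prop) ?_
    funext x
    simp [D.ι_C_res, D.incl_res]
  exact congrFun h v

theorem q_nonpos (v : V) : D.q v ≤ 0 :=
  (D.q_le v).trans (mul_nonpos_of_nonpos_of_nonneg D.w_neg.le (sq_nonneg _))

/-- The quadratic expression `κ ‖v‖² + 2 q(v) + 2 Re ⟨f, v⟩` in `v ∈ V` and `f` in the dual of `V`.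
Along a solution of `x' = A x + f` it is `exp (-κ t)` times the derivative of
`exp (κ t) ‖x(t)‖²`. -/
def power (κ : ℝ) (p : V × W) : ℝ :=
  κ * ‖D.incl p.1‖ ^ 2 + 2 * D.q p.1 + 2 * RCLike.re (D.pair p.2 p.1)

theorem power_zero (κ : ℝ) : D.power κ 0 = 0 := by
  have h := D.norm_pair_le 0 0
  rw [norm_zero, zero_mul] at h
  simp [power, D.q_zero, norm_le_zero_iff.1 h]

theorem abs_power_sub_le (κ : ℝ) : ∃ M : ℝ, ∀ a b : V × W,
    |D.power κ a - D.power κ b| ≤ M * (‖a‖ + ‖b‖) * ‖a - b‖ := by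
  have hM : 0 ≤ |D.M| := abs_nonneg _
  refine ⟨|κ| * ‖D.incl‖ ^ 2 + 2 * |D.M| + 2, fun a b => ?_⟩
  have a1 : ‖a.1‖ ≤ ‖a‖ := norm_fst_le a
  have a2 : ‖a.2‖ ≤ ‖a‖ := norm_snd_le a
  have b1 : ‖b.1‖ ≤ ‖b‖ := norm_fst_le b
  have b2 : ‖b.2‖ ≤ ‖b‖ := norm_snd_le b
  have c1 : ‖a.1 - b.1‖ ≤ ‖a - b‖ := norm_fst_le (a - b)
  have c2 : ‖a.2 - b.2‖ ≤ ‖a - b‖ := norm_snd_le (a - b)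
  have e1 : |‖D.incl a.1‖ ^ 2 - ‖D.incl b.1‖ ^ 2| ≤
      ‖D.incl‖ ^ 2 * ((‖a‖ + ‖b‖) * ‖a - b‖) := by
    have h1 : |‖D.incl a.1‖ - ‖D.incl b.1‖| ≤ ‖D.incl‖ * ‖a - b‖ := by
      refine (abs_norm_sub_norm_le _ _).trans ?_
      rw [← map_sub]
      exact (D.incl.le_opNorm _).trans (by gcongr)
    have h2 : |‖D.incl a.1‖ + ‖D.incl b.1‖| ≤ ‖D.incl‖ * (‖a‖ + ‖b‖) := by
      rw [abs_of_nonneg (by positivity), mul_add]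
      exact add_le_add ((D.incl.le_opNorm _).trans (by gcongr))
        ((D.incl.le_opNorm _).trans (by gcongr))
    rw [sq_sub_sq, abs_mul]
    refine (mul_le_mul h2 h1 (abs_nonneg _) (by positivity)).trans (le_of_eq (by ring))
  have e2 : |D.q a.1 - D.q b.1| ≤ |D.M| * ((‖a‖ + ‖b‖) * ‖a - b‖) := by
    refine (D.abs_q_sub_le _ _).trans ?_
    rw [mul_assoc]
    exact mul_le_mul (le_abs_self _) (by gcongr) (by positivity) hM
  have e3 : |RCLike.re (D.pair a.2 a.1) - RCLike.re (D.pair b.2 b.1)| ≤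
      (‖a‖ + ‖b‖) * ‖a - b‖ := by
    have h : D.pair a.2 a.1 - D.pair b.2 b.1 =
        D.pair a.2 (a.1 - b.1) + D.pair (a.2 - b.2) b.1 := by
      rw [D.pair_sub_left, D.pair_sub_right]; ring
    rw [← map_sub, h]
    refine (RCLike.abs_re_le_norm _).trans ((norm_add_le _ _).trans ?_)
    have h1 : ‖D.pair a.2 (a.1 - b.1)‖ ≤ ‖a‖ * ‖a - b‖ :=
      (D.norm_pair_le _ _).trans (by gcongr)
    have h2 : ‖D.pair (a.2 - b.2) b.1‖ ≤ ‖a - b‖ * ‖b‖ :=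
      (D.norm_pair_le _ _).trans (by gcongr)
    linarith
  have e : D.power κ a - D.power κ b = κ * (‖D.incl a.1‖ ^ 2 - ‖D.incl b.1‖ ^ 2) +
      2 * (D.q a.1 - D.q b.1) + 2 * (RCLike.re (D.pair a.2 a.1) - RCLike.re (D.pair b.2 b.1)) := by
    simp only [power]; ring
  rw [e]
  refine (abs_add_three _ _ _).trans ?_
  rw [abs_mul, abs_mul, abs_mul, abs_two]
  have := mul_le_mul_of_nonneg_left e1 (abs_nonneg κ)
  linarith

end FormData

namespace System

variable (S : System 𝕜 X U₁ U₂ Y)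

/-- The semigroup, extended to negative times as a constant. -/
def Tc (r : ℝ) : X →L[𝕜] X := S.semigroup.T (max r 0)

theorem Tc_of_nonneg {r : ℝ} (hr : 0 ≤ r) : S.Tc r = S.semigroup.T r := by
  rw [Tc, max_eq_left hr]

theorem Tc_zero (x : X) : S.Tc 0 x = x := by
  simp [Tc, S.semigroup.map_zero]

theorem Tc_add {s t : ℝ} (hs : 0 ≤ s) (ht : 0 ≤ t) (x : X) :
    S.Tc (s + t) x = S.Tc s (S.Tc t x) := by
  rw [S.Tc_of_nonneg hs, S.Tc_of_nonneg ht, S.Tc_of_nonneg (add_nonneg hs ht),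
    S.semigroup.map_add s t hs ht]
  rfl

theorem continuous_Tc (x : X) : Continuous fun r => S.Tc r x :=
  (S.semigroup.continuousOn x).comp_continuous (by fun_prop) fun _ => mem_Ici.2 (le_max_right _ _)

theorem R_Tc (r : ℝ) (x : X) : S.R (S.Tc r x) = S.Tc r (S.R x) :=
  S.isResolvent.commute S.isGenerator (le_max_right _ _) x

/-- The bounded operator `A (β - A)⁻¹ = β (β - A)⁻¹ - 1`. -/
def AR : X →L[𝕜] X := S.β • S.R - ContinuousLinearMap.id 𝕜 X

theorem A_R (x : X) : S.A ⟨S.R x, S.isResolvent.mem_domain x⟩ = S.AR x := by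
  have := S.isResolvent.right_inv x
  simp only [AR, _root_.sub_apply, _root_.smul_apply,
    ContinuousLinearMap.id_apply]
  rw [eq_sub_iff_add_eq, ← eq_sub_iff_add_eq']
  exact this.symm

theorem R_injective : Function.Injective S.R := by
  rw [injective_iff_map_eq_zero]
  intro x hx
  have h := S.isResolvent.right_inv x
  have h1 : S.A ⟨S.R x, S.isResolvent.mem_domain x⟩ = 0 := by
    have : (⟨S.R x, S.isResolvent.mem_domain x⟩ : S.A.domain) = 0 := Subtype.ext hx
    rw [this]
    exact S.A.toFun.map_zero
  rw [h1, hx] at h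
  simpa using h.symm

theorem _root_.BFS.FormData.re_inner_AR {S : System 𝕜 X U₁ U₂ Y} {V W : Type*}
    [NormedAddCommGroup V] [NormedSpace 𝕜 V] [NormedAddCommGroup W] [NormedSpace 𝕜 W]
    (D : FormData S V W) (x : X) : RCLike.re (inner 𝕜 (S.R x) (S.AR x)) = D.q (D.res x) := by
  rw [D.q_res, S.A_R]

variable [NormedSpace ℝ X] [IsScalarTower ℝ 𝕜 X]

/-- The orbit of an element of the domain has the right derivative given by the generator. -/
theorem hasDerivWithinAt_Tc_zero (x : X) :
    HasDerivWithinAt (fun h => S.Tc h (S.R x)) (S.AR x) (Ioi 0) 0 := by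
  have h1 := (S.isGenerator (S.R x) (S.AR x)).1 (by
    rw [← S.A_R x]
    exact S.A.mem_graph ⟨S.R x, S.isResolvent.mem_domain x⟩)
  rw [hasDerivWithinAt_iff_tendsto_slope' (by simp)]
  refine h1.congr' ?_
  filter_upwards [self_mem_nhdsWithin] with t ht
  rw [slope_def_module, S.Tc_zero, S.Tc_of_nonneg (le_of_lt ht), sub_zero]
  rw [← algebraMap_smul 𝕜 (t⁻¹ : ℝ) (_ : X)]
  simp

end System

namespace FormData

variable {S : System 𝕜 X U₁ U₂ Y} {V W : Type*} [NormedAddCommGroup V] [NormedSpace 𝕜 V]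
  [NormedAddCommGroup W] [NormedSpace 𝕜 W]
  (D : FormData S V W) [NormedSpace ℝ X] [IsScalarTower ℝ 𝕜 X]

include D

/-- The semigroup consists of contractions, since its generator is dissipative. -/
theorem norm_Tc_le (r : ℝ) (x : X) : ‖S.Tc r x‖ ≤ ‖x‖ := by
  have key : ∀ t, 0 ≤ t → ∀ x, ‖S.Tc t (S.R x)‖ ≤ ‖S.R x‖ := by
    intro t ht x
    have hd : ∀ r ∈ Ico 0 t, HasDerivWithinAt (fun r => ‖S.Tc r (S.R x)‖ ^ 2)
        (2 * D.q (D.res (S.Tc r x))) (Ici r) r := by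
      intro r hr
      rw [← hasDerivWithinAt_Ioi_iff_Ici]
      have h1 := S.hasDerivWithinAt_Tc_zero (S.Tc r x)
      have h2 : HasDerivWithinAt (fun h => S.Tc h (S.R x)) (S.AR (S.Tc r x)) (Ioi r) r := by
        have h3 : HasDerivWithinAt (fun h : ℝ => h - r) 1 (Ioi r) r :=
          ((hasDerivAt_id r).sub_const r).hasDerivWithinAt
        have h4 := HasDerivWithinAt.scomp (t' := Ioi 0) r (by simpa using h1) h3
          (fun y hy => by simpa using hy)
        rw [one_smul] at h4
        refine h4.congr (fun y hy => ?_) ?_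
        · have : y = (y - r) + r := by ring
          rw [Function.comp_apply, S.R_Tc, ← S.Tc_add (sub_nonneg.2 (le_of_lt hy)) hr.1, ← this]
        · simp [S.Tc_zero, S.R_Tc]
      have h5 := hasDerivWithinAt_re_norm_sq (𝕜 := 𝕜) h2
      rwa [← S.R_Tc, D.re_inner_AR] at h5
    have h1 := image_le_of_deriv_right_le_deriv_boundary (a := 0) (b := t)
      (B := fun _ => ‖S.R x‖ ^ 2) (B' := fun _ => 0)
      (f := fun r => ‖S.Tc r (S.R x)‖ ^ 2) (f' := fun r => 2 * D.q (D.res (S.Tc r x)))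
      ((S.continuous_Tc _).norm.pow 2).continuousOn hd (by simp [S.Tc_zero])
      continuousOn_const (fun r _ => hasDerivWithinAt_const _ _ _)
      (fun r _ => by linarith [D.q_nonpos (D.res (S.Tc r x))]) ⟨ht, le_rfl⟩
    exact le_of_sq_le_sq h1 (norm_nonneg _)
  have hr : S.Tc r = S.Tc (max r 0) := by simp [System.Tc]
  rw [hr]
  have hcl : IsClosed {x : X | ‖S.Tc (max r 0) x‖ ≤ ‖x‖} :=
    isClosed_le (by fun_prop) (by fun_prop)
  exact D.denseRange_R.induction_on x hcl (key _ (le_max_right _ _))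

theorem continuous_uncurry_Tc : Continuous fun p : ℝ × X => S.Tc p.1 p.2 :=
  continuous_uncurry_of_contraction (D := fun x : X => x) denseRange_id D.norm_Tc_le
    S.continuous_Tc

omit D in
/-- The mild solution of `x' = A x + g`, `x(0) = ξ`, for continuous `g : ℝ → X`. -/
def _root_.BFS.System.mild (S : System 𝕜 X U₁ U₂ Y) (ξ : X) (g : ℝ → X) (t : ℝ) : X :=
  S.Tc t ξ + ∫ s in (0 : ℝ)..t, S.Tc (t - s) (g s)

omit D in
theorem _root_.BFS.System.mild_zero (ξ : X) (g : ℝ → X) : S.mild ξ g 0 = ξ := by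
  simp [System.mild, S.Tc_zero]

theorem continuous_kernel {g : ℝ → X} (hg : Continuous g) :
    Continuous (Function.uncurry fun r s => S.Tc (r - s) (g s)) :=
  D.continuous_uncurry_Tc.comp
    (by fun_prop : Continuous fun p : ℝ × ℝ => ((p.1 - p.2, g p.2) : ℝ × X))

theorem continuous_kernel_right {g : ℝ → X} (hg : Continuous g) (r : ℝ) :
    Continuous fun s => S.Tc (r - s) (g s) :=
  (D.continuous_kernel hg).comp (by fun_prop : Continuous fun s => (r, s))

theorem continuous_mild (ξ : X) {g : ℝ → X} (hg : Continuous g) : Continuous (S.mild ξ g) :=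
  (S.continuous_Tc ξ).add (intervalIntegral.continuous_parametric_intervalIntegral_of_continuous
    (D.continuous_kernel hg) continuous_id)

theorem mild_add (ξ η : X) {g k : ℝ → X} (hg : Continuous g) (hk : Continuous k) (t : ℝ) :
    S.mild (ξ + η) (g + k) t = S.mild ξ g t + S.mild η k t := by
  simp only [System.mild, Pi.add_apply, map_add]
  rw [intervalIntegral.integral_add ((D.continuous_kernel_right hg t).intervalIntegrable _ _)
    ((D.continuous_kernel_right hk t).intervalIntegrable _ _)]
  abel

/-- The mild solution restarted at time `t`. -/
theorem mild_eq_of_le (ξ : X) {g : ℝ → X} (hg : Continuous g) {t r : ℝ} (ht : 0 ≤ t)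
    (hr : t ≤ r) :
    S.mild ξ g r = S.Tc (r - t) (S.mild ξ g t) + ∫ s in t..r, S.Tc (r - s) (g s) := by
  have hi : ∀ a b, IntervalIntegrable (fun s => S.Tc (r - s) (g s)) volume a b := fun a b =>
    (D.continuous_kernel_right hg r).intervalIntegrable a b
  rw [System.mild, System.mild,
    ← intervalIntegral.integral_add_adjacent_intervals (hi 0 t) (hi t r),
    map_add, ← S.Tc_add (sub_nonneg.2 hr) ht, sub_add_cancel, ← add_assoc,
    ← ContinuousLinearMap.intervalIntegral_comp_comm _
      ((D.continuous_kernel_right hg t).intervalIntegrable _ _)]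
  congr 2
  refine intervalIntegral.integral_congr fun s hs => ?_
  rw [uIcc_of_le ht] at hs
  rw [← S.Tc_add (sub_nonneg.2 hr) (sub_nonneg.2 hs.2)]
  congr 2
  ring

/-- For data in the domain, the mild solution is a classical solution. -/
theorem hasDerivWithinAt_R_mild (ξ : X) {g : ℝ → X} (hg : Continuous g) {t : ℝ} (ht : 0 ≤ t) :
    HasDerivWithinAt (fun r => S.R (S.mild ξ g r)) (S.AR (S.mild ξ g t) + S.R (g t))
      (Ioi t) t := by
  have h3 : HasDerivWithinAt (fun h : ℝ => h - t) 1 (Ioi t) t :=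
    ((hasDerivAt_id t).sub_const t).hasDerivWithinAt
  have h4 := HasDerivWithinAt.scomp (t' := Ioi 0) t
    (by simpa using S.hasDerivWithinAt_Tc_zero (S.mild ξ g t)) h3 (fun y hy => by simpa using hy)
  rw [one_smul] at h4
  have hRg : Continuous fun s => S.R (g s) := by fun_prop
  have h5 := (hasDerivAt_integral_diag (D.continuous_kernel hRg) t).hasDerivWithinAt (s := Ioi t)
  rw [sub_self, S.Tc_zero] at h5
  refine (h4.add h5).congr (fun r hr => ?_) ?_
  · rw [D.mild_eq_of_le ξ hg ht (le_of_lt hr), map_add,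
      ← ContinuousLinearMap.intervalIntegral_comp_comm _
        ((D.continuous_kernel_right hg r).intervalIntegrable _ _)]
    simp only [S.R_Tc]
    rfl
  · simp [S.Tc_zero]

/-- The weighted energy identity for classical solutions. -/
theorem energy_mild (κ : ℝ) (ξ : X) {g : ℝ → X} (hg : Continuous g) {s t : ℝ} (hs : 0 ≤ s)
    (hst : s ≤ t) :
    ∫ r in s..t, Real.exp (κ * r) *
        D.power κ (D.res (S.mild ξ g r), D.pivot (S.R (g r))) =
      Real.exp (κ * t) * ‖S.R (S.mild ξ g t)‖ ^ 2 -
        Real.exp (κ * s) * ‖S.R (S.mild ξ g s)‖ ^ 2 := by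
  have hm := D.continuous_mild ξ hg
  obtain ⟨M, hM⟩ := D.abs_power_sub_le κ
  have hp := continuous_of_quadratic hM
  have hc1 : Continuous fun r => Real.exp (κ * r) * ‖S.R (S.mild ξ g r)‖ ^ 2 := by fun_prop
  have hc2 : Continuous fun r => Real.exp (κ * r) *
      D.power κ (D.res (S.mild ξ g r), D.pivot (S.R (g r))) := by fun_prop
  refine intervalIntegral.integral_eq_sub_of_hasDeriv_right hc1.continuousOn (fun r hr => ?_)
    (hc2.intervalIntegrable _ _)
  rw [min_eq_left hst] at hr
  have h1 := hasDerivWithinAt_re_norm_sq (𝕜 := 𝕜)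
    (D.hasDerivWithinAt_R_mild ξ hg (hs.trans hr.1.le))
  have h2 : HasDerivWithinAt (fun r => Real.exp (κ * r)) (Real.exp (κ * r) * κ) (Ioi r) r :=
    (((hasDerivAt_id r).const_mul κ).exp.congr_deriv (by simp)).hasDerivWithinAt
  refine (h2.mul h1).congr_deriv ?_
  simp only [power, D.incl_res, D.pair_pivot, inner_add_right, map_add, D.re_inner_AR]
  ring

end FormData

end BFS

/-! ### The linear equation in the form domain -/

namespace BFS

/-- A continuous function is square integrable over a bounded interval. -/
theorem memLp_two_of_continuousOn {E : Type*} [NormedAddCommGroup E] {f : ℝ → E} {s t : ℝ}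
    (hf : ContinuousOn f (Icc s t)) : MemLp f 2 (volume.restrict (Ioc s t)) := by
  obtain ⟨C, hC⟩ := isCompact_Icc.exists_bound_of_continuousOn hf
  refine MemLp.of_bound ((hf.mono Ioc_subset_Icc_self).aestronglyMeasurable measurableSet_Ioc) C ?_
  filter_upwards [ae_restrict_mem measurableSet_Ioc] with r hr
  exact hC r (Ioc_subset_Icc_self hr)

theorem cauchySeq_of_dist_le_mul {A P : Type*} [PseudoMetricSpace A] [PseudoMetricSpace P]
    {u : ℕ → A} {p : ℕ → P} (hp : CauchySeq p) {c : ℝ} (hc : 0 < c)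
    (h : ∀ n m, dist (u n) (u m) ≤ c * dist (p n) (p m)) : CauchySeq u := by
  rw [Metric.cauchySeq_iff] at hp ⊢
  intro ε hε
  obtain ⟨N, hN⟩ := hp (ε / c) (by positivity)
  refine ⟨N, fun n hn m hm => (h n m).trans_lt ?_⟩
  have := hN n hn m hm
  rwa [lt_div_iff₀' hc] at this

variable {𝕜 X U₁ U₂ Y : Type*} [RCLike 𝕜]
  [NormedAddCommGroup X] [InnerProductSpace 𝕜 X] [CompleteSpace X]
  [NormedAddCommGroup U₁] [InnerProductSpace 𝕜 U₁] [CompleteSpace U₁]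
  [NormedAddCommGroup U₂] [InnerProductSpace 𝕜 U₂] [CompleteSpace U₂]
  [NormedAddCommGroup Y] [InnerProductSpace 𝕜 Y] [CompleteSpace Y]

namespace FormData

variable {S : System 𝕜 X U₁ U₂ Y} {V W : Type*} [NormedAddCommGroup V] [NormedSpace 𝕜 V]
  [NormedAddCommGroup W] [NormedSpace 𝕜 W]
  (D : FormData S V W) [NormedSpace ℝ X] [IsScalarTower ℝ 𝕜 X]

/-- `x` is the trajectory of `x' = A x + f`, `x(0) = x₀`, on `[0, T]`, and `v` is `x` as an element
of `L²(0, T; V)`, where `f ∈ L²(0, T)` has values in the dual of `V`: the triple `(f, x, v)` is a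
limit of classical solutions, with inputs `(β - A)⁻¹ gₙ` for continuous `gₙ` and initial data
`(β - A)⁻¹ ξₙ`. -/
structure LinSol (T : ℝ) (x₀ : X) (f : ℝ → W) (x : ℝ → X) (v : ℝ → V) : Prop where
  continuousOn : ContinuousOn x (Icc 0 T)
  memLp_f : MemLp f 2 (volume.restrict (Ioc 0 T))
  memLp_v : MemLp v 2 (volume.restrict (Ioc 0 T))
  approx : ∃ (ξ : ℕ → X) (g : ℕ → ℝ → X), (∀ n, Continuous (g n)) ∧
    Tendsto (fun n => S.R (ξ n)) atTop (𝓝 x₀) ∧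
    (∀ t ∈ Icc 0 T, Tendsto (fun n => S.R (S.mild (ξ n) (g n) t)) atTop (𝓝 (x t))) ∧
    Tendsto (fun n => eLpNorm ((fun s => D.res (S.mild (ξ n) (g n) s)) - v) 2
      (volume.restrict (Ioc 0 T))) atTop (𝓝 0) ∧
    Tendsto (fun n => eLpNorm ((fun s => D.pivot (S.R (g n s))) - f) 2
      (volume.restrict (Ioc 0 T))) atTop (𝓝 0)

variable {D} {T : ℝ} {x₀ x₀' : X} {f f' : ℝ → W} {x x' : ℝ → X} {v v' : ℝ → V}

variable (D) in
theorem memLp_res_mild (ξ : X) {g : ℝ → X} (hg : Continuous g) :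
    MemLp (fun s => D.res (S.mild ξ g s)) 2 (volume.restrict (Ioc 0 T)) :=
  memLp_two_of_continuousOn (D.res.continuous.comp (D.continuous_mild ξ hg)).continuousOn

variable (D) in
theorem memLp_pivot {g : ℝ → X} (hg : Continuous g) :
    MemLp (fun s => D.pivot (S.R (g s))) 2 (volume.restrict (Ioc 0 T)) :=
  memLp_two_of_continuousOn (by fun_prop : Continuous _).continuousOn

variable (D) in
theorem linSol_mild (ξ : X) {g : ℝ → X} (hg : Continuous g) :
    D.LinSol T (S.R ξ) (fun s => D.pivot (S.R (g s))) (fun s => S.R (S.mild ξ g s))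
      (fun s => D.res (S.mild ξ g s)) where
  continuousOn := (S.R.continuous.comp (D.continuous_mild ξ hg)).continuousOn
  memLp_f := D.memLp_pivot hg
  memLp_v := D.memLp_res_mild ξ hg
  approx := ⟨fun _ => ξ, fun _ => g, fun _ => hg, tendsto_const_nhds,
    fun _ _ => tendsto_const_nhds, by simp, by simp⟩

namespace LinSol

theorem congr_state (h : D.LinSol T x₀ f x v) (hx : EqOn x' x (Icc 0 T)) :
    D.LinSol T x₀ f x' v where
  continuousOn := h.continuousOn.congr hx
  memLp_f := h.memLp_f
  memLp_v := h.memLp_v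
  approx := by
    obtain ⟨ξ, g, h1, h2, h3, h4⟩ := h.approx
    exact ⟨ξ, g, h1, h2, fun t ht => by rw [hx ht]; exact h3 t ht, h4⟩

theorem mono (h : D.LinSol T x₀ f x v) {t : ℝ} (ht : t ≤ T) : D.LinSol t x₀ f x v := by
  have hle : volume.restrict (Ioc 0 t) ≤ volume.restrict (Ioc 0 T) :=
    Measure.restrict_mono (Ioc_subset_Ioc_right ht) le_rfl
  obtain ⟨ξ, g, h1, h2, h3, h4, h5⟩ := h.approx
  exact
  { continuousOn := h.continuousOn.mono (Icc_subset_Icc_right ht)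
    memLp_f := h.memLp_f.mono_measure hle
    memLp_v := h.memLp_v.mono_measure hle
    approx := ⟨ξ, g, h1, h2, fun r hr => h3 r ⟨hr.1, hr.2.trans ht⟩,
      tendsto_of_tendsto_of_tendsto_of_le_of_le tendsto_const_nhds h4 (fun _ => zero_le)
        (fun _ => eLpNorm_mono_measure _ hle),
      tendsto_of_tendsto_of_tendsto_of_le_of_le tendsto_const_nhds h5 (fun _ => zero_le)
        (fun _ => eLpNorm_mono_measure _ hle)⟩ }

theorem add (h : D.LinSol T x₀ f x v) (h' : D.LinSol T x₀' f' x' v') :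
    D.LinSol T (x₀ + x₀') (f + f') (x + x') (v + v') where
  continuousOn := h.continuousOn.add h'.continuousOn
  memLp_f := h.memLp_f.add h'.memLp_f
  memLp_v := h.memLp_v.add h'.memLp_v
  approx := by
    obtain ⟨ξ, g, h1, h2, h3, h4, h5⟩ := h.approx
    obtain ⟨ξ', g', h1', h2', h3', h4', h5'⟩ := h'.approx
    have e : ∀ n t, S.mild ((ξ + ξ') n) ((g + g') n) t =
        S.mild (ξ n) (g n) t + S.mild (ξ' n) (g' n) t := fun n t =>
      D.mild_add _ _ (h1 n) (h1' n) t
    have e1 : ∀ n, (fun s => D.res (S.mild ((ξ + ξ') n) ((g + g') n) s)) =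
        (fun s => D.res (S.mild (ξ n) (g n) s)) + fun s => D.res (S.mild (ξ' n) (g' n) s) := by
      intro n
      funext s
      rw [e, map_add, Pi.add_apply]
    have e2 : ∀ n, (fun s => D.pivot (S.R ((g + g') n s))) =
        (fun s => D.pivot (S.R (g n s))) + fun s => D.pivot (S.R (g' n s)) := by
      intro n
      funext s
      rw [Pi.add_apply, Pi.add_apply, map_add, map_add, Pi.add_apply]
    refine ⟨ξ + ξ', g + g', fun n => (h1 n).add (h1' n), ?_, ?_, ?_, ?_⟩
    · have h6 := h2.add h2'
      simp only [← map_add] at h6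
      exact h6
    · intro t ht
      simp only [e, map_add]
      exact (h3 t ht).add (h3' t ht)
    · simp only [e1]
      exact tendsto_eLpNorm_two_add h.memLp_v h'.memLp_v (fun n => D.memLp_res_mild _ (h1 n))
        (fun n => D.memLp_res_mild _ (h1' n)) h4 h4'
    · simp only [e2]
      exact tendsto_eLpNorm_two_add h.memLp_f h'.memLp_f (fun n => D.memLp_pivot (h1 n))
        (fun n => D.memLp_pivot (h1' n)) h5 h5'

theorem neg (h : D.LinSol T x₀ f x v) : D.LinSol T (-x₀) (-f) (-x) (-v) where
  continuousOn := h.continuousOn.neg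
  memLp_f := h.memLp_f.neg
  memLp_v := h.memLp_v.neg
  approx := by
    obtain ⟨ξ, g, h1, h2, h3, h4, h5⟩ := h.approx
    have e : ∀ n t, S.mild ((-ξ) n) ((-g) n) t = -S.mild (ξ n) (g n) t := by
      intro n t
      rw [System.mild, System.mild, Pi.neg_apply, Pi.neg_apply, map_neg, neg_add,
        ← intervalIntegral.integral_neg]
      simp only [Pi.neg_apply, map_neg]
    have e1 : ∀ n, (fun s => D.res (S.mild ((-ξ) n) ((-g) n) s)) - -v =
        -((fun s => D.res (S.mild (ξ n) (g n) s)) - v) := by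
      intro n
      funext s
      simp only [Pi.sub_apply, Pi.neg_apply (f := v), e, map_neg,
        Pi.neg_apply (f := (fun s => D.res (S.mild (ξ n) (g n) s)) - v)]
      abel
    have e2 : ∀ n, (fun s => D.pivot (S.R ((-g) n s))) - -f =
        -((fun s => D.pivot (S.R (g n s))) - f) := by
      intro n
      funext s
      simp only [Pi.sub_apply, Pi.neg_apply, map_neg]
      abel
    refine ⟨-ξ, -g, fun n => (h1 n).neg, ?_, ?_, ?_, ?_⟩
    · have h6 := h2.neg
      simp only [← map_neg] at h6
      exact h6
    · intro t ht
      simp only [e, map_neg]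
      exact (h3 t ht).neg
    · simp only [e1, eLpNorm_neg]
      exact h4
    · simp only [e2, eLpNorm_neg]
      exact h5

theorem sub (h : D.LinSol T x₀ f x v) (h' : D.LinSol T x₀' f' x' v') :
    D.LinSol T (x₀ - x₀') (f - f') (x - x') (v - v') := by
  simpa only [sub_eq_add_neg] using h.add h'.neg

theorem state_zero (hT : 0 ≤ T) (h : D.LinSol T x₀ f x v) : x 0 = x₀ := by
  obtain ⟨ξ, g, h1, h2, h3, -⟩ := h.approx
  have := h3 0 ⟨le_rfl, hT⟩
  simp only [System.mild_zero] at this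
  exact tendsto_nhds_unique this h2

/-- Along a subsequence the convergence in `L²` is pointwise, which identifies `v` and `x`. -/
theorem incl_ae (h : D.LinSol T x₀ f x v) :
    ∀ᵐ t ∂volume.restrict (Ioc 0 T), D.incl (v t) = x t := by
  obtain ⟨ξ, g, h1, h2, h3, h4, h5⟩ := h.approx
  obtain ⟨ns, hns, hae⟩ := (tendstoInMeasure_of_tendsto_eLpNorm (by norm_num)
    (fun n => (D.memLp_res_mild _ (h1 n)).1) h.memLp_v.1 h4).exists_seq_tendsto_ae
  filter_upwards [hae, ae_restrict_mem measurableSet_Ioc] with t ht htT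
  refine tendsto_nhds_unique ((D.incl.continuous.tendsto _).comp ht) ?_
  have h6 := (h3 t (Ioc_subset_Icc_self htT)).comp hns.tendsto_atTop
  refine h6.congr fun n => ?_
  simp [D.incl_res]

/-- The weighted energy identity. -/
theorem energy (h : D.LinSol T x₀ f x v) (κ : ℝ) {s t : ℝ} (hs : 0 ≤ s) (hst : s ≤ t)
    (ht : t ≤ T) :
    ∫ r in Ioc s t, Real.exp (κ * r) * D.power κ (v r, f r) =
      Real.exp (κ * t) * ‖x t‖ ^ 2 - Real.exp (κ * s) * ‖x s‖ ^ 2 := by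
  obtain ⟨ξ, g, h1, h2, h3, h4, h5⟩ := h.approx
  have hsub : Ioc s t ⊆ Ioc 0 T := Ioc_subset_Ioc hs ht
  have hle : volume.restrict (Ioc s t) ≤ volume.restrict (Ioc 0 T) :=
    Measure.restrict_mono hsub le_rfl
  obtain ⟨M, hM⟩ := D.abs_power_sub_le κ
  have hpair : ∀ {a : ℝ → V} {b : ℝ → W}, MemLp a 2 (volume.restrict (Ioc 0 T)) →
      MemLp b 2 (volume.restrict (Ioc 0 T)) →
      MemLp (fun r => (a r, b r)) 2 (volume.restrict (Ioc 0 T)) :=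
    fun ha hb => memLp_prod_iff.2 ⟨ha, hb⟩
  have hlim : Tendsto (fun n => eLpNorm ((fun r => (D.res (S.mild (ξ n) (g n) r),
      D.pivot (S.R (g n r)))) - fun r => (v r, f r)) 2 (volume.restrict (Ioc 0 T)))
      atTop (𝓝 0) := by
    have e1 := tendsto_eLpNorm_two_clm (ContinuousLinearMap.inl 𝕜 V W) h4
    have e2 := tendsto_eLpNorm_two_clm (ContinuousLinearMap.inr 𝕜 V W) h5
    have e3 := tendsto_eLpNorm_two_add
      ((ContinuousLinearMap.inl 𝕜 V W).comp_memLp' h.memLp_v)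
      ((ContinuousLinearMap.inr 𝕜 V W).comp_memLp' h.memLp_f)
      (fun n => (ContinuousLinearMap.inl 𝕜 V W).comp_memLp'
        (D.memLp_res_mild (ξ n) (h1 n)))
      (fun n => (ContinuousLinearMap.inr 𝕜 V W).comp_memLp' (D.memLp_pivot (h1 n)))
      e1 e2
    have e4 : ∀ (a : ℝ → V) (b : ℝ → W),
        (ContinuousLinearMap.inl 𝕜 V W) ∘ a +
          (ContinuousLinearMap.inr 𝕜 V W) ∘ b = fun r => (a r, b r) := by
      intro a b
      funext r
      simp only [Pi.add_apply, Function.comp_apply, ContinuousLinearMap.inl_apply,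
        ContinuousLinearMap.inr_apply, Prod.mk_add_mk, add_zero, zero_add]
    simp only [e4] at e3
    exact e3
  have key := tendsto_integral_of_quadratic (D.power_zero κ) hM
    (μ := volume.restrict (Ioc s t)) (ρ := fun r => Real.exp (κ * r)) (c := Real.exp (|κ| * T))
    (by fun_prop) (by
      filter_upwards [ae_restrict_mem measurableSet_Ioc] with r hr
      rw [abs_of_pos (Real.exp_pos _), Real.exp_le_exp]
      have hr' := hsub hr
      calc κ * r ≤ |κ| * r := mul_le_mul_of_nonneg_right (le_abs_self _) hr'.1.le
        _ ≤ |κ| * T := mul_le_mul_of_nonneg_left hr'.2 (abs_nonneg _))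
    ((hpair h.memLp_v h.memLp_f).mono_measure hle)
    (fun n => (hpair (D.memLp_res_mild (ξ n) (h1 n)) (D.memLp_pivot (h1 n))).mono_measure hle)
    (tendsto_of_tendsto_of_tendsto_of_le_of_le tendsto_const_nhds hlim (fun _ => zero_le)
        (fun _ => eLpNorm_mono_measure _ hle))
  refine tendsto_nhds_unique key ?_
  have h6 := (((h3 t ⟨hs.trans hst, ht⟩).norm.pow 2).const_mul (Real.exp (κ * t))).sub
    (((h3 s ⟨hs, hst.trans ht⟩).norm.pow 2).const_mul (Real.exp (κ * s)))
  refine h6.congr fun n => ?_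
  rw [← D.energy_mild κ (ξ n) (h1 n) hs hst, intervalIntegral.integral_of_le hst]

theorem memLp_v_Ioc (h : D.LinSol T x₀ f x v) {s t : ℝ} (hs : 0 ≤ s) (ht : t ≤ T) :
    MemLp v 2 (volume.restrict (Ioc s t)) :=
  h.memLp_v.mono_measure (Measure.restrict_mono (Ioc_subset_Ioc hs ht) le_rfl)

theorem memLp_f_Ioc (h : D.LinSol T x₀ f x v) {s t : ℝ} (hs : 0 ≤ s) (ht : t ≤ T) :
    MemLp f 2 (volume.restrict (Ioc s t)) :=
  h.memLp_f.mono_measure (Measure.restrict_mono (Ioc_subset_Ioc hs ht) le_rfl)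

/-- The basic estimate: coercivity of `q` absorbs half of the input. -/
theorem bound (h : D.LinSol T x₀ f x v) {s t : ℝ} (hs : 0 ≤ s) (hst : s ≤ t) (ht : t ≤ T) :
    ‖x t‖ ^ 2 + D.α * ∫ r in Ioc s t, ‖v r‖ ^ 2 ≤
      ‖x s‖ ^ 2 + D.α⁻¹ * ∫ r in Ioc s t, ‖f r‖ ^ 2 := by
  have h1 := h.energy 0 hs hst ht
  simp only [zero_mul, Real.exp_zero, one_mul] at h1
  have hv := integrable_norm_sq (h.memLp_v_Ioc hs ht)
  have hf := integrable_norm_sq (h.memLp_f_Ioc hs ht)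
  obtain ⟨M, hM⟩ := D.abs_power_sub_le 0
  have h2 : ∫ r in Ioc s t, D.power 0 (v r, f r) ≤
      ∫ r in Ioc s t, (D.α⁻¹ * ‖f r‖ ^ 2 - D.α * ‖v r‖ ^ 2) := by
    refine integral_mono (integrable_of_quadratic (D.power_zero 0) hM
      (memLp_prod_iff.2 ⟨h.memLp_v_Ioc hs ht, h.memLp_f_Ioc hs ht⟩))
      ((hf.const_mul _).sub (hv.const_mul _)) fun r => ?_
    have e1 := D.q_le_neg (v r)
    have e2 : RCLike.re (D.pair (f r) (v r)) ≤ ‖f r‖ * ‖v r‖ :=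
      (RCLike.re_le_norm _).trans (D.norm_pair_le _ _)
    have hα := D.α_pos
    -- the inequality between the arithmetic and the geometric mean
    have e3 : 2 * (‖f r‖ * ‖v r‖) ≤ D.α * ‖v r‖ ^ 2 + D.α⁻¹ * ‖f r‖ ^ 2 := by
      have e4 := mul_nonneg (inv_nonneg.2 hα.le) (sq_nonneg (D.α * ‖v r‖ - ‖f r‖))
      have e5 : D.α⁻¹ * (D.α * ‖v r‖ - ‖f r‖) ^ 2 =
          D.α * ‖v r‖ ^ 2 + D.α⁻¹ * ‖f r‖ ^ 2 - 2 * (‖f r‖ * ‖v r‖) := by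
        field_simp
        ring
      linarith
    simp only [power, zero_mul, zero_add]
    linarith
  rw [integral_sub (hf.const_mul _) (hv.const_mul _), integral_const_mul, integral_const_mul] at h2
  linarith

theorem norm_le (h : D.LinSol T x₀ f x v) {t : ℝ} (ht : t ∈ Icc 0 T) :
    ‖x t‖ ≤ ‖x₀‖ + √D.α⁻¹ * (eLpNorm f 2 (volume.restrict (Ioc 0 T))).toReal := by
  have hα := D.α_pos
  have h1 := (h.mono ht.2).bound le_rfl ht.1 le_rfl
  rw [h.state_zero (ht.1.trans ht.2)] at h1
  have h2 : 0 ≤ D.α * ∫ r in Ioc 0 t, ‖v r‖ ^ 2 :=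
    mul_nonneg hα.le (integral_nonneg fun _ => by positivity)
  have h3 : ∫ r in Ioc 0 t, ‖f r‖ ^ 2 ≤
      (eLpNorm f 2 (volume.restrict (Ioc 0 T))).toReal ^ 2 := by
    rw [sq_toReal_eLpNorm_two h.memLp_f]
    exact setIntegral_mono_set (integrable_norm_sq h.memLp_f)
      (Eventually.of_forall fun _ => by positivity) (Ioc_subset_Ioc_right ht.2).eventuallyLE
  refine le_of_sq_le_sq ?_ (by positivity)
  have h4 : √D.α⁻¹ ^ 2 = D.α⁻¹ := Real.sq_sqrt (inv_nonneg.2 hα.le)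
  have h5 := mul_le_mul_of_nonneg_left h3 (inv_nonneg.2 hα.le)
  have h6 : 0 ≤ ‖x₀‖ * (√D.α⁻¹ * (eLpNorm f 2 (volume.restrict (Ioc 0 T))).toReal) := by
    positivity
  rw [add_sq, mul_pow, h4]
  linarith

theorem eLpNorm_le (h : D.LinSol T x₀ f x v) (hT : 0 ≤ T) :
    (eLpNorm v 2 (volume.restrict (Ioc 0 T))).toReal ≤
      √D.α⁻¹ * (‖x₀‖ + √D.α⁻¹ * (eLpNorm f 2 (volume.restrict (Ioc 0 T))).toReal) := by
  have hα := D.α_pos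
  have h1 := h.bound le_rfl hT le_rfl
  rw [h.state_zero hT, ← sq_toReal_eLpNorm_two h.memLp_f, ← sq_toReal_eLpNorm_two h.memLp_v] at h1
  set a := (eLpNorm v 2 (volume.restrict (Ioc 0 T))).toReal
  set b := (eLpNorm f 2 (volume.restrict (Ioc 0 T))).toReal with hb
  have hb0 : 0 ≤ b := ENNReal.toReal_nonneg
  refine le_of_sq_le_sq ?_ (by positivity)
  have h4 : √D.α⁻¹ ^ 2 = D.α⁻¹ := Real.sq_sqrt (inv_nonneg.2 hα.le)
  rw [mul_pow, h4, add_sq, mul_pow, h4]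
  have h6 : 0 ≤ ‖x₀‖ * (√D.α⁻¹ * b) := by positivity
  rw [← div_eq_inv_mul, le_div_iff₀ hα]
  nlinarith [sq_nonneg ‖x T‖]

end LinSol

variable [CompleteSpace V]

variable (D) in
/-- Limits of the data of classical solutions are data of a solution. -/
theorem exists_linSol_of_tendsto (hT : 0 ≤ T) (hf : MemLp f 2 (volume.restrict (Ioc 0 T)))
    {ξ : ℕ → X} {g : ℕ → ℝ → X} (hg : ∀ n, Continuous (g n))
    (hξ : Tendsto (fun n => S.R (ξ n)) atTop (𝓝 x₀))
    (hgf : Tendsto (fun n => eLpNorm ((fun s => D.pivot (S.R (g n s))) - f) 2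
      (volume.restrict (Ioc 0 T))) atTop (𝓝 0)) :
    ∃ x v, D.LinSol T x₀ f x v ∧
      ∀ t ∈ Icc 0 T, Tendsto (fun n => S.R (S.mild (ξ n) (g n) t)) atTop (𝓝 (x t)) := by
  set μ := volume.restrict (Ioc 0 T) with hμ
  have : Fact ((1 : ℝ≥0∞) ≤ 2) := ⟨by norm_num⟩
  -- the data form a Cauchy sequence, and the solutions depend on them Lipschitz continuously
  set p : ℕ → X × Lp W 2 μ := fun n =>
    (S.R (ξ n), (D.memLp_pivot (T := T) (hg n)).toLp _) with hp
  have hpc : CauchySeq p := by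
    refine Tendsto.cauchySeq (x := (x₀, hf.toLp f)) (hξ.prodMk_nhds ?_)
    exact (Lp.tendsto_Lp_iff_tendsto_eLpNorm'' _ (fun n => D.memLp_pivot (hg n)) _ hf).2 hgf
  set c := √D.α⁻¹ with hc
  have hc0 : 0 ≤ c := Real.sqrt_nonneg _
  have hdiff : ∀ n m, D.LinSol T (S.R (ξ n) - S.R (ξ m)) _ _ _ := fun n m =>
    (D.linSol_mild (ξ n) (hg n)).sub (D.linSol_mild (ξ m) (hg m))
  have hpd : ∀ n m, ‖S.R (ξ n) - S.R (ξ m)‖ + c * (eLpNorm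
      ((fun s => D.pivot (S.R (g n s))) - fun s => D.pivot (S.R (g m s))) 2 μ).toReal ≤
        (1 + c) * dist (p n) (p m) := by
    intro n m
    have h1 : ‖S.R (ξ n) - S.R (ξ m)‖ ≤ dist (p n) (p m) := by
      rw [← dist_eq_norm, Prod.dist_eq]
      exact le_max_left _ _
    have h2 : (eLpNorm ((fun s => D.pivot (S.R (g n s))) -
        fun s => D.pivot (S.R (g m s))) 2 μ).toReal ≤ dist (p n) (p m) := by
      rw [Prod.dist_eq]
      refine le_trans (le_of_eq ?_) (le_max_right _ _)
      rw [dist_edist, Lp.edist_toLp_toLp]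
    have := mul_le_mul_of_nonneg_left h2 hc0
    linarith
  have hx : ∀ n m, ∀ t ∈ Icc 0 T,
      dist (S.R (S.mild (ξ n) (g n) t)) (S.R (S.mild (ξ m) (g m) t)) ≤
        (1 + c) * dist (p n) (p m) := by
    intro n m t ht
    rw [dist_eq_norm]
    exact ((hdiff n m).norm_le ht).trans (hpd n m)
  have hv : CauchySeq fun n => (D.memLp_res_mild (T := T) (ξ n) (hg n)).toLp _ := by
    refine cauchySeq_of_dist_le_mul hpc (c := (c + 1) * (1 + c)) (by positivity) fun n m => ?_
    rw [dist_edist, Lp.edist_toLp_toLp]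
    refine ((hdiff n m).eLpNorm_le hT).trans ?_
    refine (mul_le_mul_of_nonneg_left (hpd n m) hc0).trans ?_
    rw [mul_assoc]
    exact mul_le_mul_of_nonneg_right (by linarith) (by positivity)
  obtain ⟨vL, hvL⟩ := cauchySeq_tendsto_of_complete hv
  have hxc : ∀ t : ℝ, ∃ y, t ∈ Icc 0 T →
      Tendsto (fun n => S.R (S.mild (ξ n) (g n) t)) atTop (𝓝 y) := by
    intro t
    by_cases ht : t ∈ Icc 0 T
    · obtain ⟨y, hy⟩ := cauchySeq_tendsto_of_complete
        (cauchySeq_of_dist_le_mul hpc (c := 1 + c) (by positivity) fun n m => hx n m t ht)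
      exact ⟨y, fun _ => hy⟩
    · exact ⟨0, fun h => absurd h ht⟩
  choose x hx' using hxc
  have hunif : TendstoUniformlyOn (fun n t => S.R (S.mild (ξ n) (g n) t)) x atTop (Icc 0 T) := by
    refine UniformCauchySeqOn.tendstoUniformlyOn_of_tendsto ?_ hx'
    rw [Metric.uniformCauchySeqOn_iff]
    intro ε hε
    obtain ⟨N, hN⟩ := Metric.cauchySeq_iff.1 hpc (ε / (1 + c)) (by positivity)
    refine ⟨N, fun n hn m hm t ht => (hx n m t ht).trans_lt ?_⟩
    have := hN n hn m hm
    rwa [lt_div_iff₀' (by positivity)] at this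
  refine ⟨x, vL, ⟨?_, hf, Lp.memLp vL, ξ, g, hg, hξ, hx', ?_, hgf⟩, hx'⟩
  · exact hunif.continuousOn (Eventually.of_forall fun n =>
      (S.R.continuous.comp (D.continuous_mild (ξ n) (hg n))).continuousOn).frequently
  · refine (Lp.tendsto_Lp_iff_tendsto_eLpNorm'' _ (fun n => D.memLp_res_mild (ξ n) (hg n)) _
      (Lp.memLp vL)).1 ?_
    rwa [Lp.toLp_coeFn]

variable (D) in
/-- The free motion of the system. -/
theorem exists_linSol_free (hT : 0 ≤ T) (x₀ : X) :
    ∃ v, D.LinSol T x₀ 0 (fun t => S.semigroup.T t x₀) v := by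
  obtain ⟨ξ, hξ⟩ : ∃ ξ : ℕ → X, Tendsto (fun n => S.R (ξ n)) atTop (𝓝 x₀) := by
    obtain ⟨y, hy, hy'⟩ := mem_closure_iff_seq_limit.1 (D.denseRange_R x₀)
    choose ξ hξ using hy
    exact ⟨ξ, by simpa only [hξ] using hy'⟩
  have h0 : Tendsto (fun _ : ℕ => eLpNorm ((fun _ : ℝ => D.pivot (S.R 0)) - 0) 2
      (volume.restrict (Ioc 0 T))) atTop (𝓝 0) := by
    have e : ((fun _ : ℝ => D.pivot (S.R 0)) - 0) = 0 := by
      funext s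
      rw [map_zero, map_zero, Pi.sub_apply, Pi.zero_apply, sub_zero]
    rw [e, eLpNorm_zero]
    exact tendsto_const_nhds
  obtain ⟨x, v, h, hx⟩ := D.exists_linSol_of_tendsto (f := 0) (g := fun _ _ => 0) hT
    MemLp.zero (fun _ => continuous_const) hξ h0
  refine ⟨v, h.congr_state fun t ht => ?_⟩
  refine tendsto_nhds_unique ?_ (hx t ht)
  rw [← S.Tc_of_nonneg ht.1]
  have h1 := ((S.Tc t).continuous.tendsto _).comp hξ
  refine h1.congr fun n => ?_
  simp only [System.mild, S.R_Tc, map_zero, intervalIntegral.integral_zero, add_zero,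
    Function.comp_apply]

end FormData

namespace System

variable (S : System 𝕜 X U₁ U₂ Y)

/-- The embedding of `X` in `X₋₁` as a bounded operator. -/
def toExt : X →L[𝕜] Extrapolation S.R :=
  LinearMap.mkContinuous (Extrapolation.of S.R) ‖S.R‖ fun x => by
    rw [Extrapolation.norm_of]
    exact S.R.le_opNorm x

theorem toExt_apply (x : X) : S.toExt x = Extrapolation.of S.R x := rfl

theorem extrapolation_of_injective : Function.Injective (Extrapolation.of S.R) := by
  rw [injective_iff_map_eq_zero]
  intro x hx
  have h := Extrapolation.norm_of S.R x
  rw [hx, norm_zero] at h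
  exact S.R_injective (by rw [map_zero]; exact norm_eq_zero.1 h.symm)

theorem Tneg_of {t : ℝ} (ht : 0 ≤ t) (x : X) :
    S.Tneg t (Extrapolation.of S.R x) = Extrapolation.of S.R (S.Tc t x) := by
  rw [Tneg, dif_pos ht, Extrapolation.lift_of, S.Tc_of_nonneg ht]

end System

namespace FormData

variable {S : System 𝕜 X U₁ U₂ Y} {V W : Type*} [NormedAddCommGroup V] [NormedSpace 𝕜 V]
  [NormedAddCommGroup W] [NormedSpace 𝕜 W]
  (D : FormData S V W) [NormedSpace ℝ X] [IsScalarTower ℝ 𝕜 X]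

include D

/-- The extended semigroup is contractive, because the resolvent commutes with the semigroup. -/
theorem norm_Tneg_le {t : ℝ} (ht : 0 ≤ t) (y : Extrapolation S.R) : ‖S.Tneg t y‖ ≤ ‖y‖ := by
  have hcl : IsClosed {y : Extrapolation S.R | ‖S.Tneg t y‖ ≤ ‖y‖} :=
    isClosed_le (by fun_prop) (by fun_prop)
  refine (Extrapolation.denseRange_of S.R).induction_on y hcl fun x => ?_
  rw [S.Tneg_of ht, Extrapolation.norm_of, Extrapolation.norm_of, S.R_Tc]
  exact D.norm_Tc_le _ _

theorem continuous_uncurry_Tneg :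
    Continuous fun p : ℝ × Extrapolation S.R => S.Tneg (max p.1 0) p.2 := by
  refine continuous_uncurry_of_contraction (S := fun r => S.Tneg (max r 0))
    (Extrapolation.denseRange_of S.R) (fun r y => D.norm_Tneg_le (le_max_right _ _) y) fun x => ?_
  simp only [S.Tneg_of (le_max_right _ _)]
  exact S.toExt.continuous.comp ((S.continuous_Tc x).comp (by fun_prop))

variable {T : ℝ} [CompleteSpace V]

/-- Existence for the input map `Φ_t u = ∫₀ᵗ T₋₁(t - s) B u(s) ds`: its values lie in `X`. -/
theorem exists_linSol_input {U : Type*} [NormedAddCommGroup U] [NormedSpace 𝕜 U]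
    (B : U →L[𝕜] W) (Be : U →L[𝕜] Extrapolation S.R)
    (hB : ∀ u, (B u, Be u) ∈ closure (range fun x : X =>
      (D.pivot x, Extrapolation.of S.R x)))
    (hT : 0 ≤ T) {u : ℝ → U} (hu : MemLp u 2 (volume.restrict (Ioc 0 T))) :
    ∃ φ v, D.LinSol T 0 (fun t => B (u t)) φ v ∧
      ∀ t ∈ Icc 0 T, Extrapolation.of S.R (φ t) = S.inputIntegral Be t u := by
  set μ := volume.restrict (Ioc 0 T) with hμ
  set P : X →L[𝕜] W × Extrapolation S.R := D.pivot.prod S.toExt with hP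
  -- `B` and `Be` are approximated at the same time, by continuous inputs in the domain
  have hcl : ∀ c, (B.prod Be) c ∈ closure (range (P.comp S.R)) := by
    intro c
    refine closure_minimal ?_ isClosed_closure (hB c)
    rintro _ ⟨x, rfl⟩
    have h1 : P x ∈ P '' closure (range S.R) := ⟨x, D.denseRange_R x, rfl⟩
    have h2 := image_closure_subset_closure_image P.continuous h1
    rwa [← range_comp] at h2
  have hex : ∀ n : ℕ, ∃ g : ℝ → X, Continuous g ∧
      eLpNorm ((fun s => (P.comp S.R) (g s)) - fun s => (B.prod Be) (u s)) 2 μ ≤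
        ((n : ℝ≥0∞) + 1)⁻¹ := fun n =>
    exists_continuous_approx μ (B.prod Be) (P.comp S.R) hcl hu (by simp)
  choose g hg hg' using hex
  have hlim : Tendsto (fun n => eLpNorm ((fun s => (P.comp S.R) (g n s)) -
      fun s => (B.prod Be) (u s)) 2 μ) atTop (𝓝 0) := by
    refine tendsto_of_tendsto_of_tendsto_of_le_of_le tendsto_const_nhds
      (h := fun n : ℕ => ((n : ℝ≥0∞) + 1)⁻¹) ?_ (fun _ => zero_le) hg'
    have h := (tendsto_add_atTop_iff_nat 1).2 ENNReal.tendsto_inv_nat_nhds_zero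
    simpa using h
  have hfst := tendsto_eLpNorm_two_clm (ContinuousLinearMap.fst 𝕜 _ _) hlim
  have hsnd := tendsto_eLpNorm_two_clm (ContinuousLinearMap.snd 𝕜 _ _) hlim
  obtain ⟨φ, v, h, hφ⟩ := D.exists_linSol_of_tendsto (f := fun t => B (u t)) (x₀ := 0)
    (ξ := fun _ => 0) hT (B.comp_memLp' hu) hg (by simp) hfst
  refine ⟨φ, v, h, fun t ht => ?_⟩
  have hle : volume.restrict (Ioc 0 t) ≤ μ := Measure.restrict_mono
    (Ioc_subset_Ioc_right ht.2) le_rfl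
  have h1 := (S.toExt.continuous.tendsto _).comp (hφ t ht)
  refine tendsto_nhds_unique h1 ?_
  have hmeas : ∀ {k : ℝ → Extrapolation S.R}, AEStronglyMeasurable k (volume.restrict (Ioc 0 t)) →
      AEStronglyMeasurable (fun s => S.Tneg (max (t - s) 0) (k s)) (volume.restrict (Ioc 0 t)) := by
    intro k hk
    exact D.continuous_uncurry_Tneg.comp_aestronglyMeasurable
      (((by fun_prop : Continuous fun s : ℝ => t - s).aestronglyMeasurable).prodMk hk)
  have hmax : ∀ k : ℝ → Extrapolation S.R, ∫ s in (0 : ℝ)..t, S.Tneg (t - s) (k s) =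
      ∫ s in Ioc 0 t, S.Tneg (max (t - s) 0) (k s) := by
    intro k
    rw [intervalIntegral.integral_of_le ht.1]
    refine setIntegral_congr_fun measurableSet_Ioc fun s hs => ?_
    rw [max_eq_left (sub_nonneg.2 hs.2)]
  have hBe : MemLp (fun s => Be (u s)) 2 (volume.restrict (Ioc 0 t)) :=
    (Be.comp_memLp' hu).mono_measure hle
  have hgn : ∀ n, Continuous fun s => S.toExt (S.R (g n s)) := fun n => by
    have := hg n
    fun_prop
  have h2 : ∀ n, S.toExt (S.R (S.mild 0 (g n) t)) =
      ∫ s in Ioc 0 t, S.Tneg (max (t - s) 0) (S.toExt (S.R (g n s))) := by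
    intro n
    have hc := D.continuous_kernel_right (hg n) t
    rw [← hmax, System.mild, map_zero, zero_add]
    change (S.toExt.comp S.R) _ = _
    rw [← ContinuousLinearMap.intervalIntegral_comp_comm _ (hc.intervalIntegrable _ _)]
    refine intervalIntegral.integral_congr fun s hs => ?_
    rw [uIcc_of_le ht.1] at hs
    simp only [ContinuousLinearMap.comp_apply]
    rw [S.toExt_apply, S.toExt_apply, S.Tneg_of (sub_nonneg.2 hs.2), S.R_Tc]
  simp only [Function.comp_def, h2]
  rw [System.inputIntegral, hmax]
  refine tendsto_integral_of_L1' _ (hmeas hBe.1) (Eventually.of_forall fun n => ?_) ?_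
  · refine Continuous.integrableOn_Ioc ?_
    have := hgn n
    exact D.continuous_uncurry_Tneg.comp
      (by fun_prop : Continuous fun s => (t - s, S.toExt (S.R (g n s))))
  · have h3 : Tendsto (fun n => eLpNorm ((fun s => S.toExt (S.R (g n s))) - fun s => Be (u s)) 2
        (volume.restrict (Ioc 0 t)) * volume.restrict (Ioc 0 t) univ ^
          (1 / (1 : ℝ≥0∞).toReal - 1 / (2 : ℝ≥0∞).toReal)) atTop (𝓝 0) := by
      have h4 := tendsto_of_tendsto_of_tendsto_of_le_of_le tendsto_const_nhds hsnd
        (fun _ => zero_le) (fun n => eLpNorm_mono_measure (p := 2) (ν := volume.restrict (Ioc 0 t))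
          ((fun s => S.toExt (S.R (g n s))) - fun s => Be (u s)) hle)
      have h5 : volume.restrict (Ioc 0 t) univ ^
          (1 / (1 : ℝ≥0∞).toReal - 1 / (2 : ℝ≥0∞).toReal) ≠ ∞ :=
        ENNReal.rpow_ne_top_of_nonneg (by norm_num) (measure_ne_top _ _)
      simpa using ENNReal.Tendsto.mul_const h4 (Or.inr h5)
    refine tendsto_of_tendsto_of_tendsto_of_le_of_le tendsto_const_nhds h3 (fun _ => zero_le) ?_
    intro n
    refine le_trans (eLpNorm_mono fun s => ?_) (eLpNorm_le_eLpNorm_mul_rpow_measure_univ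
      (by norm_num) ((hgn n).aestronglyMeasurable.sub hBe.1))
    simp only [Pi.sub_apply, ← map_sub]
    exact D.norm_Tneg_le (le_max_right _ _) _

end FormData

end BFS

/-! ### The feedback: Lipschitz estimate, uniqueness and the a priori bound -/

namespace BFS

/-- Young's inequality for the weighted geometric mean, with a small factor on one side. -/
theorem exists_rpow_mul_rpow_le {p : ℝ} (hp : p ∈ Ioo (0 : ℝ) 1) {δ : ℝ} (hδ : 0 < δ) :
    ∃ c : ℝ, 0 ≤ c ∧ ∀ a b : ℝ, 0 ≤ a → 0 ≤ b → a ^ (1 - p) * b ^ p ≤ δ * b + c * a := by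
  have hp1 : 0 < 1 - p := sub_pos.2 hp.2
  set c : ℝ := δ ^ (-p / (1 - p)) with hc
  have hc0 : 0 < c := Real.rpow_pos_of_pos hδ _
  refine ⟨c, hc0.le, fun a b ha hb => ?_⟩
  have h1 := Real.geom_mean_le_arith_mean2_weighted hp1.le hp.1.le (mul_nonneg hc0.le ha)
    (mul_nonneg hδ.le hb) (by ring)
  rw [Real.mul_rpow hc0.le ha, Real.mul_rpow hδ.le hb] at h1
  have h2 : c ^ (1 - p) * δ ^ p = 1 := by
    rw [hc, ← Real.rpow_mul hδ.le, div_mul_cancel₀ _ hp1.ne', ← Real.rpow_add hδ]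
    simp
  have h3 : c ^ (1 - p) * a ^ (1 - p) * (δ ^ p * b ^ p) = a ^ (1 - p) * b ^ p := by
    calc _ = (c ^ (1 - p) * δ ^ p) * (a ^ (1 - p) * b ^ p) := by ring
      _ = _ := by rw [h2, one_mul]
  rw [h3] at h1
  refine h1.trans ?_
  have h4 : (1 - p) * (c * a) ≤ 1 * (c * a) :=
    mul_le_mul_of_nonneg_right (by linarith [hp.1]) (by positivity)
  have h5 : p * (δ * b) ≤ 1 * (δ * b) := mul_le_mul_of_nonneg_right hp.2.le (by positivity)
  linarith

variable {𝕜 X U₁ U₂ Y : Type*} [RCLike 𝕜]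
  [NormedAddCommGroup X] [InnerProductSpace 𝕜 X] [CompleteSpace X]
  [NormedAddCommGroup U₁] [InnerProductSpace 𝕜 U₁] [CompleteSpace U₁]
  [NormedAddCommGroup U₂] [InnerProductSpace 𝕜 U₂] [CompleteSpace U₂]
  [NormedAddCommGroup Y] [InnerProductSpace 𝕜 Y] [CompleteSpace Y]

namespace FormData

variable {S : System 𝕜 X U₁ U₂ Y} {V W : Type*} [NormedAddCommGroup V] [NormedSpace 𝕜 V]
  [NormedAddCommGroup W] [NormedSpace 𝕜 W] (D : FormData S V W)

/-- The closed-loop feedback `v ↦ N(v, C v)` on `V`. -/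
def feedback (v : V) : U₂ := S.N (D.incl v) (D.C v)

theorem continuous_feedback : Continuous D.feedback := by
  unfold feedback
  fun_prop

theorem feedback_zero : D.feedback 0 = 0 := by
  simp [feedback]

theorem pair_add_left (f g : W) (v : V) : D.pair (f + g) v = D.pair f v + D.pair g v := by
  have h := D.pair_sub_left (f + g) g v
  rw [add_sub_cancel_right] at h
  rw [h, sub_add_cancel]

/-- The bilinear term is bounded relative to the norm of `V`, with relative bound zero. -/
theorem exists_norm_N_le {δ : ℝ} (hδ : 0 < δ) : ∃ c : ℝ, 0 ≤ c ∧ ∀ v v' : V,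
    ‖S.N (D.incl v) (D.C v')‖ ≤ ‖D.incl v‖ * (δ * ‖v'‖ + c * ‖D.incl v'‖) := by
  obtain ⟨K, hK, p, hp, hN⟩ := S.N_bound
  obtain ⟨c, hc, hc'⟩ := exists_rpow_mul_rpow_le hp
    (δ := δ / (K * (‖D.C‖ + 1))) (by positivity)
  refine ⟨K * c * ‖S.C‖, by positivity, fun v v' => (hN _ _).trans ?_⟩
  have h1 : ‖S.ι (D.C v')‖ ^ (1 - p) * ‖D.C v'‖ ^ p ≤
      δ / (K * (‖D.C‖ + 1)) * ‖D.C v'‖ + c * ‖S.ι (D.C v')‖ :=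
    hc' _ _ (norm_nonneg _) (norm_nonneg _)
  have h2 : ‖D.C v'‖ ≤ (‖D.C‖ + 1) * ‖v'‖ :=
    (D.C.le_opNorm v').trans (mul_le_mul_of_nonneg_right (by linarith) (norm_nonneg _))
  have h3 : ‖S.ι (D.C v')‖ ≤ ‖S.C‖ * ‖D.incl v'‖ := by
    rw [D.ι_C]
    exact S.C.le_opNorm _
  calc K * ‖D.incl v‖ * ‖S.ι (D.C v')‖ ^ (1 - p) * ‖D.C v'‖ ^ p
      = K * ‖D.incl v‖ * (‖S.ι (D.C v')‖ ^ (1 - p) * ‖D.C v'‖ ^ p) := by ring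
    _ ≤ K * ‖D.incl v‖ * (δ / (K * (‖D.C‖ + 1)) * ((‖D.C‖ + 1) * ‖v'‖) +
          c * (‖S.C‖ * ‖D.incl v'‖)) := by
        refine mul_le_mul_of_nonneg_left (h1.trans ?_) (by positivity)
        gcongr
    _ = ‖D.incl v‖ * (δ * ‖v'‖ + K * c * ‖S.C‖ * ‖D.incl v'‖) := by
        field_simp

theorem memLp_feedback {μ : Measure ℝ} [IsFiniteMeasure μ] {v : ℝ → V} (hv : MemLp v 2 μ) {r : ℝ}
    (hr : ∀ᵐ t ∂μ, ‖D.incl (v t)‖ ≤ r) : MemLp (fun t => D.feedback (v t)) 2 μ := by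
  obtain ⟨c, hc, hN⟩ := D.exists_norm_N_le one_pos
  have hb : MemLp (fun t => |r| * (‖v t‖ + c * |r|)) 2 μ :=
    (hv.norm.add (memLp_const _)).const_mul _
  refine hb.mono' (D.continuous_feedback.comp_aestronglyMeasurable hv.1) ?_
  filter_upwards [hr] with t ht
  have ht' := ht.trans (le_abs_self r)
  refine (hN (v t) (v t)).trans ?_
  rw [one_mul]
  gcongr

/-- Over short intervals the feedback is Lipschitz continuous with a small constant, on bounded
sets of trajectories. -/
theorem exists_feedback_lipschitz (r ρ : ℝ) {ε : ℝ} (hε : 0 < ε) : ∃ τ > 0, ∀ {s t : ℝ},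
    s ≤ t → t - s ≤ τ → ∀ {v v' : ℝ → V} {E : ℝ},
    MemLp v 2 (volume.restrict (Ioc s t)) → MemLp v' 2 (volume.restrict (Ioc s t)) →
    (∀ᵐ a ∂volume.restrict (Ioc s t), ‖D.incl (v a)‖ ≤ r) →
    (∀ᵐ a ∂volume.restrict (Ioc s t), ‖D.incl (v' a)‖ ≤ r) →
    (∀ᵐ a ∂volume.restrict (Ioc s t), ‖D.incl (v a - v' a)‖ ^ 2 ≤ E) →
    ∫ a in Ioc s t, ‖v a‖ ^ 2 ≤ ρ → ∫ a in Ioc s t, ‖v a - v' a‖ ^ 2 ≤ E →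
    ∫ a in Ioc s t, ‖D.feedback (v a) - D.feedback (v' a)‖ ^ 2 ≤ ε * E := by
  obtain ⟨δ, hδ, hδε⟩ : ∃ δ : ℝ, 0 < δ ∧ 4 * δ ^ 2 * (|ρ| + r ^ 2) ≤ ε / 2 := by
    refine ⟨√(ε / (8 * (|ρ| + r ^ 2 + 1))), by positivity, ?_⟩
    rw [Real.sq_sqrt (by positivity)]
    have h : 4 * (ε / (8 * (|ρ| + r ^ 2 + 1))) * (|ρ| + r ^ 2) =
        ε / 2 * ((|ρ| + r ^ 2) / (|ρ| + r ^ 2 + 1)) := by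
      field_simp
      ring
    rw [h]
    have h2 : (|ρ| + r ^ 2) / (|ρ| + r ^ 2 + 1) ≤ 1 := by
      rw [div_le_one (by positivity)]
      linarith
    nlinarith
  obtain ⟨c, hc, hN⟩ := D.exists_norm_N_le hδ
  refine ⟨ε / (16 * (c ^ 2 * r ^ 2 + 1)), by positivity, ?_⟩
  intro s t hst hτ v v' E hv hv' hr hr' hE hρ hE'
  have hE0 : 0 ≤ E := (integral_nonneg fun _ => by positivity).trans hE'
  have hvv' : MemLp (fun a => v a - v' a) 2 (volume.restrict (Ioc s t)) := hv.sub hv'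
  have hF := (D.memLp_feedback hv hr).sub (D.memLp_feedback hv' hr')
  have i1 := integrable_norm_sq hv
  have i2 := integrable_norm_sq hvv'
  have hpt : ∀ᵐ a ∂volume.restrict (Ioc s t), ‖D.feedback (v a) - D.feedback (v' a)‖ ^ 2 ≤
      4 * (δ ^ 2 * E * ‖v a‖ ^ 2 + r ^ 2 * δ ^ 2 * ‖v a - v' a‖ ^ 2 + 2 * (c ^ 2 * r ^ 2 * E)) := by
    filter_upwards [hr, hr', hE] with a ha ha' hEa
    have e : D.feedback (v a) - D.feedback (v' a) =
        S.N (D.incl (v a - v' a)) (D.C (v a)) + S.N (D.incl (v' a)) (D.C (v a - v' a)) := by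
      simp only [feedback, map_sub, _root_.sub_apply]
      abel
    have h1 := hN (v a - v' a) (v a)
    have h2 := hN (v' a) (v a - v' a)
    have hr0 : 0 ≤ r := (norm_nonneg _).trans ha
    set d := ‖D.incl (v a - v' a)‖
    set A := ‖v a‖
    set B := ‖v a - v' a‖
    have hd0 : 0 ≤ d := norm_nonneg _
    have hA0 : 0 ≤ A := norm_nonneg _
    have hB0 : 0 ≤ B := norm_nonneg _
    have h3 : ‖D.feedback (v a) - D.feedback (v' a)‖ ≤
        δ * d * A + c * r * d + r * δ * B + r * c * d := by
      rw [e]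
      refine (norm_add_le _ _).trans ((add_le_add h1 h2).trans ?_)
      have h4 : d * (δ * A + c * ‖D.incl (v a)‖) ≤ d * (δ * A + c * r) := by gcongr
      have h5 : ‖D.incl (v' a)‖ * (δ * B + c * d) ≤ r * (δ * B + c * d) := by gcongr
      linarith
    have h6 := pow_le_pow_left₀ (norm_nonneg _) h3 2
    have h7 : (δ * d * A + c * r * d + r * δ * B + r * c * d) ^ 2 ≤
        4 * (δ ^ 2 * d ^ 2 * A ^ 2 + r ^ 2 * δ ^ 2 * B ^ 2 + 2 * (c ^ 2 * r ^ 2 * d ^ 2)) := by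
      nlinarith [sq_nonneg (δ * d * A - c * r * d), sq_nonneg (δ * d * A - r * δ * B),
        sq_nonneg (c * r * d - r * δ * B)]
    refine h6.trans (h7.trans ?_)
    gcongr
  have i3 : Integrable (fun a => δ ^ 2 * E * ‖v a‖ ^ 2 + r ^ 2 * δ ^ 2 * ‖v a - v' a‖ ^ 2)
      (volume.restrict (Ioc s t)) := (i1.const_mul _).add (i2.const_mul _)
  have hint : Integrable (fun a => 4 * (δ ^ 2 * E * ‖v a‖ ^ 2 +
      r ^ 2 * δ ^ 2 * ‖v a - v' a‖ ^ 2 + 2 * (c ^ 2 * r ^ 2 * E))) (volume.restrict (Ioc s t)) :=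
    (i3.add (integrable_const _)).const_mul _
  refine (integral_mono_ae (integrable_norm_sq hF) hint hpt).trans ?_
  rw [integral_const_mul, integral_add i3 (integrable_const _),
    integral_add (i1.const_mul _) (i2.const_mul _), integral_const_mul, integral_const_mul,
    setIntegral_const, measureReal_def, Real.volume_Ioc, ENNReal.toReal_ofReal (by linarith),
    smul_eq_mul]
  have k1 : δ ^ 2 * E * ∫ a in Ioc s t, ‖v a‖ ^ 2 ≤ δ ^ 2 * E * |ρ| := by
    have := hρ.trans (le_abs_self ρ)
    gcongr
  have k2 : r ^ 2 * δ ^ 2 * ∫ a in Ioc s t, ‖v a - v' a‖ ^ 2 ≤ r ^ 2 * δ ^ 2 * E := by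
    gcongr
  have k3 : (t - s) * (2 * (c ^ 2 * r ^ 2 * E)) ≤ ε / 8 * E := by
    have h1 : (t - s) * (2 * (c ^ 2 * r ^ 2 * E)) ≤
        ε / (16 * (c ^ 2 * r ^ 2 + 1)) * (2 * (c ^ 2 * r ^ 2 * E)) := by gcongr
    refine h1.trans ?_
    have h2 : ε / (16 * (c ^ 2 * r ^ 2 + 1)) * (2 * (c ^ 2 * r ^ 2 * E)) =
        ε / 8 * E * ((c ^ 2 * r ^ 2) / (c ^ 2 * r ^ 2 + 1)) := by
      field_simp
      ring
    rw [h2]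
    refine mul_le_of_le_one_right (by positivity) ?_
    rw [div_le_one (by positivity)]
    linarith
  have k4 := mul_le_mul_of_nonneg_right hδε hE0
  linarith

variable [NormedSpace ℝ X] [IsScalarTower ℝ 𝕜 X] {D} {T : ℝ} {z₀ : X} {u₁ : ℝ → U₁}
  {u u' : ℝ → U₂} {x x' : ℝ → X} {v v' : ℝ → V}

/-- Two trajectories with the same data at time `s` differ by as much as their inputs do. -/
theorem exists_linSol_sub_le (D : FormData S V W) : ∃ b > 0, ∀ {T : ℝ} {z₀ : X} {u₁ : ℝ → U₁}
    {u u' : ℝ → U₂} {x x' : ℝ → X} {v v' : ℝ → V},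
    MemLp u 2 (volume.restrict (Ioc 0 T)) → MemLp u' 2 (volume.restrict (Ioc 0 T)) →
    D.LinSol T z₀ (fun t => D.B₁ (u₁ t) + D.B₂ (u t)) x v →
    D.LinSol T z₀ (fun t => D.B₁ (u₁ t) + D.B₂ (u' t)) x' v' →
    ∀ {s t : ℝ}, 0 ≤ s → s ≤ t → t ≤ T → x s = x' s →
      (∀ a ∈ Icc s t, ‖x a - x' a‖ ^ 2 ≤ b * ∫ a in Ioc s t, ‖u a - u' a‖ ^ 2) ∧
      ∫ a in Ioc s t, ‖v a - v' a‖ ^ 2 ≤ b * ∫ a in Ioc s t, ‖u a - u' a‖ ^ 2 := by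
  have hα := D.α_pos
  set b₀ := D.α⁻¹ * (‖D.B₂‖ ^ 2 + 1) with hb₀
  have hb₀' : 0 < b₀ := by positivity
  refine ⟨b₀ + D.α⁻¹ * b₀, by positivity, ?_⟩
  intro T z₀ u₁ u u' x x' v v' hu hu' h h' s t hs hst ht hx
  have hd := h.sub h'
  have hMu : MemLp (fun a => u a - u' a) 2 (volume.restrict (Ioc 0 T)) := hu.sub hu'
  have hub : ∀ a, a ∈ Icc s t → D.α⁻¹ * ∫ r in Ioc s a, ‖((fun t => D.B₁ (u₁ t) + D.B₂ (u t)) -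
      fun t => D.B₁ (u₁ t) + D.B₂ (u' t)) r‖ ^ 2 ≤ b₀ * ∫ a in Ioc s t, ‖u a - u' a‖ ^ 2 := by
    intro a ha
    rw [hb₀, mul_assoc]
    refine mul_le_mul_of_nonneg_left ?_ (inv_nonneg.2 hα.le)
    have i1 : IntegrableOn (fun r => ‖u r - u' r‖ ^ 2) (Ioc s t) :=
      integrable_norm_sq (hMu.mono_measure (Measure.restrict_mono (Ioc_subset_Ioc hs ht) le_rfl))
    have i2 : IntegrableOn (fun r => ‖u r - u' r‖ ^ 2) (Ioc s a) :=
      i1.mono_set (Ioc_subset_Ioc_right ha.2)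
    calc ∫ r in Ioc s a, ‖((fun t => D.B₁ (u₁ t) + D.B₂ (u t)) -
            fun t => D.B₁ (u₁ t) + D.B₂ (u' t)) r‖ ^ 2
        ≤ ∫ r in Ioc s a, (‖D.B₂‖ ^ 2 + 1) * ‖u r - u' r‖ ^ 2 := by
          refine integral_mono (integrable_norm_sq (hd.memLp_f_Ioc hs (ha.2.trans ht)))
            (i2.const_mul _) fun r => ?_
          simp only [Pi.sub_apply, add_sub_add_left_eq_sub, ← map_sub]
          have h1 := pow_le_pow_left₀ (norm_nonneg _) (D.B₂.le_opNorm (u r - u' r)) 2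
          rw [mul_pow] at h1
          nlinarith [sq_nonneg ‖u r - u' r‖]
      _ = (‖D.B₂‖ ^ 2 + 1) * ∫ r in Ioc s a, ‖u r - u' r‖ ^ 2 := integral_const_mul _ _
      _ ≤ (‖D.B₂‖ ^ 2 + 1) * ∫ r in Ioc s t, ‖u r - u' r‖ ^ 2 := by
          refine mul_le_mul_of_nonneg_left ?_ (by positivity)
          exact setIntegral_mono_set i1 (Eventually.of_forall fun _ => by positivity)
            (Ioc_subset_Ioc_right ha.2).eventuallyLE
  have hE : 0 ≤ ∫ a in Ioc s t, ‖u a - u' a‖ ^ 2 := integral_nonneg fun _ => by positivity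
  have hxs : ‖(x - x') s‖ ^ 2 = 0 := by simp [hx]
  constructor
  · intro a ha
    have h1 := hd.bound hs ha.1 (ha.2.trans ht)
    have h2 : 0 ≤ D.α * ∫ r in Ioc s a, ‖(v - v') r‖ ^ 2 :=
      mul_nonneg hα.le (integral_nonneg fun _ => by positivity)
    have h3 := hub a ha
    have h4 : 0 ≤ D.α⁻¹ * b₀ * ∫ a in Ioc s t, ‖u a - u' a‖ ^ 2 := by positivity
    rw [hxs] at h1
    have h5 : ‖x a - x' a‖ ^ 2 = ‖(x - x') a‖ ^ 2 := rfl
    rw [h5, add_mul]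
    linarith
  · have h1 := hd.bound hs hst ht
    have h3 := hub t ⟨hst, le_rfl⟩
    rw [hxs] at h1
    have h5 : ∫ r in Ioc s t, ‖v r - v' r‖ ^ 2 = ∫ r in Ioc s t, ‖(v - v') r‖ ^ 2 := rfl
    have h6 : D.α * ∫ r in Ioc s t, ‖(v - v') r‖ ^ 2 ≤ b₀ * ∫ a in Ioc s t, ‖u a - u' a‖ ^ 2 := by
      nlinarith [sq_nonneg ‖(x - x') t‖]
    rw [← le_div_iff₀' hα, div_eq_inv_mul] at h6
    rw [h5, add_mul, mul_assoc]
    have : 0 ≤ b₀ * ∫ a in Ioc s t, ‖u a - u' a‖ ^ 2 := by positivity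
    linarith

theorem LinSol.ae_norm_incl_le {x₀ : X} {f : ℝ → W} (h : D.LinSol T x₀ f x v) {s t r : ℝ}
    (hs : 0 ≤ s) (ht : t ≤ T) (hr : ∀ a ∈ Icc s t, ‖x a‖ ≤ r) :
    ∀ᵐ a ∂volume.restrict (Ioc s t), ‖D.incl (v a)‖ ≤ r := by
  have h1 := ae_mono (Measure.restrict_mono (Ioc_subset_Ioc hs ht) le_rfl :
    volume.restrict (Ioc s t) ≤ volume.restrict (Ioc 0 T)) h.incl_ae
  filter_upwards [h1, ae_restrict_mem measurableSet_Ioc] with a ha ha'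
  rw [ha]
  exact hr a (Ioc_subset_Icc_self ha')

/-- Induction over a covering of `[0, T]` by intervals of a fixed length. -/
theorem forall_of_step {P : ℝ → Prop} {τ : ℝ} (hτ : 0 < τ) (hT : 0 ≤ T) (h0 : P 0)
    (hstep : ∀ s ∈ Icc 0 T, P s → P (min (s + τ) T)) : P T := by
  have key : ∀ k : ℕ, P (min (k * τ) T) := by
    intro k
    induction k with
    | zero => simpa [hT] using h0
    | succ k ih =>
      have h1 := hstep _ ⟨le_min (by positivity) hT, min_le_right _ _⟩ ih
      have e : min (min (k * τ) T + τ) T = min (((k + 1 : ℕ) : ℝ) * τ) T := by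
        push_cast
        rcases le_total (k * τ) T with h | h
        · rw [min_eq_left h]; congr 1; ring
        · rw [min_eq_right h, min_eq_right (by linarith), min_eq_right (by linarith)]
      rwa [e] at h1
  obtain ⟨k, hk⟩ := exists_nat_ge (T / τ)
  have h1 := key k
  rwa [min_eq_right (by rwa [div_le_iff₀ hτ] at hk)] at h1

/-- Solutions of the bilinear system are unique. -/
theorem eqOn_of_feedback (hT : 0 ≤ T) (hu : MemLp u 2 (volume.restrict (Ioc 0 T)))
    (hu' : MemLp u' 2 (volume.restrict (Ioc 0 T)))
    (h : D.LinSol T z₀ (fun t => D.B₁ (u₁ t) + D.B₂ (u t)) x v)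
    (h' : D.LinSol T z₀ (fun t => D.B₁ (u₁ t) + D.B₂ (u' t)) x' v')
    (hF : ∀ᵐ t ∂volume.restrict (Ioc 0 T), u t = D.feedback (v t))
    (hF' : ∀ᵐ t ∂volume.restrict (Ioc 0 T), u' t = D.feedback (v' t)) :
    EqOn x x' (Icc 0 T) := by
  obtain ⟨b, hb, hdiff⟩ := exists_linSol_sub_le D
  obtain ⟨r₁, hr₁⟩ := isCompact_Icc.exists_bound_of_continuousOn h.continuousOn
  obtain ⟨r₂, hr₂⟩ := isCompact_Icc.exists_bound_of_continuousOn h'.continuousOn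
  obtain ⟨τ, hτ, hlip⟩ := D.exists_feedback_lipschitz (max r₁ r₂)
    (∫ a in Ioc 0 T, ‖v a‖ ^ 2) (ε := (2 * b)⁻¹) (by positivity)
  -- uniqueness propagates over steps of length `τ`, where the feedback is a contraction
  refine forall_of_step (P := fun s => EqOn x x' (Icc 0 s)) hτ hT ?_ ?_
  · intro t ht
    rw [Icc_self, mem_singleton_iff] at ht
    rw [ht, h.state_zero hT, h'.state_zero hT]
  intro s hs hP
  set t := min (s + τ) T with ht
  have hst : s ≤ t := le_min (by linarith) hs.2
  have htT : t ≤ T := min_le_right _ _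
  have hsub : Ioc s t ⊆ Ioc 0 T := Ioc_subset_Ioc hs.1 htT
  have hle : volume.restrict (Ioc s t) ≤ volume.restrict (Ioc 0 T) :=
    Measure.restrict_mono hsub le_rfl
  obtain ⟨d1, d2⟩ := hdiff hu hu' h h' hs.1 hst htT (hP ⟨hs.1, le_rfl⟩)
  have hIcc : ∀ a ∈ Icc s t, a ∈ Icc 0 T := fun a ha => ⟨hs.1.trans ha.1, ha.2.trans htT⟩
  have h1 := hlip hst (by linarith [min_le_left (s + τ) T]) (h.memLp_v_Ioc hs.1 htT)
    (h'.memLp_v_Ioc hs.1 htT)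
    (h.ae_norm_incl_le hs.1 htT fun a ha => (hr₁ a (hIcc a ha)).trans (le_max_left _ _))
    (h'.ae_norm_incl_le hs.1 htT fun a ha => (hr₂ a (hIcc a ha)).trans (le_max_right _ _))
    (by
      filter_upwards [ae_mono hle h.incl_ae, ae_mono hle h'.incl_ae,
        ae_restrict_mem measurableSet_Ioc] with a ha ha' hat
      rw [map_sub, ha, ha']
      exact d1 a (Ioc_subset_Icc_self hat))
    (setIntegral_mono_set (integrable_norm_sq h.memLp_v)
      (Eventually.of_forall fun _ => by positivity) hsub.eventuallyLE) d2
  have h2 : ∫ a in Ioc s t, ‖D.feedback (v a) - D.feedback (v' a)‖ ^ 2 =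
      ∫ a in Ioc s t, ‖u a - u' a‖ ^ 2 := by
    refine integral_congr_ae ?_
    filter_upwards [ae_mono hle hF, ae_mono hle hF'] with a ha ha'
    rw [ha, ha']
  have h3 : ∫ a in Ioc s t, ‖u a - u' a‖ ^ 2 ≤ 0 := by
    rw [h2, ← mul_assoc] at h1
    have e : (2 * b)⁻¹ * b = 1 / 2 := by field_simp
    rw [e] at h1
    linarith
  intro a ha
  rcases le_total a s with has | has
  · exact hP ⟨ha.1, has⟩
  · have h4 := (d1 a ⟨has, ha.2⟩).trans (mul_nonpos_of_nonneg_of_nonpos hb.le h3)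
    have h5 : ‖x a - x' a‖ = 0 := by
      have := sq_nonneg ‖x a - x' a‖
      exact pow_eq_zero_iff (two_ne_zero) |>.1 (le_antisymm h4 this)
    exact sub_eq_zero.1 (norm_eq_zero.1 h5)

/-- The decay inequality for the feedback, extended from the domain of the generator to `V`. -/
def HasDecay (D : FormData S V W) : Prop :=
  ∃ m₁ m₂ : ℝ, 0 < 1 - m₁ ∧ (1 - m₁) * D.w + m₂ < 0 ∧ ∀ v : V,
    ‖D.pair (D.B₂ (D.feedback v)) v‖ ≤ -m₁ * D.q v + m₂ * ‖D.incl v‖ ^ 2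

/-- The a priori estimate: under the decay inequality the energy of the closed loop decays up to
the contribution of the input. -/
theorem HasDecay.exists_bound (hD : D.HasDecay) : ∃ ν > 0, ∃ c > 0, ∀ {T : ℝ} {z₀ : X}
    {u₁ : ℝ → U₁} {u : ℝ → U₂} {x : ℝ → X} {v : ℝ → V},
    MemLp u₁ 2 (volume.restrict (Ioc 0 T)) →
    D.LinSol T z₀ (fun t => D.B₁ (u₁ t) + D.B₂ (u t)) x v → ∀ t ∈ Icc 0 T,
    (∀ᵐ a ∂volume.restrict (Ioc 0 t), u a = D.feedback (v a)) →
      Real.exp (2 * ν * t) * ‖x t‖ ^ 2 ≤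
        ‖z₀‖ ^ 2 + c ^ 2 * ∫ a in Ioc 0 t, Real.exp (2 * ν * a) * ‖u₁ a‖ ^ 2 := by
  obtain ⟨m₁, m₂, hm₁, hm₂, hdec⟩ := hD
  have hα := D.α_pos
  have hw := D.w_neg
  set ν := -((1 - m₁) * D.w + m₂) / 2 with hν
  have hν0 : 0 < ν := by rw [hν]; linarith
  obtain ⟨η, hη, hη1, hη2⟩ : ∃ η > 0, η ≤ 1 - m₁ ∧ -(η * D.w) ≤ ν := by
    refine ⟨min (1 - m₁) (ν / -D.w), lt_min hm₁ (div_pos hν0 (neg_pos.2 hw)), min_le_left _ _, ?_⟩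
    have h1 := mul_le_mul_of_nonneg_right (min_le_right (1 - m₁) (ν / -D.w)) (neg_pos.2 hw).le
    rw [div_mul_cancel₀ _ (neg_pos.2 hw).ne'] at h1
    linarith
  set c := √(2 * (‖D.B₁‖ ^ 2 / (4 * (η * D.α)))) + 1 with hc
  have hc2 : 2 * (‖D.B₁‖ ^ 2 / (4 * (η * D.α))) ≤ c ^ 2 := by
    have h1 : (√(2 * (‖D.B₁‖ ^ 2 / (4 * (η * D.α))))) ^ 2 =
      2 * (‖D.B₁‖ ^ 2 / (4 * (η * D.α))) := Real.sq_sqrt (by positivity)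
    have h2 := Real.sqrt_nonneg (2 * (‖D.B₁‖ ^ 2 / (4 * (η * D.α))))
    rw [hc, add_sq, h1]
    linarith
  refine ⟨ν, hν0, c, by positivity, ?_⟩
  intro T z₀ u₁ u x v hu₁ h t ht hF
  -- with the weight `exp (2 ν t)` the decay rate is absorbed in the energy identity
  have hle : volume.restrict (Ioc 0 t) ≤ volume.restrict (Ioc 0 T) :=
    Measure.restrict_mono (Ioc_subset_Ioc_right ht.2) le_rfl
  have h1 := h.energy (2 * ν) le_rfl ht.1 ht.2
  rw [h.state_zero (ht.1.trans ht.2), mul_zero, Real.exp_zero, one_mul] at h1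
  obtain ⟨M, hM⟩ := D.abs_power_sub_le (2 * ν)
  have hexpb : ∀ᵐ r ∂volume.restrict (Ioc 0 t), ‖Real.exp (2 * ν * r)‖ ≤ Real.exp (2 * ν * t) := by
    filter_upwards [ae_restrict_mem measurableSet_Ioc] with r hr
    rw [Real.norm_eq_abs, abs_of_pos (Real.exp_pos _), Real.exp_le_exp]
    have := hr.2
    gcongr
  have i1 : Integrable (fun r => Real.exp (2 * ν * r) *
      D.power (2 * ν) (v r, D.B₁ (u₁ r) + D.B₂ (u r))) (volume.restrict (Ioc 0 t)) :=
    (integrable_of_quadratic (D.power_zero _) hM (memLp_prod_iff.2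
      ⟨h.memLp_v_Ioc le_rfl ht.2, h.memLp_f_Ioc le_rfl ht.2⟩)).bdd_mul (by fun_prop) hexpb
  have i2 : Integrable (fun r => Real.exp (2 * ν * r) * ‖u₁ r‖ ^ 2)
      (volume.restrict (Ioc 0 t)) :=
    (integrable_norm_sq (hu₁.mono_measure hle)).bdd_mul (by fun_prop) hexpb
  have h2 : ∫ r in Ioc 0 t, Real.exp (2 * ν * r) *
      D.power (2 * ν) (v r, D.B₁ (u₁ r) + D.B₂ (u r)) ≤
      ∫ r in Ioc 0 t, c ^ 2 * (Real.exp (2 * ν * r) * ‖u₁ r‖ ^ 2) := by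
    refine integral_mono_ae i1 (i2.const_mul _) ?_
    filter_upwards [hF] with r hr
    rw [mul_left_comm]
    refine mul_le_mul_of_nonneg_left ?_ (Real.exp_pos _).le
    simp only [power]
    rw [D.pair_add_left, map_add, hr]
    have e1 : RCLike.re (D.pair (D.B₁ (u₁ r)) (v r)) ≤ ‖D.B₁‖ * ‖u₁ r‖ * ‖v r‖ :=
      (RCLike.re_le_norm _).trans ((D.norm_pair_le _ _).trans
        (mul_le_mul_of_nonneg_right (D.B₁.le_opNorm _) (norm_nonneg _)))
    have e2 := (RCLike.re_le_norm (D.pair (D.B₂ (D.feedback (v r))) (v r))).trans (hdec (v r))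
    -- the part `η q` of the dissipation absorbs the input, the rest gives the decay rate
    have e3 := mul_le_mul_of_nonneg_left (D.q_le_neg (v r)) hη.le
    have e4 := mul_le_mul_of_nonneg_left (D.q_le (v r)) (sub_nonneg.2 hη1)
    have e5 : ‖D.B₁‖ * ‖u₁ r‖ * ‖v r‖ ≤
        η * D.α * ‖v r‖ ^ 2 + ‖D.B₁‖ ^ 2 / (4 * (η * D.α)) * ‖u₁ r‖ ^ 2 := by
      have hp : 0 < η * D.α := mul_pos hη hα
      have e6 : η * D.α * ‖v r‖ ^ 2 + ‖D.B₁‖ ^ 2 / (4 * (η * D.α)) * ‖u₁ r‖ ^ 2 -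
          ‖D.B₁‖ * ‖u₁ r‖ * ‖v r‖ =
          (4 * (η * D.α))⁻¹ * (2 * (η * D.α) * ‖v r‖ - ‖D.B₁‖ * ‖u₁ r‖) ^ 2 := by
        field_simp
        ring
      have e7 : 0 ≤ (4 * (η * D.α))⁻¹ * (2 * (η * D.α) * ‖v r‖ - ‖D.B₁‖ * ‖u₁ r‖) ^ 2 := by
        positivity
      linarith
    have e8 := mul_le_mul_of_nonneg_right hc2 (sq_nonneg ‖u₁ r‖)
    have e9 := mul_le_mul_of_nonneg_right hη2 (sq_nonneg ‖D.incl (v r)‖)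
    have e10 : ((1 - m₁) * D.w + m₂) * ‖D.incl (v r)‖ ^ 2 = -(2 * ν) * ‖D.incl (v r)‖ ^ 2 := by
      rw [hν]; ring
    linarith
  rw [integral_const_mul] at h2
  linarith

end FormData

end BFS

/-! ### Existence on bounded time intervals -/

namespace BFS

variable {𝕜 X U₁ U₂ Y : Type*} [RCLike 𝕜]
  [NormedAddCommGroup X] [InnerProductSpace 𝕜 X] [CompleteSpace X]
  [NormedAddCommGroup U₁] [InnerProductSpace 𝕜 U₁] [CompleteSpace U₁]
  [NormedAddCommGroup U₂] [InnerProductSpace 𝕜 U₂] [CompleteSpace U₂]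
  [NormedAddCommGroup Y] [InnerProductSpace 𝕜 Y] [CompleteSpace Y]

/-- A function on `(0, s]` continued by a function on `(s, t]` and by zero. -/
def glue {E : Type*} [Zero E] (s t : ℝ) (a b : ℝ → E) (r : ℝ) : E :=
  if r ∈ Ioc 0 s then a r else (Ioc s t).indicator b r

section Glue

variable {E : Type*} [NormedAddCommGroup E] {s t : ℝ} {a b : ℝ → E}

theorem glue_of_mem_left {r : ℝ} (h : r ∈ Ioc 0 s) : glue s t a b r = a r := if_pos h

theorem glue_of_mem_right {r : ℝ} (h : r ∈ Ioc s t) : glue s t a b r = b r := by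
  rw [glue, if_neg fun h' => not_le.2 h.1 h'.2, indicator_of_mem h]

theorem memLp_glue {T : ℝ} (ht : t ≤ T) (hs : s ∈ Icc 0 T)
    (ha : MemLp a 2 (volume.restrict (Ioc 0 T)))
    (hb : MemLp b 2 (volume.restrict (Ioc s t))) :
    MemLp (glue s t a b) 2 (volume.restrict (Ioc 0 T)) := by
  have e : glue s t a b = (Ioc 0 s).indicator a + (Ioc s t).indicator b := by
    funext r
    by_cases h : r ∈ Ioc 0 s
    · rw [glue_of_mem_left h, Pi.add_apply, indicator_of_mem h, indicator_of_notMem, add_zero]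
      exact fun h' => not_le.2 h'.1 h.2
    · rw [glue, if_neg h, Pi.add_apply, indicator_of_notMem h, zero_add]
  rw [e]
  refine (ha.indicator measurableSet_Ioc).add ?_
  rw [memLp_indicator_iff_restrict measurableSet_Ioc, Measure.restrict_restrict measurableSet_Ioc,
    inter_eq_left.2 (Ioc_subset_Ioc hs.1 ht)]
  exact hb

end Glue

namespace FormData

variable {S : System 𝕜 X U₁ U₂ Y} {V W : Type*} [NormedAddCommGroup V] [NormedSpace 𝕜 V]
  [NormedAddCommGroup W] [NormedSpace 𝕜 W] (D : FormData S V W) [NormedSpace ℝ X]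
  [IsScalarTower ℝ 𝕜 X] [CompleteSpace V] {T : ℝ} {u₁ : ℝ → U₁} {u : ℝ → U₂}

theorem exists_linSol (hT : 0 ≤ T) (z₀ : X) (hu₁ : MemLp u₁ 2 (volume.restrict (Ioc 0 T)))
    (hu : MemLp u 2 (volume.restrict (Ioc 0 T))) :
    ∃ x v, D.LinSol T z₀ (fun t => D.B₁ (u₁ t) + D.B₂ (u t)) x v ∧
      ∀ t ∈ Icc 0 T, ∃ φ₁ φ₂ : X,
        Extrapolation.of S.R φ₁ = S.inputIntegral S.B₁ t u₁ ∧
        Extrapolation.of S.R φ₂ = S.inputIntegral S.B₂ t u ∧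
        x t = S.semigroup.T t z₀ + φ₁ + φ₂ := by
  obtain ⟨v₀, h₀⟩ := D.exists_linSol_free hT z₀
  obtain ⟨φ₁, v₁, h₁, e₁⟩ := D.exists_linSol_input D.B₁ S.B₁ D.represents₁ hT hu₁
  obtain ⟨φ₂, v₂, h₂, e₂⟩ := D.exists_linSol_input D.B₂ S.B₂ D.represents₂ hT hu
  have h := (h₀.add h₁).add h₂
  rw [add_zero, add_zero, zero_add] at h
  exact ⟨_, _, h, fun t ht => ⟨φ₁ t, φ₂ t, e₁ t ht, e₂ t ht, rfl⟩⟩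

/-- There is an input `u ∈ L²(0, T; U₂)` that solves the fixed point equation `u = N(x, C x)` on
`(0, s]` for the trajectory `x` it generates. -/
def SolvableUntil (T : ℝ) (z₀ : X) (u₁ : ℝ → U₁) (s : ℝ) : Prop :=
  ∃ u x v, MemLp u 2 (volume.restrict (Ioc 0 T)) ∧
    D.LinSol T z₀ (fun t => D.B₁ (u₁ t) + D.B₂ (u t)) x v ∧
    ∀ᵐ a ∂volume.restrict (Ioc 0 s), u a = D.feedback (v a)

theorem norm_add_sq_le (f : ℝ → U₁) (g : ℝ → U₂) (a : ℝ) :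
    ‖D.B₁ (f a) + D.B₂ (g a)‖ ^ 2 ≤
      2 * (‖D.B₁‖ ^ 2 * ‖f a‖ ^ 2 + ‖D.B₂‖ ^ 2 * ‖g a‖ ^ 2) := by
  have h1 : ‖D.B₁ (f a) + D.B₂ (g a)‖ ≤ ‖D.B₁‖ * ‖f a‖ + ‖D.B₂‖ * ‖g a‖ :=
    (norm_add_le _ _).trans (add_le_add (D.B₁.le_opNorm _) (D.B₂.le_opNorm _))
  have h2 := pow_le_pow_left₀ (norm_nonneg _) h1 2
  nlinarith [sq_nonneg (‖D.B₁‖ * ‖f a‖ - ‖D.B₂‖ * ‖g a‖)]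

/-- If the closed-loop trajectories are bounded a priori, they can be continued by a fixed amount
of time. The continuation is a fixed point of the map `Φ` that sends an input on `(s, t]` to the
feedback of the trajectory it generates, a contraction of the unit ball of `L²(s, t; U₂)` when
`t - s` is small. -/
theorem exists_step (hT : 0 ≤ T) (z₀ : X) (hu₁ : MemLp u₁ 2 (volume.restrict (Ioc 0 T))) (r₀ : ℝ)
    (hr₀ : ∀ u x v, MemLp u 2 (volume.restrict (Ioc 0 T)) →
      D.LinSol T z₀ (fun t => D.B₁ (u₁ t) + D.B₂ (u t)) x v → ∀ s ∈ Icc 0 T,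
      (∀ᵐ a ∂volume.restrict (Ioc 0 s), u a = D.feedback (v a)) → ‖x s‖ ≤ r₀) :
    ∃ τ > 0, ∀ s ∈ Icc 0 T, D.SolvableUntil T z₀ u₁ s →
      D.SolvableUntil T z₀ u₁ (min (s + τ) T) := by
  have hα := D.α_pos
  obtain ⟨b, hb, hdiff⟩ := exists_linSol_sub_le D
  set G := ∫ a in Ioc 0 T, ‖u₁ a‖ ^ 2 with hG
  have hG0 : 0 ≤ G := integral_nonneg fun _ => by positivity
  -- the bound for the energy after the step, for inputs in the unit ball
  set e₀ := r₀ ^ 2 + D.α⁻¹ * (2 * (‖D.B₁‖ ^ 2 * G + ‖D.B₂‖ ^ 2)) with he₀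
  have he₀' : 0 ≤ e₀ := by positivity
  set r := √e₀ with hr
  have hr2 : r ^ 2 = e₀ := Real.sq_sqrt he₀'
  have hr' : 0 ≤ r := Real.sqrt_nonneg _
  set ρ := D.α⁻¹ * e₀ with hρ
  have hρ0 : 0 ≤ ρ := by positivity
  obtain ⟨τ, hτ, hlip⟩ := D.exists_feedback_lipschitz r ρ
    (ε := min (4 * b)⁻¹ (e₀ + ρ + 1)⁻¹) (by positivity)
  refine ⟨τ, hτ, ?_⟩
  rintro s hs ⟨u₀, x₀, v₀, hu₀, h₀, hF₀⟩
  set t := min (s + τ) T with ht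
  have hst : s ≤ t := le_min (by linarith) hs.2
  have htT : t ≤ T := min_le_right _ _
  have hsub : Ioc s t ⊆ Ioc 0 T := Ioc_subset_Ioc hs.1 htT
  have hle : volume.restrict (Ioc s t) ≤ volume.restrict (Ioc 0 T) :=
    Measure.restrict_mono hsub le_rfl
  have hts : t - s ≤ τ := by linarith [min_le_left (s + τ) T]
  set μ := volume.restrict (Ioc s t) with hμ
  have : Fact ((1 : ℝ≥0∞) ≤ 2) := ⟨by norm_num⟩
  -- the trajectory that continues the given one with the input `w` on `(s, t]`
  have hext : ∀ w : Lp U₂ 2 μ, MemLp (glue s t u₀ w) 2 (volume.restrict (Ioc 0 T)) := fun w =>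
    memLp_glue htT hs hu₀ (Lp.memLp w)
  have hex := fun w : Lp U₂ 2 μ => D.exists_linSol hT z₀ hu₁ (hext w)
  choose x v hxv _ using hex
  have hglue : ∀ w : Lp U₂ 2 μ, ∀ a ∈ Ioc s t, glue s t u₀ w a = w a := fun w a ha =>
    glue_of_mem_right ha
  have hdist : ∀ w w' : Lp U₂ 2 μ,
      ∫ a in Ioc s t, ‖glue s t u₀ w a - glue s t u₀ w' a‖ ^ 2 = dist w w' ^ 2 := by
    intro w w'
    rw [Lp.dist_def, sq_toReal_eLpNorm_two ((Lp.memLp w).sub (Lp.memLp w'))]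
    refine setIntegral_congr_fun measurableSet_Ioc fun a ha => ?_
    simp only [hglue w a ha, hglue w' a ha, Pi.sub_apply]
  have hx₀ : ∀ w, EqOn (x w) x₀ (Icc 0 s) := by
    intro w a ha
    have h1 := (hdiff (hext w) hu₀ (hxv w) h₀ le_rfl hs.1 hs.2
      (by rw [(hxv w).state_zero hT, h₀.state_zero hT])).1 a ha
    have h2 : ∫ a in Ioc 0 s, ‖glue s t u₀ w a - u₀ a‖ ^ 2 = 0 := by
      rw [setIntegral_congr_fun (g := fun _ => (0 : ℝ)) measurableSet_Ioc fun a ha => by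
        simp [glue_of_mem_left ha]]
      simp
    rw [h2, mul_zero] at h1
    exact sub_eq_zero.1 (norm_eq_zero.1 (pow_eq_zero_iff (two_ne_zero) |>.1
      (le_antisymm h1 (sq_nonneg _))))
  have hbound : ∀ w ∈ Metric.closedBall (0 : Lp U₂ 2 μ) 1, ∀ a ∈ Icc s t,
      ‖x w a‖ ^ 2 + D.α * ∫ c in Ioc s a, ‖v w c‖ ^ 2 ≤ e₀ := by
    intro w hw a ha
    have h1 := (hxv w).bound hs.1 ha.1 (ha.2.trans htT)
    have h2 : ‖x w s‖ ≤ r₀ := by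
      rw [hx₀ w ⟨hs.1, le_rfl⟩]
      exact hr₀ u₀ x₀ v₀ hu₀ h₀ s hs hF₀
    have h3 := pow_le_pow_left₀ (norm_nonneg _) h2 2
    have hw1 : ∫ c in Ioc s t, ‖w c‖ ^ 2 ≤ 1 := by
      rw [← sq_toReal_eLpNorm_two (Lp.memLp w), ← Lp.norm_def]
      rw [mem_closedBall_zero_iff] at hw
      exact pow_le_one₀ (norm_nonneg _) hw
    have i1 : IntegrableOn (fun c => ‖u₁ c‖ ^ 2) (Ioc 0 T) := integrable_norm_sq hu₁
    have i2 : IntegrableOn (fun c => ‖w c‖ ^ 2) (Ioc s t) := integrable_norm_sq (Lp.memLp w)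
    have hsa : Ioc s a ⊆ Ioc s t := Ioc_subset_Ioc_right ha.2
    have j1 : IntegrableOn (fun c => ‖D.B₁‖ ^ 2 * ‖u₁ c‖ ^ 2) (Ioc s a) :=
      (i1.mono_set (hsa.trans hsub)).const_mul _
    have j2 : IntegrableOn (fun c => ‖D.B₂‖ ^ 2 * ‖w c‖ ^ 2) (Ioc s a) :=
      (i2.mono_set hsa).const_mul _
    have h4 : ∫ c in Ioc s a, ‖D.B₁ (u₁ c) + D.B₂ (glue s t u₀ w c)‖ ^ 2 ≤
        2 * (‖D.B₁‖ ^ 2 * G + ‖D.B₂‖ ^ 2) := by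
      calc _ ≤ ∫ c in Ioc s a, 2 * (‖D.B₁‖ ^ 2 * ‖u₁ c‖ ^ 2 + ‖D.B₂‖ ^ 2 * ‖w c‖ ^ 2) := by
            refine setIntegral_mono_on
              (integrable_norm_sq ((hxv w).memLp_f_Ioc hs.1 (ha.2.trans htT)))
              ((j1.add j2).const_mul 2) measurableSet_Ioc fun c hc => ?_
            rw [hglue w c (hsa hc)]
            exact D.norm_add_sq_le u₁ w c
        _ = 2 * (‖D.B₁‖ ^ 2 * (∫ c in Ioc s a, ‖u₁ c‖ ^ 2) +
              ‖D.B₂‖ ^ 2 * ∫ c in Ioc s a, ‖w c‖ ^ 2) := by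
            rw [integral_const_mul, integral_add j1 j2, integral_const_mul, integral_const_mul]
        _ ≤ 2 * (‖D.B₁‖ ^ 2 * G + ‖D.B₂‖ ^ 2 * 1) := by
            have k1 : ∫ c in Ioc s a, ‖u₁ c‖ ^ 2 ≤ G := setIntegral_mono_set i1
              (Eventually.of_forall fun _ => by positivity) (hsa.trans hsub).eventuallyLE
            have k2 : ∫ c in Ioc s a, ‖w c‖ ^ 2 ≤ 1 := (setIntegral_mono_set i2
              (Eventually.of_forall fun _ => by positivity) hsa.eventuallyLE).trans hw1
            gcongr
        _ = _ := by rw [mul_one]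
    have h5 := mul_le_mul_of_nonneg_left h4 (inv_nonneg.2 hα.le)
    rw [he₀]
    linarith
  have hxr : ∀ w ∈ Metric.closedBall (0 : Lp U₂ 2 μ) 1, ∀ a ∈ Icc s t, ‖x w a‖ ≤ r := by
    intro w hw a ha
    have h1 := hbound w hw a ha
    have h2 : 0 ≤ D.α * ∫ c in Ioc s a, ‖v w c‖ ^ 2 :=
      mul_nonneg hα.le (integral_nonneg fun _ => by positivity)
    exact le_of_sq_le_sq (by rw [hr2]; linarith) hr'
  have hvρ : ∀ w ∈ Metric.closedBall (0 : Lp U₂ 2 μ) 1, ∫ c in Ioc s t, ‖v w c‖ ^ 2 ≤ ρ := by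
    intro w hw
    have h1 := hbound w hw t ⟨hst, le_rfl⟩
    rw [hρ, ← div_eq_inv_mul, le_div_iff₀' hα]
    linarith [sq_nonneg ‖x w t‖]
  have hvr : ∀ w ∈ Metric.closedBall (0 : Lp U₂ 2 μ) 1, ∀ᵐ a ∂μ, ‖D.incl (v w a)‖ ≤ r :=
    fun w hw => (hxv w).ae_norm_incl_le hs.1 htT (hxr w hw)
  have hvm : ∀ w, MemLp (v w) 2 μ := fun w => (hxv w).memLp_v_Ioc hs.1 htT
  classical
  set Φ : Lp U₂ 2 μ → Lp U₂ 2 μ := fun w =>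
    if h : MemLp (fun a => D.feedback (v w a)) 2 μ then h.toLp _ else 0 with hΦ
  have hfm : ∀ w ∈ Metric.closedBall (0 : Lp U₂ 2 μ) 1,
      MemLp (fun a => D.feedback (v w a)) 2 μ := fun w hw => D.memLp_feedback (hvm w) (hvr w hw)
  have hΦw : ∀ w (hw : w ∈ Metric.closedBall (0 : Lp U₂ 2 μ) 1),
      Φ w = (hfm w hw).toLp _ := fun w hw => dif_pos (hfm w hw)
  have hmaps : MapsTo Φ (Metric.closedBall 0 1) (Metric.closedBall 0 1) := by
    intro w hw
    rw [mem_closedBall_zero_iff, hΦw w hw, Lp.norm_toLp]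
    have h1 := hlip hst hts (v' := fun _ => 0) (E := e₀ + ρ) (hvm w) MemLp.zero' (hvr w hw)
      (by simp [hr']) (by
        filter_upwards [hvr w hw] with a ha
        rw [sub_zero]
        have := pow_le_pow_left₀ (norm_nonneg _) ha 2
        linarith) (hvρ w hw) (by
        simp only [sub_zero]
        linarith [hvρ w hw])
    simp only [D.feedback_zero, sub_zero] at h1
    rw [← sq_toReal_eLpNorm_two (hfm w hw)] at h1
    have h2 : min (4 * b)⁻¹ (e₀ + ρ + 1)⁻¹ * (e₀ + ρ) ≤ 1 := by
      refine (mul_le_mul_of_nonneg_right (min_le_right _ _) (by positivity)).trans ?_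
      rw [inv_mul_le_iff₀ (by positivity)]
      linarith
    exact (sq_le_one_iff₀ ENNReal.toReal_nonneg).1 (h1.trans h2)
  have hcontr : ∀ w ∈ Metric.closedBall (0 : Lp U₂ 2 μ) 1,
      ∀ w' ∈ Metric.closedBall (0 : Lp U₂ 2 μ) 1, dist (Φ w) (Φ w') ≤ 1 / 2 * dist w w' := by
    intro w hw w' hw'
    obtain ⟨d1, d2⟩ := hdiff (hext w) (hext w') (hxv w) (hxv w') hs.1 hst htT
      (by rw [hx₀ w ⟨hs.1, le_rfl⟩, hx₀ w' ⟨hs.1, le_rfl⟩])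
    rw [hdist] at d1 d2
    have h1 := hlip hst hts (hvm w) (hvm w') (hvr w hw) (hvr w' hw') (by
      filter_upwards [ae_mono hle (hxv w).incl_ae, ae_mono hle (hxv w').incl_ae,
        ae_restrict_mem measurableSet_Ioc] with a ha ha' hat
      rw [map_sub, ha, ha']
      exact d1 a (Ioc_subset_Icc_self hat)) (hvρ w hw) d2
    have h2 : min (4 * b)⁻¹ (e₀ + ρ + 1)⁻¹ * (b * dist w w' ^ 2) ≤ (1 / 2 * dist w w') ^ 2 := by
      refine (mul_le_mul_of_nonneg_right (min_le_left _ _) (by positivity)).trans (le_of_eq ?_)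
      field_simp
      ring
    refine le_of_sq_le_sq (le_trans (le_of_eq ?_) (h1.trans h2)) (by positivity)
    rw [hΦw w hw, hΦw w' hw', dist_edist, Lp.edist_toLp_toLp,
      sq_toReal_eLpNorm_two ((hfm w hw).sub (hfm w' hw'))]
    rfl
  obtain ⟨w, hw, hfix, -⟩ := ContractingWith.exists_fixedPoint' (K := 1 / 2) (f := Φ)
    (x := 0) (Metric.isClosed_closedBall (x := (0 : Lp U₂ 2 μ)) (ε := 1)).isComplete hmaps
    ⟨by rw [← NNReal.coe_lt_coe]; norm_num, LipschitzWith.of_dist_le_mul fun w w' => by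
      have := hcontr w w.2 w' w'.2
      rw [Subtype.dist_eq, Subtype.dist_eq]
      simpa using this⟩ (Metric.mem_closedBall_self zero_le_one) (edist_ne_top _ _)
  refine ⟨glue s t u₀ w, x w, v w, hext w, hxv w, ?_⟩
  have hst' : Ioc 0 t = Ioc 0 s ∪ Ioc s t := (Ioc_union_Ioc_eq_Ioc hs.1 hst).symm
  rw [hst', ae_restrict_union_iff]
  constructor
  · have hle0 : volume.restrict (Ioc 0 s) ≤ volume.restrict (Ioc 0 T) :=
      Measure.restrict_mono (Ioc_subset_Ioc_right hs.2) le_rfl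
    filter_upwards [hF₀, ae_mono hle0 h₀.incl_ae, ae_mono hle0 (hxv w).incl_ae,
      ae_restrict_mem measurableSet_Ioc] with a ha h1 h2 hat
    rw [glue_of_mem_left hat, ha]
    congr 1
    apply D.incl_injective
    rw [h1, h2, hx₀ w (Ioc_subset_Icc_self hat)]
  · have h1 : Φ w = w := hfix
    have h2 := (hfm w hw).coeFn_toLp
    rw [← hΦw w hw, h1] at h2
    filter_upwards [h2, ae_restrict_mem measurableSet_Ioc] with a ha hat
    rw [hglue w a hat, ha]

/-- Existence on bounded time intervals, from the a priori estimate. -/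
theorem HasDecay.solvableUntil (hD : D.HasDecay) (hT : 0 ≤ T) (z₀ : X)
    (hu₁ : MemLp u₁ 2 (volume.restrict (Ioc 0 T))) : D.SolvableUntil T z₀ u₁ T := by
  obtain ⟨ν, hν, c, hc, hbound⟩ := hD.exists_bound
  have hG0 : 0 ≤ ∫ a in Ioc 0 T, Real.exp (2 * ν * a) * ‖u₁ a‖ ^ 2 :=
    integral_nonneg fun _ => by positivity
  obtain ⟨τ, hτ, hstep⟩ := D.exists_step hT z₀ hu₁
    (√(‖z₀‖ ^ 2 + c ^ 2 * ∫ a in Ioc 0 T, Real.exp (2 * ν * a) * ‖u₁ a‖ ^ 2)) (by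
      intro u x v hu h s hs hF
      refine Real.le_sqrt_of_sq_le ?_
      have h1 := hbound hu₁ h s hs hF
      have h2 : ∫ a in Ioc 0 s, Real.exp (2 * ν * a) * ‖u₁ a‖ ^ 2 ≤
          ∫ a in Ioc 0 T, Real.exp (2 * ν * a) * ‖u₁ a‖ ^ 2 := by
        refine setIntegral_mono_set ?_ (Eventually.of_forall fun _ => by positivity)
          (Ioc_subset_Ioc_right hs.2).eventuallyLE
        refine (integrable_norm_sq hu₁).bdd_mul (c := Real.exp (2 * ν * T)) (by fun_prop) ?_
        filter_upwards [ae_restrict_mem measurableSet_Ioc] with r hr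
        rw [Real.norm_eq_abs, abs_of_pos (Real.exp_pos _), Real.exp_le_exp]
        have := hr.2
        gcongr
      have h3 : 1 * ‖x s‖ ^ 2 ≤ Real.exp (2 * ν * s) * ‖x s‖ ^ 2 := by
        refine mul_le_mul_of_nonneg_right (Real.one_le_exp ?_) (sq_nonneg _)
        have := hs.1
        positivity
      have h4 := mul_le_mul_of_nonneg_left h2 (sq_nonneg c)
      linarith)
  refine forall_of_step hτ hT ?_ hstep
  obtain ⟨x, v, h, -⟩ := D.exists_linSol hT z₀ hu₁ (MemLp.zero' (ε := U₂))
  exact ⟨_, x, v, MemLp.zero', h, by simp⟩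

end FormData

end BFS

/-! ### Global solutions and input-to-state stability -/

namespace BFS

variable {𝕜 X U₁ U₂ Y : Type*} [RCLike 𝕜]
  [NormedAddCommGroup X] [InnerProductSpace 𝕜 X] [CompleteSpace X]
  [NormedAddCommGroup U₁] [InnerProductSpace 𝕜 U₁] [CompleteSpace U₁]
  [NormedAddCommGroup U₂] [InnerProductSpace 𝕜 U₂] [CompleteSpace U₂]
  [NormedAddCommGroup Y] [InnerProductSpace 𝕜 Y] [CompleteSpace Y]

namespace FormData

section Global

variable {S : System 𝕜 X U₁ U₂ Y} {V W : Type*} [NormedAddCommGroup V] [NormedSpace 𝕜 V]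
  [NormedAddCommGroup W] [NormedSpace 𝕜 W] (D : FormData S V W) [NormedSpace ℝ X]
  [IsScalarTower ℝ 𝕜 X] [CompleteSpace V] {T : ℝ} {z₀ : X} {u₁ : ℝ → U₁} {u : ℝ → U₂}
  {x : ℝ → X} {v : ℝ → V}

variable {D} in
/-- A trajectory of the linear system satisfies the variation of constants formula. -/
theorem LinSol.state (h : D.LinSol T z₀ (fun t => D.B₁ (u₁ t) + D.B₂ (u t)) x v) (hT : 0 ≤ T)
    (hu₁ : MemLp u₁ 2 (volume.restrict (Ioc 0 T))) (hu : MemLp u 2 (volume.restrict (Ioc 0 T)))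
    {t : ℝ} (ht : t ∈ Icc 0 T) : ∃ φ₁ φ₂ : X,
      Extrapolation.of S.R φ₁ = S.inputIntegral S.B₁ t u₁ ∧
      Extrapolation.of S.R φ₂ = S.inputIntegral S.B₂ t u ∧
      x t = S.semigroup.T t z₀ + φ₁ + φ₂ := by
  obtain ⟨x', v', h', hs⟩ := D.exists_linSol hT z₀ hu₁ hu
  obtain ⟨b, hb, hdiff⟩ := exists_linSol_sub_le D
  have h1 := (hdiff hu hu h h' le_rfl hT le_rfl
    (by rw [h.state_zero hT, h'.state_zero hT])).1 t ht
  simp only [sub_self, norm_zero, ne_eq, OfNat.ofNat_ne_zero, not_false_eq_true, zero_pow,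
    integral_zero, mul_zero] at h1
  have h2 : x t = x' t := sub_eq_zero.1 (norm_eq_zero.1 (pow_eq_zero_iff (two_ne_zero) |>.1
    (le_antisymm h1 (sq_nonneg _))))
  rw [h2]
  exact hs t ht

/-- On bounded intervals a solution of the bilinear system is a fixed point: its trajectory solves
the linear system in `V`, with the feedback as an input. -/
theorem linSol_of_isSolutionOutput {z : ℝ → X} {y : ℝ → Y} (h : S.IsSolutionOutput z₀ u₁ z y)
    (hT : 0 < T) (hu₁ : MemLp u₁ 2 (volume.restrict (Ioc 0 T))) :
    ∃ v, MemLp (fun t => S.N (z t) (y t)) 2 (volume.restrict (Ioc 0 T)) ∧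
      D.LinSol T z₀ (fun t => D.B₁ (u₁ t) + D.B₂ (S.N (z t) (y t))) z v ∧
      ∀ᵐ t ∂volume.restrict (Ioc 0 T), S.N (z t) (y t) = D.feedback (v t) := by
  have hz : ContinuousOn z (Icc 0 T) := h.continuousOn.mono fun t ht => ht.1
  have hy := h.memL2Loc T hT
  obtain ⟨r, hr⟩ := isCompact_Icc.exists_bound_of_continuousOn hz
  have hu : MemLp (fun t => S.N (z t) (y t)) 2 (volume.restrict (Ioc 0 T)) := by
    refine MemLp.of_le_mul (c := ‖S.N‖ * r) hy
      (S.N.aestronglyMeasurable_comp₂ (memLp_two_of_continuousOn hz).1 hy.1) ?_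
    filter_upwards [ae_restrict_mem measurableSet_Ioc] with t ht
    refine (S.N.le_opNorm₂ _ _).trans ?_
    have := hr t (Ioc_subset_Icc_self ht)
    gcongr
  obtain ⟨x, v, hx, hs⟩ := D.exists_linSol hT.le z₀ hu₁ hu
  have hzx : EqOn z x (Icc 0 T) := by
    intro t ht
    obtain ⟨φ₁, φ₂, e1, e2, e3⟩ := h.state t ht.1
    obtain ⟨ψ₁, ψ₂, f1, f2, f3⟩ := hs t ht
    rw [e3, f3, S.extrapolation_of_injective (e1.trans f1.symm),
      S.extrapolation_of_injective (e2.trans f2.symm)]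
  have hz' := hx.congr_state hzx
  refine ⟨v, hu, hz', ?_⟩
  have hout : ∀ᵐ t ∂volume.restrict (Ioc 0 T), S.ι (y t) = S.C (z t) :=
    ae_mono (Measure.restrict_mono (fun t ht => ht.1) le_rfl) h.output
  filter_upwards [hout, hz'.incl_ae] with t h1 h2
  have h3 : y t = D.C (v t) := S.ι_injective (by rw [h1, D.ι_C, h2])
  rw [feedback, h2, h3]

include D in
theorem eqOn_of_isSolution (hu₁ : MemL2Loc u₁) {z z' : ℝ → X} (h : S.IsSolution z₀ u₁ z)
    (h' : S.IsSolution z₀ u₁ z') : EqOn z z' (Ici 0) := by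
  obtain ⟨y, hy⟩ := h
  obtain ⟨y', hy'⟩ := h'
  intro t ht
  have ht1 : 0 < t + 1 := by have := mem_Ici.1 ht; linarith
  obtain ⟨v, a1, a2, a3⟩ := D.linSol_of_isSolutionOutput hy ht1 (hu₁ _ ht1)
  obtain ⟨v', b1, b2, b3⟩ := D.linSol_of_isSolutionOutput hy' ht1 (hu₁ _ ht1)
  exact eqOn_of_feedback ht1.le a1 b1 a2 b2 a3 b3 ⟨ht, by linarith⟩

variable {D} in
/-- Global existence: the solutions on bounded intervals agree, by uniqueness. -/
theorem HasDecay.exists_isSolution (hD : D.HasDecay) (z₀ : X) (hu₁ : MemL2Loc u₁) :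
    ∃ z, S.IsSolution z₀ u₁ z := by
  have hpos : ∀ n : ℕ, (0 : ℝ) < n + 1 := fun n => by positivity
  have hex := fun n : ℕ => hD.solvableUntil D (hpos n).le z₀ (hu₁ _ (hpos n))
  choose u x v hu h hF using hex
  have hcons : ∀ (n m : ℕ) (t : ℝ), 0 ≤ t → t ≤ n + 1 → t ≤ m + 1 → x n t = x m t := by
    intro n m t ht hn hm
    have hle : ∀ k : ℕ, t ≤ k + 1 →
        volume.restrict (Ioc 0 t) ≤ volume.restrict (Ioc (0 : ℝ) (k + 1)) := fun k hk =>
      Measure.restrict_mono (Ioc_subset_Ioc_right hk) le_rfl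
    exact eqOn_of_feedback ht ((hu n).mono_measure (hle n hn)) ((hu m).mono_measure (hle m hm))
      ((h n).mono hn) ((h m).mono hm) (ae_mono (hle n hn) (hF n)) (ae_mono (hle m hm) (hF m))
      ⟨ht, le_rfl⟩
  -- the solution number `n` lives on `[0, n + 1]`, which contains `t` for `n = ⌊t⌋`
  set z : ℝ → X := fun t => x ⌊t⌋₊ t with hz
  set y : ℝ → Y := fun t => D.C (v ⌊t⌋₊ t) with hy
  have hfl : ∀ t : ℝ, t ≤ (⌊t⌋₊ : ℝ) + 1 := fun t => (Nat.lt_floor_add_one t).le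
  have hzn : ∀ (n : ℕ) (t : ℝ), t ∈ Icc (0 : ℝ) (n + 1) → z t = x n t := fun n t ht =>
    hcons _ _ t ht.1 (hfl t) ht.2
  have hincl : ∀ᵐ t : ℝ, ∀ n : ℕ, t ∈ Ioc (0 : ℝ) (n + 1) → D.incl (v n t) = x n t :=
    ae_all_iff.2 fun n => (ae_restrict_iff' measurableSet_Ioc).1 (h n).incl_ae
  have hyn : ∀ᵐ t : ℝ, ∀ n : ℕ, t ∈ Ioc (0 : ℝ) (n + 1) → y t = D.C (v n t) := by
    filter_upwards [hincl] with t ht n htn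
    change D.C _ = D.C _
    congr 1
    apply D.incl_injective
    rw [ht n htn, ht _ ⟨htn.1, hfl t⟩]
    exact hzn n t (Ioc_subset_Icc_self htn)
  refine ⟨z, y, ?_, ?_, ?_, ?_⟩
  · intro t ht
    have h1 : ContinuousWithinAt (x ⌊t⌋₊) (Ici 0) t :=
      ((h ⌊t⌋₊).continuousOn t ⟨ht, hfl t⟩).mono_of_mem_nhdsWithin (by
        rw [← Ici_inter_Iic]
        exact inter_mem self_mem_nhdsWithin
          (mem_nhdsWithin_of_mem_nhds (Iic_mem_nhds (Nat.lt_floor_add_one t))))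
    refine h1.congr_of_eventuallyEq ?_ rfl
    filter_upwards [self_mem_nhdsWithin, mem_nhdsWithin_of_mem_nhds
      (Iic_mem_nhds (Nat.lt_floor_add_one t))] with s hs hs'
    exact hzn _ s ⟨hs, hs'⟩
  · intro t ht
    have hsub : Ioc 0 t ⊆ Ioc (0 : ℝ) (⌊t⌋₊ + 1) := Ioc_subset_Ioc_right (hfl t)
    have h1 : MemLp (fun s => D.C (v ⌊t⌋₊ s)) 2 (volume.restrict (Ioc 0 t)) :=
      (D.C.comp_memLp' (h ⌊t⌋₊).memLp_v).mono_measure (Measure.restrict_mono hsub le_rfl)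
    refine (memLp_congr_ae ?_).1 h1
    filter_upwards [ae_restrict_of_ae hyn, ae_restrict_mem measurableSet_Ioc] with s hs hst
    exact (hs _ (hsub hst)).symm
  · intro t ht
    obtain ⟨φ₁, φ₂, e1, e2, e3⟩ := (h ⌊t⌋₊).state (hpos _).le (hu₁ _ (hpos _)) (hu _)
      (t := t) ⟨ht, hfl t⟩
    refine ⟨φ₁, φ₂, e1, e2.trans ?_, e3⟩
    refine intervalIntegral.integral_congr_ae ?_
    rw [uIoc_of_le ht]
    have hsub : Ioc 0 t ⊆ Ioc (0 : ℝ) (⌊t⌋₊ + 1) := Ioc_subset_Ioc_right (hfl t)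
    filter_upwards [hincl, hyn, (ae_restrict_iff' measurableSet_Ioc).1 (hF ⌊t⌋₊)]
      with s h1 h2 h3 hs
    have hs' := hsub hs
    rw [h3 hs', h2 _ hs', hzn _ s (Ioc_subset_Icc_self hs'), ← h1 _ hs']
    rfl
  · filter_upwards [ae_restrict_of_ae hincl, ae_restrict_mem measurableSet_Ioi] with t ht ht0
    rw [hy, hz, D.ι_C, ht _ ⟨ht0, hfl t⟩]

end Global

section Stability

variable {S : System 𝕜 X U₁ U₂ Y} {V W : Type*} [NormedAddCommGroup V] [NormedSpace 𝕜 V]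
  [NormedAddCommGroup W] [NormedSpace 𝕜 W] {D : FormData S V W} [CompleteSpace V]

/-- Unique solvability together with the exponential `L²`-estimate. -/
theorem HasDecay.exists_solution_estimate (hD : D.HasDecay) : ∃ ν > (0 : ℝ), ∃ c > (0 : ℝ),
    ∀ (z₀ : X) (u₁ : ℝ → U₁), MemL2Loc u₁ → ∃ z : ℝ → X, S.IsSolution z₀ u₁ z ∧
      (∀ z' : ℝ → X, S.IsSolution z₀ u₁ z' → EqOn z' z (Ici 0)) ∧
      ∀ t : ℝ, 0 ≤ t → ‖z t‖ ≤ ‖z₀‖ * Real.exp (-ν * t) + c * Real.exp (-ν * t) *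
        (eLpNorm (fun s => ((Real.exp (ν * s) : ℝ) : 𝕜) • u₁ s) 2
          (volume.restrict (Ioc 0 t))).toReal := by
  let _ : NormedSpace ℝ X := NormedSpace.restrictScalars ℝ 𝕜 X
  have : IsScalarTower ℝ 𝕜 X := RestrictScalars.isScalarTower ℝ 𝕜 X
  obtain ⟨ν, hν, c, hc, hbound⟩ := hD.exists_bound
  refine ⟨ν, hν, c, hc, fun z₀ u₁ hu₁ => ?_⟩
  obtain ⟨z, hz⟩ := hD.exists_isSolution z₀ hu₁
  refine ⟨z, hz, fun z' hz' => D.eqOn_of_isSolution hu₁ hz' hz, fun t ht => ?_⟩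
  obtain ⟨y, hy⟩ := hz
  have ht1 : 0 < t + 1 := by linarith
  have hle : volume.restrict (Ioc 0 t) ≤ volume.restrict (Ioc 0 (t + 1)) :=
    Measure.restrict_mono (Ioc_subset_Ioc_right (by linarith)) le_rfl
  obtain ⟨v, -, h2, h3⟩ := D.linSol_of_isSolutionOutput hy ht1 (hu₁ _ ht1)
  have h4 := hbound (hu₁ _ ht1) h2 t ⟨ht, by linarith⟩ (ae_mono hle h3)
  have hmem : MemLp (fun s => ((Real.exp (ν * s) : ℝ) : 𝕜) • u₁ s) 2
      (volume.restrict (Ioc 0 t)) := by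
    refine MemLp.of_le_mul (c := Real.exp (ν * t)) ((hu₁ _ ht1).mono_measure hle) ?_ ?_
    · have hc1 : Continuous fun s : ℝ => ((Real.exp (ν * s) : ℝ) : 𝕜) :=
        RCLike.continuous_ofReal.comp (by fun_prop)
      exact hc1.aestronglyMeasurable.smul ((hu₁ _ ht1).mono_measure hle).1
    · filter_upwards [ae_restrict_mem measurableSet_Ioc] with s hs
      rw [norm_smul, RCLike.norm_ofReal, abs_of_pos (Real.exp_pos _)]
      have := hs.2
      gcongr
  have h5 : ∫ a in Ioc 0 t, Real.exp (2 * ν * a) * ‖u₁ a‖ ^ 2 =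
      (eLpNorm (fun s => ((Real.exp (ν * s) : ℝ) : 𝕜) • u₁ s) 2
        (volume.restrict (Ioc 0 t))).toReal ^ 2 := by
    rw [sq_toReal_eLpNorm_two hmem]
    congr 1
    funext a
    rw [norm_smul, RCLike.norm_ofReal, abs_of_pos (Real.exp_pos _), mul_pow, ← Real.exp_nat_mul]
    congr 2
    push_cast
    ring
  rw [h5] at h4
  set L := (eLpNorm (fun s => ((Real.exp (ν * s) : ℝ) : 𝕜) • u₁ s) 2
        (volume.restrict (Ioc 0 t))).toReal
  have hL : 0 ≤ L := ENNReal.toReal_nonneg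
  have h6 : Real.exp (ν * t) * ‖z t‖ ≤ ‖z₀‖ + c * L := by
    refine le_of_sq_le_sq ?_ (by positivity)
    have e1 : Real.exp (2 * ν * t) = Real.exp (ν * t) ^ 2 := by
      rw [← Real.exp_nat_mul]
      congr 1
      push_cast
      ring
    rw [mul_pow, ← e1, add_sq, mul_pow]
    have : 0 ≤ 2 * ‖z₀‖ * (c * L) := by positivity
    linarith
  have h7 := mul_le_mul_of_nonneg_left h6 (Real.exp_pos (-ν * t)).le
  rw [← mul_assoc, ← Real.exp_add, neg_mul, neg_add_cancel, Real.exp_zero, one_mul] at h7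
  rw [neg_mul]
  linarith

end Stability

end FormData

/-- The weight `exp (-2 ν (t - s))` has total mass at most `1 / (2 ν)` on `(0, t]`. -/
theorem withDensity_exp_univ_le {ν : ℝ} (hν : 0 < ν) {t : ℝ} (ht : 0 ≤ t) :
    (volume.restrict (Ioc 0 t)).withDensity
      (fun s => ENNReal.ofReal (Real.exp (-(2 * ν) * (t - s)))) univ ≤
        ENNReal.ofReal (2 * ν)⁻¹ := by
  rw [withDensity_apply _ MeasurableSet.univ, Measure.restrict_univ,
    ← ofReal_integral_eq_lintegral_ofReal
      (Continuous.integrableOn_Ioc (by fun_prop))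
      (Eventually.of_forall fun s => (Real.exp_pos _).le)]
  refine ENNReal.ofReal_le_ofReal ?_
  have hd : ∀ s ∈ uIcc 0 t, HasDerivAt (fun s => (2 * ν)⁻¹ * Real.exp (-(2 * ν) * (t - s)))
      (Real.exp (-(2 * ν) * (t - s))) s := by
    intro s _
    have h1 := (((hasDerivAt_id s).const_sub t).const_mul (-(2 * ν))).exp.const_mul (2 * ν)⁻¹
    refine h1.congr_deriv ?_
    simp only [id]
    field_simp
  rw [← intervalIntegral.integral_of_le ht, intervalIntegral.integral_eq_sub_of_hasDerivAt hd
    (Continuous.intervalIntegrable (by fun_prop) _ _)]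
  have : 0 ≤ (2 * ν)⁻¹ * Real.exp (-(2 * ν) * (t - 0)) := by positivity
  simp only [sub_self, mul_zero, Real.exp_zero, mul_one]
  linarith

/-- The weighted `L²`-norm of the input is bounded by its `Lᵖ`-norm, for every `p ≥ 2`, uniformly
in time. -/
theorem exp_mul_eLpNorm_le {E : Type*} [NormedAddCommGroup E] [NormedSpace 𝕜 E] {ν : ℝ}
    (hν : 0 < ν) {p : ℝ≥0∞} (hp : 2 ≤ p) {t : ℝ} (ht : 0 ≤ t) {u : ℝ → E}
    (hu : MemLp u p (volume.restrict (Ioc 0 t))) :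
    Real.exp (-ν * t) * (eLpNorm (fun s => ((Real.exp (ν * s) : ℝ) : 𝕜) • u s) 2
      (volume.restrict (Ioc 0 t))).toReal ≤
        (1 + (2 * ν)⁻¹) * (eLpNorm u p (volume.restrict (Ioc 0 t))).toReal := by
  -- the left side is the norm in `L²` of the measure `m` with density `exp (-2 ν (t - s))`
  set μ := volume.restrict (Ioc 0 t) with hμ
  set ρ : ℝ → ℝ≥0∞ := fun s => ENNReal.ofReal (Real.exp (-(2 * ν) * (t - s))) with hρ
  have hρm : Measurable ρ := by fun_prop
  set m := μ.withDensity ρ with hm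
  have hmass : m univ ≤ ENNReal.ofReal (2 * ν)⁻¹ := withDensity_exp_univ_le hν ht
  have hmμ : m ≤ μ := by
    refine (withDensity_mono (μ := μ) (g := 1) ?_).trans_eq withDensity_one
    filter_upwards [ae_restrict_mem measurableSet_Ioc] with s hs
    simp only [hρ, Pi.one_apply]
    rw [← ENNReal.ofReal_one]
    refine ENNReal.ofReal_le_ofReal (Real.exp_le_one_iff.2 ?_)
    have := sub_nonneg.2 hs.2
    nlinarith
  have hfin : IsFiniteMeasure m := ⟨hmass.trans_lt ENNReal.ofReal_lt_top⟩
  have hu2 : MemLp u 2 μ := hu.mono_exponent hp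
  have hum : MemLp u 2 m := hu2.mono_measure hmμ
  have hmem : MemLp (fun s => ((Real.exp (ν * s) : ℝ) : 𝕜) • u s) 2 μ := by
    refine MemLp.of_le_mul (c := Real.exp (ν * t)) hu2 ?_ ?_
    · have hc1 : Continuous fun s : ℝ => ((Real.exp (ν * s) : ℝ) : 𝕜) :=
        RCLike.continuous_ofReal.comp (by fun_prop)
      exact hc1.aestronglyMeasurable.smul hu2.1
    · filter_upwards [ae_restrict_mem measurableSet_Ioc] with s hs
      rw [norm_smul, RCLike.norm_ofReal, abs_of_pos (Real.exp_pos _)]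
      have := hs.2
      gcongr
  have h1 : Real.exp (-ν * t) * (eLpNorm (fun s => ((Real.exp (ν * s) : ℝ) : 𝕜) • u s) 2 μ).toReal =
      (eLpNorm u 2 m).toReal := by
    rw [← sq_eq_sq₀ (by positivity) ENNReal.toReal_nonneg, mul_pow, sq_toReal_eLpNorm_two hmem,
      sq_toReal_eLpNorm_two hum, hm, hρ,
      integral_withDensity_eq_integral_toReal_smul (by fun_prop)
        (Eventually.of_forall fun _ => ENNReal.ofReal_lt_top), ← integral_const_mul]
    congr 1
    funext s
    rw [norm_smul, RCLike.norm_ofReal, abs_of_pos (Real.exp_pos _), mul_pow, ← Real.exp_nat_mul,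
      ← Real.exp_nat_mul, ← mul_assoc, ← Real.exp_add, ENNReal.toReal_ofReal (Real.exp_pos _).le,
      smul_eq_mul]
    congr 2
    push_cast
    ring
  rw [h1]
  -- the exponent of the total mass in Hölder's inequality; for `p = ∞` it is `1 / 2`, since
  -- `∞.toReal = 0` and `1 / 0 = 0`
  set e := 1 / (2 : ℝ≥0∞).toReal - 1 / p.toReal with he
  have he0 : 0 ≤ e := by
    rw [he, ENNReal.toReal_ofNat]
    rcases eq_or_ne p ∞ with rfl | hp'
    · norm_num
    · have h2 : (2 : ℝ) ≤ p.toReal := by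
        have := ENNReal.toReal_mono hp' hp
        simpa using this
      exact sub_nonneg.2 (one_div_le_one_div_of_le (by norm_num) h2)
  have he1 : e ≤ 1 := by
    have h2 : 0 ≤ 1 / p.toReal := by positivity
    rw [he, ENNReal.toReal_ofNat]
    linarith
  have h2 : m univ ^ e ≤ ENNReal.ofReal (1 + (2 * ν)⁻¹) := by
    have h3 : m univ ≤ ENNReal.ofReal (1 + (2 * ν)⁻¹) :=
      hmass.trans (ENNReal.ofReal_le_ofReal (by linarith))
    refine (ENNReal.rpow_le_rpow h3 he0).trans ?_
    refine (ENNReal.rpow_le_rpow_of_exponent_le ?_ he1).trans_eq (ENNReal.rpow_one _)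
    rw [← ENNReal.ofReal_one]
    have : 0 < (2 * ν)⁻¹ := by positivity
    exact ENNReal.ofReal_le_ofReal (by linarith)
  have h3 : eLpNorm u 2 m ≤ eLpNorm u p μ * ENNReal.ofReal (1 + (2 * ν)⁻¹) :=
    (eLpNorm_le_eLpNorm_mul_rpow_measure_univ hp hum.1).trans
      (mul_le_mul' (eLpNorm_mono_measure _ hmμ) h2)
  have h4 := ENNReal.toReal_mono (ENNReal.mul_ne_top hu.eLpNorm_ne_top ENNReal.ofReal_ne_top) h3
  rw [ENNReal.toReal_mul, ENNReal.toReal_ofReal (by positivity)] at h4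
  linarith

/-- Exponential decay is a comparison function of class `𝒦ℒ`. -/
theorem isKL_exp {ν : ℝ} (hν : 0 < ν) : IsKL fun s t => s * (Real.exp (-ν * t)).toNNReal where
  continuous := by
    simp only [Function.uncurry_def]
    fun_prop
  strictMono t := fun a b hab =>
    mul_lt_mul_of_pos_right hab (Real.toNNReal_pos.2 (Real.exp_pos _))
  map_zero t := zero_mul _
  strictAnti s hs := fun a b hab => by
    refine mul_lt_mul_of_pos_left ?_ hs
    rw [Real.toNNReal_lt_toNNReal_iff (Real.exp_pos _), Real.exp_lt_exp]
    have : (a : ℝ) < b := hab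
    nlinarith
  tendsto_zero s _ := by
    have h1 : Tendsto (fun t : ℝ≥0 => Real.exp (-ν * t)) atTop (𝓝 0) := by
      refine Real.tendsto_exp_atBot.comp ?_
      exact (NNReal.tendsto_coe_atTop.2 tendsto_id).const_mul_atTop_of_neg (neg_lt_zero.2 hν)
    have h2 := (((continuous_real_toNNReal.tendsto _).comp h1).const_mul s)
    simpa using h2

theorem isKInfty_mul {c : ℝ≥0} (hc : 0 < c) : IsKInfty fun s => c * s where
  continuous := by fun_prop
  map_zero := mul_zero _
  strictMono := fun _ _ hab => mul_lt_mul_of_pos_left hab hc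
  tendsto_atTop := tendsto_id.const_mul_atTop hc

theorem FormData.HasDecay.isLpISS {S : System 𝕜 X U₁ U₂ Y} {V W : Type*} [NormedAddCommGroup V]
    [NormedSpace 𝕜 V] [NormedAddCommGroup W] [NormedSpace 𝕜 W] {D : FormData S V W}
    [CompleteSpace V] (hD : D.HasDecay) {p : ℝ≥0∞} (hp : 2 ≤ p) : S.IsLpISS p := by
  obtain ⟨ν, hν, c, hc, hsol⟩ := hD.exists_solution_estimate
  have hc' : 0 < c * (1 + (2 * ν)⁻¹) := by positivity
  refine ⟨_, _, isKL_exp hν, isKInfty_mul (Real.toNNReal_pos.2 hc'), fun z₀ u₁ hu₁ => ?_⟩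
  have hu : ∀ t : ℝ, MemLp u₁ p (volume.restrict (Ioc 0 t)) := fun t =>
    hu₁.mono_measure (Measure.restrict_mono (fun s hs => hs.1) le_rfl)
  obtain ⟨z, hz, huniq, hest⟩ := hsol z₀ u₁ fun t _ => (hu t).mono_exponent hp
  refine ⟨z, hz, huniq, fun t => ?_⟩
  have h1 := hest t t.2
  have h2 := exp_mul_eLpNorm_le (𝕜 := 𝕜) hν hp t.2 (hu t)
  rw [← NNReal.coe_le_coe]
  push_cast
  rw [Real.coe_toNNReal _ (Real.exp_pos _).le, Real.coe_toNNReal _ hc'.le]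
  have h3 := mul_le_mul_of_nonneg_left h2 hc.le
  simp only [← mul_assoc] at h3
  exact h1.trans (add_le_add le_rfl h3)

end BFS

/-! ### The self-adjoint and the skew-adjoint case -/

namespace BFS

variable {𝕜 X U₁ U₂ Y : Type*} [RCLike 𝕜]
  [NormedAddCommGroup X] [InnerProductSpace 𝕜 X] [CompleteSpace X]
  [NormedAddCommGroup U₁] [InnerProductSpace 𝕜 U₁] [CompleteSpace U₁]
  [NormedAddCommGroup U₂] [InnerProductSpace 𝕜 U₂] [CompleteSpace U₂]
  [NormedAddCommGroup Y] [InnerProductSpace 𝕜 Y] [CompleteSpace Y]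

theorem abs_norm_sq_sub_norm_sq_le {E : Type*} [NormedAddCommGroup E] (a b : E) :
    |‖a‖ ^ 2 - ‖b‖ ^ 2| ≤ (‖a‖ + ‖b‖) * ‖a - b‖ := by
  rw [sq_sub_sq, abs_mul, abs_of_nonneg (by positivity : 0 ≤ ‖a‖ + ‖b‖)]
  exact mul_le_mul_of_nonneg_left (abs_norm_sub_norm_le _ _) (by positivity)

namespace Half

variable {A : X →ₗ.[𝕜] X} {w : ℝ} (h : IsStrictlyNegative A w)

theorem denseRange_of : DenseRange (Half.of h) :=
  UniformSpace.Completion.denseRange_coe (α := FormDomain h)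

theorem norm_of (x : A.domain) : ‖Half.of h x‖ = ‖FormDomain.of h x‖ :=
  UniformSpace.Completion.norm_coe (FormDomain.of h x)

theorem norm_sq_of (x : A.domain) : ‖Half.of h x‖ ^ 2 = -RCLike.re (inner 𝕜 (x : X) (A x)) := by
  rw [norm_of, FormDomain.norm_sq_of, inner_neg_right, map_neg]

/-- The inner product of `X_{1/2}` against an element of the domain extends `⟨-A x, v⟩` to all
`v ∈ X_{1/2}`. -/
theorem inner_of_left (x : A.domain) (v : Half h) :
    inner 𝕜 (Half.of h x) v = inner 𝕜 (-A x) (Half.incl h v) := by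
  have hf : (fun v : Half h => inner 𝕜 (Half.of h x) v) =
      fun v => inner 𝕜 (-A x) (Half.incl h v) := by
    refine (denseRange_of h).equalizer (by fun_prop) (by fun_prop) ?_
    funext y
    simp only [Function.comp_apply]
    rw [Half.incl_of, inner_neg_left, h.inner_comm, ← inner_neg_right, ← FormDomain.inner_of h]
    exact UniformSpace.Completion.inner_coe (FormDomain.of h x) (FormDomain.of h y)
  exact congrFun hf v

/-- The form is closable, so that its completion embeds in `X`. -/
theorem incl_injective : Function.Injective (Half.incl h) := by
  rw [injective_iff_map_eq_zero]
  intro v hv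
  have h1 : (fun u : Half h => inner 𝕜 u v) = fun _ => 0 := by
    refine (denseRange_of h).equalizer (by fun_prop) (by fun_prop) ?_
    funext x
    simp only [Function.comp_apply]
    rw [inner_of_left, hv, inner_zero_right]
  exact inner_self_eq_zero.1 (congrFun h1 v)

end Half

namespace System

variable {S : System 𝕜 X U₁ U₂ Y}

theorem R_surjective_domain (z : S.A.domain) : ∃ x, S.R x = z :=
  ⟨_, S.isResolvent.left_inv z⟩

theorem denseRange_R (h : Dense (S.A.domain : Set X)) : DenseRange S.R := by
  refine h.mono ?_
  intro z hz
  exact S.R_surjective_domain ⟨z, hz⟩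

variable (S) in
/-- The resolvent as a map to the domain. -/
def RDom : X →ₗ[𝕜] S.A.domain := S.R.toLinearMap.codRestrict S.A.domain S.isResolvent.mem_domain

theorem RDom_surjective : Function.Surjective S.RDom := by
  intro z
  obtain ⟨x, hx⟩ := S.R_surjective_domain z
  exact ⟨x, Subtype.ext hx⟩

theorem coe_RDom (x : X) : (S.RDom x : X) = S.R x := rfl

theorem A_RDom (x : X) : S.A (S.RDom x) = S.AR x := S.A_R x

namespace SelfAdjointCase

variable (a : S.SelfAdjointCase)

/-- The resolvent as a bounded operator from `X` to `X_{1/2}`. -/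
def res : X →L[𝕜] Half a.strictlyNegative :=
  LinearMap.mkContinuous ((Half.of a.strictlyNegative).comp S.RDom) (√(‖S.R‖ * ‖S.AR‖)) fun x => by
    refine le_of_sq_le_sq ?_ (by positivity)
    rw [LinearMap.comp_apply, Half.norm_sq_of, mul_pow, Real.sq_sqrt (by positivity), A_RDom,
      coe_RDom]
    refine (neg_le_abs _).trans ((RCLike.abs_re_le_norm _).trans
      ((norm_inner_le_norm _ _).trans ?_))
    refine (mul_le_mul (S.R.le_opNorm x) (S.AR.le_opNorm x) (norm_nonneg _)
      (by positivity)).trans (le_of_eq ?_)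
    ring

theorem res_apply (x : X) : a.res x = Half.of a.strictlyNegative (S.RDom x) := rfl

theorem denseRange_res : DenseRange a.res := by
  have e : range a.res = range (Half.of a.strictlyNegative) :=
    S.RDom_surjective.range_comp (Half.of a.strictlyNegative)
  rw [DenseRange, e]
  exact Half.denseRange_of a.strictlyNegative

/-- In the self-adjoint case the form domain is `X_{1/2}`, where `-⟨A z, z⟩` is the squared
norm. -/
def formData : FormData S (Half a.strictlyNegative) (NegHalf a.strictlyNegative) where
  incl := Half.incl a.strictlyNegative
  incl_injective := Half.incl_injective _
  res := a.res
  incl_res x := Half.incl_of _ _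
  denseRange_res := a.denseRange_res
  denseRange_R := S.denseRange_R a.strictlyNegative.isSelfAdjoint.dense_domain
  q v := -‖v‖ ^ 2
  q_res x := by
    rw [a.res_apply, Half.norm_sq_of, neg_neg]
    rfl
  M := 1
  abs_q_sub_le v v' := by
    rw [one_mul, neg_sub_neg, abs_sub_comm]
    exact abs_norm_sq_sub_norm_sq_le v v'
  α := 1
  α_pos := one_pos
  q_le_neg v := by rw [neg_one_mul]
  w := a.w
  q_le v := by
    have hcl : IsClosed {v : Half a.strictlyNegative |
        -‖v‖ ^ 2 ≤ a.w * ‖Half.incl a.strictlyNegative v‖ ^ 2} :=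
      isClosed_le (by fun_prop) (by fun_prop)
    refine (Half.denseRange_of a.strictlyNegative).induction_on v hcl fun x => ?_
    rw [Half.norm_sq_of, Half.incl_of, neg_neg]
    exact a.strictlyNegative.re_inner_le x
  w_neg := a.strictlyNegative.neg
  pair f v := f v
  pair_sub_left f g v := rfl
  pair_sub_right f v v' := map_sub f v v'
  norm_pair_le f v := f.le_opNorm v
  pivot := NegHalf.of a.strictlyNegative
  pair_pivot x v := NegHalf.of_apply _ x v
  B₁ := a.B₁
  B₂ := a.B₂
  represents₁ := a.represents₁
  represents₂ := a.represents₂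
  C := a.C
  ι_C_res x := by
    rw [a.res_apply, a.C_of, S.ι_C₁]
    rfl

theorem hasDecay_formData (h : a.HasDecay) : a.formData.HasDecay := by
  obtain ⟨m₁, m₂, h1, h2, h3⟩ := h
  refine ⟨m₁, m₂, h1, h2, fun v => ?_⟩
  change ‖a.B₂ (a.formData.feedback v) v‖ ≤
    -m₁ * -‖v‖ ^ 2 + m₂ * ‖Half.incl a.strictlyNegative v‖ ^ 2
  have hc := a.formData.continuous_feedback
  have hcl : IsClosed {v : Half a.strictlyNegative | ‖a.B₂ (a.formData.feedback v) v‖ ≤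
      -m₁ * -‖v‖ ^ 2 + m₂ * ‖Half.incl a.strictlyNegative v‖ ^ 2} := by
    simp_rw [← NegHalf.inner_adjoint]
    exact isClosed_le (by fun_prop) (by fun_prop)
  refine (Half.denseRange_of a.strictlyNegative).induction_on v hcl fun x => ?_
  have h4 := h3 x
  rw [NegHalf.inner_adjoint] at h4
  rw [Half.norm_sq_of, Half.incl_of, neg_neg]
  have e : a.formData.feedback (Half.of a.strictlyNegative x) =
      S.N x (S.C₁ (Interpolation.of S.A S.β x)) := by
    change S.N (Half.incl a.strictlyNegative (Half.of a.strictlyNegative x))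
      (a.C (Half.of a.strictlyNegative x)) = _
    rw [Half.incl_of, a.C_of]
  rw [e]
  exact h4

end SelfAdjointCase

namespace SkewAdjointCase

variable (a : S.SkewAdjointCase)

theorem re_inner_A₀ (z : a.A₀.domain) : RCLike.re (inner 𝕜 (z : X) (a.A₀ z)) = 0 := by
  have h1 := LinearPMap.adjoint_isFormalAdjoint a.dense_domain
  rw [a.skewAdjoint] at h1
  have h2 := congrArg RCLike.re (h1 z z)
  have h3 : (-a.A₀) z = -a.A₀ z := rfl
  rw [h3, inner_neg_left, map_neg, inner_re_symm] at h2
  linarith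

/-- The equation `A = A₀ + L`, pointwise on the domain. -/
theorem exists_A_eq (z : S.A.domain) : ∃ hz : (z : X) ∈ a.A₀.domain,
    S.A z = a.A₀ ⟨z, hz⟩ + a.L z := by
  have key : ∀ (B : X →ₗ.[𝕜] X), B = a.A₀ + a.L.toLinearMap.toPMap ⊤ → ∀ z : B.domain,
      ∃ hz : (z : X) ∈ a.A₀.domain, B z = a.A₀ ⟨z, hz⟩ + a.L z := by
    rintro B rfl z
    exact ⟨z.2.1, LinearPMap.add_apply _ _ z⟩
  exact key S.A a.eq_add z

theorem re_inner_A (z : S.A.domain) :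
    RCLike.re (inner 𝕜 (z : X) (S.A z)) = RCLike.re (inner 𝕜 (z : X) (a.L z)) := by
  obtain ⟨hz, e⟩ := a.exists_A_eq z
  rw [e, inner_add_right, map_add, a.re_inner_A₀ ⟨z, hz⟩, zero_add]

include a in
theorem dense_domain_A : Dense (S.A.domain : Set X) := by
  have e : S.A.domain = a.A₀.domain := by
    rw [a.eq_add, LinearPMap.add_domain]
    exact inf_top_eq _
  rw [e]
  exact a.dense_domain

/-- In the skew-adjoint case the form domain is `X` itself, and only the bounded part `L` of the
generator contributes to the form. -/
def formData : FormData S X X where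
  incl := ContinuousLinearMap.id 𝕜 X
  incl_injective := Function.injective_id
  res := S.R
  incl_res _ := rfl
  denseRange_res := S.denseRange_R a.dense_domain_A
  denseRange_R := S.denseRange_R a.dense_domain_A
  q v := RCLike.re (inner 𝕜 v (a.L v))
  q_res x := (a.re_inner_A ⟨S.R x, S.isResolvent.mem_domain x⟩).symm
  M := ‖a.L‖
  abs_q_sub_le v v' := by
    have e : inner 𝕜 v (a.L v) - inner 𝕜 v' (a.L v') =
        inner 𝕜 v (a.L (v - v')) + inner 𝕜 (v - v') (a.L v') := by
      rw [map_sub, inner_sub_left, inner_sub_right]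
      ring
    rw [← map_sub, e]
    refine (RCLike.abs_re_le_norm _).trans ((norm_add_le _ _).trans ?_)
    have h1 : ‖inner 𝕜 v (a.L (v - v'))‖ ≤ ‖v‖ * (‖a.L‖ * ‖v - v'‖) :=
      (norm_inner_le_norm _ _).trans (by gcongr; exact a.L.le_opNorm _)
    have h2 : ‖inner 𝕜 (v - v') (a.L v')‖ ≤ ‖v - v'‖ * (‖a.L‖ * ‖v'‖) :=
      (norm_inner_le_norm _ _).trans (by gcongr; exact a.L.le_opNorm _)
    linarith
  α := -a.w
  α_pos := neg_pos.2 a.neg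
  q_le_neg v := by
    rw [neg_neg]
    exact a.re_inner_le v
  w := a.w
  q_le := a.re_inner_le
  w_neg := a.neg
  pair f v := inner 𝕜 v f
  pair_sub_left f g v := inner_sub_right v f g
  pair_sub_right f v v' := inner_sub_left v v' f
  norm_pair_le f v := (norm_inner_le_norm v f).trans_eq (mul_comm _ _)
  pivot := ContinuousLinearMap.id 𝕜 X
  pair_pivot _ _ := rfl
  B₁ := a.B₁
  B₂ := a.B₂
  represents₁ u := subset_closure ⟨a.B₁ u, Prod.ext rfl (a.of_B₁ u)⟩
  represents₂ u := subset_closure ⟨a.B₂ u, Prod.ext rfl (a.of_B₂ u)⟩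
  C := a.C
  ι_C_res x := by
    rw [← S.coe_RDom, a.C_coe, S.ι_C₁]

theorem hasDecay_formData (h : a.HasDecay) : a.formData.HasDecay := by
  obtain ⟨m₁, m₂, h1, h2, h3⟩ := h
  refine ⟨m₁, m₂, h1, h2, fun v => ?_⟩
  change ‖inner 𝕜 v (a.B₂ (S.N v (a.C v)))‖ ≤
    -m₁ * RCLike.re (inner 𝕜 v (a.L v)) + m₂ * ‖v‖ ^ 2
  have hcl : IsClosed {v : X | ‖inner 𝕜 v (a.B₂ (S.N v (a.C v)))‖ ≤
      -m₁ * RCLike.re (inner 𝕜 v (a.L v)) + m₂ * ‖v‖ ^ 2} := by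
    have hre : Continuous (RCLike.re : 𝕜 → ℝ) := RCLike.continuous_re
    refine isClosed_le (by fun_prop) ?_
    exact (continuous_const.mul (hre.comp (by fun_prop))).add (by fun_prop)
  have hd : closure (S.A.domain : Set X) ⊆ _ := closure_minimal (fun x hx => ?_) hcl
  · exact hd (a.dense_domain_A v)
  · have h4 := h3 ⟨x, hx⟩
    rw [ContinuousLinearMap.adjoint_inner_left, a.re_inner_A, ← a.C_coe] at h4
    exact h4

end SkewAdjointCase

end System

end BFS

theorem mainTheorem3 {𝕜 X U₁ U₂ Y : Type*} [RCLike 𝕜]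
    [NormedAddCommGroup X] [InnerProductSpace 𝕜 X] [CompleteSpace X]
    [NormedAddCommGroup U₁] [InnerProductSpace 𝕜 U₁] [CompleteSpace U₁]
    [NormedAddCommGroup U₂] [InnerProductSpace 𝕜 U₂] [CompleteSpace U₂]
    [NormedAddCommGroup Y] [InnerProductSpace 𝕜 Y] [CompleteSpace Y]
    (S : BFS.System 𝕜 X U₁ U₂ Y)
    (hS : (∃ a : S.SelfAdjointCase, a.HasDecay) ∨ (∃ a : S.SkewAdjointCase, a.HasDecay)) :
    (∃ ν > (0 : ℝ), ∃ c > (0 : ℝ), ∀ (z₀ : X) (u₁ : ℝ → U₁), BFS.MemL2Loc u₁ →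
      ∃ z : ℝ → X, S.IsSolution z₀ u₁ z ∧
        ∀ t : ℝ, 0 ≤ t →
          ‖z t‖ ≤ ‖z₀‖ * Real.exp (-ν * t) + c * Real.exp (-ν * t) *
            (MeasureTheory.eLpNorm (fun s => ((Real.exp (ν * s) : ℝ) : 𝕜) • u₁ s) 2
              (MeasureTheory.volume.restrict (Set.Ioc 0 t))).toReal) ∧
    ∀ p : ENNReal, 2 ≤ p → S.IsLpISS p := by
  rcases hS with ⟨a, ha⟩ | ⟨a, ha⟩
  · have hD := a.hasDecay_formData ha
    obtain ⟨ν, hν, c, hc, h⟩ := hD.exists_solution_estimate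
    refine ⟨⟨ν, hν, c, hc, fun z₀ u₁ hu₁ => ?_⟩, fun p hp => hD.isLpISS hp⟩
    obtain ⟨z, hz, -, hest⟩ := h z₀ u₁ hu₁
    exact ⟨z, hz, hest⟩
  · have hD := a.hasDecay_formData ha
    obtain ⟨ν, hν, c, hc, h⟩ := hD.exists_solution_estimate
    refine ⟨⟨ν, hν, c, hc, fun z₀ u₁ hu₁ => ?_⟩, fun p hp => hD.isLpISS hp⟩
    obtain ⟨z, hz, -, hest⟩ := h z₀ u₁ hu₁
    exact ⟨z, hz, hest⟩

end
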